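/- Conventions. A unitary ribbon fusion category (URFC) is a semisimple abelian $\mathbb{C}$-linear rigid monoidal category with finite-dimensional morphism spaces, finitely many isomorphism classes of simple objects and simple unit, equipped with a braiding $c$, a ribbon twist $\theta$, and a compatible $C^*$-structure for which the structural isomorphisms are unitary and the quantum trace is positive (so all quantum dimensions $d_a$ are positive). It is a unitary modular category if its $S$-matrix $\tilde s_{ab}=\operatorname{Tr}(c_{X_b,X_a}c_{X_a,X_b})$, indexed by the isomorphism classes of simple objects, is invertible. A fusion subcategory is a full subcategory containing the unit and closed under tensor products, duals, finite direct sums and direct summands; it is modular if its own $S$-matrix is invertible. The dimension of a (full, direct-sum and summand closed) subcategory is $\dim=\sum_a d_a^2$ over its isomorphism classes of simple objects. A fermion in a URFC is a simple object $f$ with $f\otimes f\cong\mathbf 1$ and $\theta_f=-1$. $\mathrm{sVec}$ is the unitary symmetric ribbon category of finite-dimensional complex super vector spaces, with braiding $x\otimes y\mapsto(-1)^{|x||y|}y\otimes x$ and with twist the parity. $\boxtimes$ denotes the Deligne product. A spin modular category is a pair $(\mathcal C,f)$ with $\mathcal C$ a unitary modular category and $f$ a fermion in $\mathcal C$. Its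 trivial sector $\mathcal C_0\subset\mathcal C$ is the full subcategory of the objects $X$ with $c_{X,f}\circ c_{f,X}=\operatorname{Id}_{f\otimes X}$, i.e. of the direct sums of simple objects whose double braiding with $f$ is trivial; it is a super-modular category. $\mathcal C_0$ is called split super-modular if $\mathcal C_0\cong\mathrm{sVec}\boxtimes\mathcal M$, as ribbon categories, for some unitary modular category $\mathcal M$. Theorem. Let $(\mathcal C,f)$ be a spin modular category and $\mathcal C_0$ its trivial sector. Then the following are equivalent: (i) $\mathcal C_0$ is split super-modular. (ii) $\mathcal C_0$ contains a modular fusion subcategory of dimension $\dim(\mathcal C_0)/2$. (iii) $\mathcal C$ contains a modular fusion subcategory of dimension $4$ that contains $f$. -/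

import Mathlib

open CategoryTheory CategoryTheory.Limits CategoryTheory.MonoidalCategory
open scoped TensorProduct

universe v u

noncomputable section

namespace SpinModular

/-! ### Ribbon structures and quantum traces -/

/-- A balanced structure (twist) on a braided monoidal category. -/
class BalancedCategory (C : Type u) [Category.{v} C] [MonoidalCategory C] [BraidedCategory C] where
  twist : ∀ X : C, X ≅ X
  twist_naturality : ∀ {X Y : C} (f : X ⟶ Y), f ≫ (twist Y).hom = (twist X).hom ≫ f
  twist_tensor : ∀ X Y : C, (twist (X ⊗ Y)).hom =
    ((twist X).hom ⊗ₘ (twist Y).hom) ≫ (β_ X Y).hom ≫ (β_ Y X).hom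

/-- The quantum trace of an endomorphism in a balanced rigid category, as an endomorphism of the
unit: coevaluation, `f` followed by the twist, braiding, evaluation. -/
def qtrace {C : Type u} [Category.{v} C] [MonoidalCategory C] [BraidedCategory C]
    [BalancedCategory C] [RightRigidCategory C] {X : C} (f : X ⟶ X) : 𝟙_ C ⟶ 𝟙_ C :=
  η_ X Xᘁ ≫ (f ≫ (BalancedCategory.twist X).hom) ▷ Xᘁ ≫ (β_ X Xᘁ).hom ≫ ε_ X Xᘁ

/-- `Z` is a direct sum of the finite family `X`. -/
def IsDirectSum {C : Type u} [Category.{v} C] [Preadditive C] {n : ℕ} (Z : C) (X : Fin n → C) :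
    Prop :=
  ∃ b : Bicone X, Nonempty b.IsBilimit ∧ Nonempty (Z ≅ b.pt)

/-- Isomorphism classes of simple objects. -/
def Label (C : Type u) [Category.{v} C] [HasZeroMorphisms C] : Type u :=
  Quotient ((isIsomorphicSetoid C).comap (Subtype.val : {X : C // Simple X} → C))

/-! ### Unitary ribbon fusion categories -/

/-- A unitary ribbon fusion category over `ℂ`: a semisimple abelian `ℂ`-linear rigid monoidal
category with finite-dimensional morphism spaces, finitely many isomorphism classes of simple
objects and simple unit; with a braiding and a ribbon twist; and with a compatible C*-structure
`dag` for which the structural isomorphisms are unitary and the quantum trace is positive (so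
that all quantum dimensions are positive). -/
class UnitaryRibbonFusionCategory (C : Type u) [Category.{v} C] extends
    Abelian C, Linear ℂ C, MonoidalCategory C, MonoidalPreadditive C, MonoidalLinear ℂ C,
    BraidedCategory C, RigidCategory C, BalancedCategory C where
  /- semisimple and finite -/
  finiteDimensional_hom : ∀ X Y : C, FiniteDimensional ℂ (X ⟶ Y)
  semisimple : ∀ X : C, ∃ (n : ℕ) (S : Fin n → C), (∀ i, Simple (S i)) ∧ IsDirectSum X S
  finite_label : Finite (Label C)
  simple_unit : Simple (𝟙_ C)
  /- ribbon -/
  twist_dual : ∀ X : C, (twist Xᘁ).hom = (twist X).homᘁ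
  /- C*-structure -/
  dag : ∀ {X Y : C}, (X ⟶ Y) → (Y ⟶ X)
  dag_id : ∀ X : C, dag (𝟙 X) = 𝟙 X
  dag_comp : ∀ {X Y Z : C} (f : X ⟶ Y) (g : Y ⟶ Z), dag (f ≫ g) = dag g ≫ dag f
  dag_dag : ∀ {X Y : C} (f : X ⟶ Y), dag (dag f) = f
  dag_add : ∀ {X Y : C} (f g : X ⟶ Y), dag (f + g) = dag f + dag g
  dag_smul : ∀ {X Y : C} (c : ℂ) (f : X ⟶ Y), dag (c • f) = (starRingEnd ℂ) c • dag f
  dag_definite : ∀ {X Y : C} (f : X ⟶ Y), f ≫ dag f = 0 → f = 0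
  dag_positive : ∀ {X Y : C} (f : X ⟶ Y), ∃ g : X ⟶ X, f ≫ dag f = g ≫ dag g
  /- unitarity of the monoidal, braided and ribbon structure -/
  dag_tensor : ∀ {X Y X' Y' : C} (f : X ⟶ Y) (g : X' ⟶ Y'), dag (f ⊗ₘ g) = dag f ⊗ₘ dag g
  dag_associator : ∀ X Y Z : C, dag (α_ X Y Z).hom = (α_ X Y Z).inv
  dag_leftUnitor : ∀ X : C, dag (λ_ X).hom = (λ_ X).inv
  dag_rightUnitor : ∀ X : C, dag (ρ_ X).hom = (ρ_ X).inv
  dag_braiding : ∀ X Y : C, dag (β_ X Y).hom = (β_ X Y).inv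
  dag_twist : ∀ X : C, dag (twist X).hom = (twist X).inv
  qtrace_pos : ∀ {X Y : C} (f : X ⟶ Y), f ≠ 0 →
    ∃ r : ℝ, 0 < r ∧ qtrace (f ≫ dag f) = (r : ℂ) • 𝟙 (𝟙_ C)

section Dimensions

variable {C : Type u} [Category.{v} C] [UnitaryRibbonFusionCategory C]

instance : Finite (Label C) := UnitaryRibbonFusionCategory.finite_label

instance : Fintype (Label C) := Fintype.ofFinite _

lemma exists_scalar (f : 𝟙_ C ⟶ 𝟙_ C) : ∃ c : ℂ, c • 𝟙 (𝟙_ C) = f :=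
  haveI := UnitaryRibbonFusionCategory.simple_unit (C := C)
  haveI := UnitaryRibbonFusionCategory.finiteDimensional_hom (𝟙_ C) (𝟙_ C)
  endomorphism_simple_eq_smul_id ℂ f

/-- The scalar by which an endomorphism of the unit acts. -/
def toScalar (f : 𝟙_ C ⟶ 𝟙_ C) : ℂ := (exists_scalar f).choose

lemma toScalar_smul (f : 𝟙_ C ⟶ 𝟙_ C) : toScalar f • 𝟙 (𝟙_ C) = f := (exists_scalar f).choose_spec

/-- The quantum dimension. -/
def qdim (X : C) : ℂ := toScalar (qtrace (𝟙 X))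

/-- A representative simple object of a label. -/
def Label.rep (a : Label C) : C := (Quotient.out a).val

/-- The labels of the simple objects with property `P`. -/
def labels (P : ObjectProperty C) : Set (Label C) := {a | P a.rep}

instance (P : ObjectProperty C) : Fintype (labels P) := Fintype.ofFinite _

/-- The unnormalized S-matrix. -/
def sMatrix (C : Type u) [Category.{v} C] [UnitaryRibbonFusionCategory C] :
    Matrix (Label C) (Label C) ℂ :=
  fun a b => toScalar (qtrace ((β_ a.rep b.rep).hom ≫ (β_ b.rep a.rep).hom))

/-- The dimension `∑ d_a ^ 2` of the full subcategory of objects with property `P`. -/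
def globalDim (P : ObjectProperty C) : ℂ := ∑ a : labels P, qdim a.1.rep ^ 2

/-- Fusion subcategories: full subcategories containing the unit and closed under tensor products,
duals, finite direct sums and direct summands (in particular under isomorphism). -/
structure IsFusionSubcategory (P : ObjectProperty C) : Prop where
  unit : P (𝟙_ C)
  tensor : ∀ X Y : C, P X → P Y → P (X ⊗ Y)
  dual : ∀ X : C, P X → P Xᘁ
  biprod : ∀ X Y : C, P X → P Y → P (X ⊞ Y)
  summand : ∀ X Y : C, Retract X Y → P Y → P X

open scoped Classical in
/-- A fusion subcategory is modular if its S-matrix is nondegenerate. -/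
structure IsModularSubcategory (P : ObjectProperty C) : Prop extends IsFusionSubcategory P where
  det_ne_zero : ((sMatrix C).submatrix (Subtype.val : labels P → Label C) Subtype.val).det ≠ 0

open scoped Classical in
/-- A unitary ribbon fusion category is (unitary) modular if its S-matrix is nondegenerate. -/
def IsModular (C : Type u) [Category.{v} C] [UnitaryRibbonFusionCategory C] : Prop :=
  (sMatrix C).det ≠ 0

/-- A fermion: a simple object `f` with `f ⊗ f ≅ 𝟙` and twist `-1`. -/
structure IsFermion (f : C) : Prop where
  simple : Simple f
  tensor_self : Nonempty (f ⊗ f ≅ 𝟙_ C)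
  twist : (BalancedCategory.twist f).hom = -𝟙 f

/-- The trivial sector: the objects `X` whose double braiding with `f` is the identity, that is,
the direct sums of simple objects `X_a` with sign `ε_a = 1`. -/
def trivialSector (f : C) : ObjectProperty C :=
  fun X => (β_ f X).hom ≫ (β_ X f).hom = 𝟙 (f ⊗ X)

instance (f : C) : (trivialSector f).IsMonoidal where
  prop_unit := by
    change (β_ f (𝟙_ C)).hom ≫ (β_ (𝟙_ C) f).hom = 𝟙 _
    simp
  prop_tensor X Y hX hY := by
    change (β_ f (X ⊗ Y)).hom ≫ (β_ (X ⊗ Y) f).hom = 𝟙 _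
    change (β_ f X).hom ≫ (β_ X f).hom = 𝟙 _ at hX
    change (β_ f Y).hom ≫ (β_ Y f).hom = 𝟙 _ at hY
    simp only [BraidedCategory.braiding_tensor_right_hom, BraidedCategory.braiding_tensor_left_hom,
      Category.assoc, Iso.inv_hom_id_assoc, ← whiskerLeft_comp_assoc, hY]
    simp [← comp_whiskerRight_assoc, hX]

end Dimensions

/-! ### Balanced structures on full subcategories and products -/

instance {C : Type u} [Category.{v} C] [MonoidalCategory C] [BraidedCategory C]
    [BalancedCategory C] (P : ObjectProperty C) [P.IsMonoidal] :
    BalancedCategory P.FullSubcategory where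
  twist X := P.isoMk (BalancedCategory.twist X.obj)
  twist_naturality f := by
    ext
    exact BalancedCategory.twist_naturality f.hom
  twist_tensor X Y := by
    ext
    exact BalancedCategory.twist_tensor X.obj Y.obj

section Products

variable {C : Type*} [Category* C] [MonoidalCategory C] [BraidedCategory C]
  {D : Type*} [Category* D] [MonoidalCategory D] [BraidedCategory D]

instance : BraidedCategory (C × D) where
  braiding X Y := (β_ X.1 Y.1).prod (β_ X.2 Y.2)

instance [BalancedCategory C] [BalancedCategory D] : BalancedCategory (C × D) where
  twist X := (BalancedCategory.twist X.1).prod (BalancedCategory.twist X.2)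
  twist_naturality f := Prod.hom_ext (BalancedCategory.twist_naturality f.1)
    (BalancedCategory.twist_naturality f.2)
  twist_tensor X Y := Prod.hom_ext (BalancedCategory.twist_tensor X.1 Y.1)
    (BalancedCategory.twist_tensor X.2 Y.2)

end Products

/-! ### Super vector spaces -/

/-- Finite-dimensional super vector spaces, as finite-dimensional complex representations of the
group `ℤˣ = {1, -1}` of order two: the even (odd) part is the subspace on which `-1` acts by
`1` (by `-1`), and a tensor product carries the diagonal action. -/
def SVec : Type 1 := Action (FGModuleCat.{0} ℂ) ℤˣ

namespace SVec

instance : Category.{0} SVec := inferInstanceAs (Category (Action (FGModuleCat.{0} ℂ) ℤˣ))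
instance : Preadditive SVec := inferInstanceAs (Preadditive (Action (FGModuleCat.{0} ℂ) ℤˣ))
instance : Linear ℂ SVec := inferInstanceAs (Linear ℂ (Action (FGModuleCat.{0} ℂ) ℤˣ))
instance : MonoidalCategory SVec :=
  inferInstanceAs (MonoidalCategory (Action (FGModuleCat.{0} ℂ) ℤˣ))
instance : MonoidalPreadditive SVec :=
  inferInstanceAs (MonoidalPreadditive (Action (FGModuleCat.{0} ℂ) ℤˣ))
instance : MonoidalLinear ℂ SVec :=
  inferInstanceAs (MonoidalLinear ℂ (Action (FGModuleCat.{0} ℂ) ℤˣ))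

/-- The parity involution: the action of `-1`. -/
def parity (V : SVec) : V ⟶ V where
  hom := Action.ρ V (-1)
  comm g := by
    have h := (Action.ρ V).map_mul g (-1)
    have h' := (Action.ρ V).map_mul (-1) g
    rw [mul_comm] at h'
    exact h'.symm.trans h

lemma parity_parity (V : SVec) : parity V ≫ parity V = 𝟙 V := by
  apply Action.Hom.ext
  exact ((Action.ρ V).map_mul (-1) (-1)).symm.trans (by simp; rfl)

lemma parity_naturality {V W : SVec} (f : V ⟶ W) : f ≫ parity W = parity V ≫ f := by
  apply Action.Hom.ext
  exact (Action.Hom.comm f (-1)).symm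

lemma parity_tensor (V W : SVec) : parity (V ⊗ W) = parity V ⊗ₘ parity W := rfl

/-- The flip `v ⊗ w ↦ w ⊗ v`. -/
def plainBraiding (V W : SVec) : V ⊗ W ≅ W ⊗ V :=
  BraidedCategory.braiding (C := Action (FGModuleCat.{0} ℂ) ℤˣ) V W

/-- The sign `(-1) ^ (|v| * |w|)` on homogeneous `v ⊗ w`. -/
def sign (V W : SVec) : V ⊗ W ⟶ V ⊗ W :=
  (1 / 2 : ℂ) • (𝟙 (V ⊗ W) + parity V ▷ W + V ◁ parity W - (parity V ⊗ₘ parity W))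

lemma sign_sign (V W : SVec) : sign V W ≫ sign V W = 𝟙 _ := by
  have h1 : parity V ▷ W ≫ parity V ▷ W = 𝟙 _ := by
    rw [← comp_whiskerRight, parity_parity, id_whiskerRight]
  have h2 : V ◁ parity W ≫ V ◁ parity W = 𝟙 _ := by
    rw [← whiskerLeft_comp, parity_parity, whiskerLeft_id]
  have h3 : V ◁ parity W ≫ parity V ▷ W = parity V ▷ W ≫ V ◁ parity W := whisker_exchange _ _
  have h4 : ∀ {Z : SVec} (g : _ ⟶ Z), V ◁ parity W ≫ parity V ▷ W ≫ g = parity V ▷ W ≫ V ◁ parity W ≫ g :=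
    fun g => by rw [← Category.assoc, h3, Category.assoc]
  have h5 : ∀ {Z : SVec} (g : _ ⟶ Z), parity V ▷ W ≫ parity V ▷ W ≫ g = g :=
    fun g => by rw [← Category.assoc, h1, Category.id_comp]
  have h6 : ∀ {Z : SVec} (g : _ ⟶ Z), V ◁ parity W ≫ V ◁ parity W ≫ g = g :=
    fun g => by rw [← Category.assoc, h2, Category.id_comp]
  simp only [sign, MonoidalCategory.tensorHom_def, Linear.smul_comp, Linear.comp_smul, Preadditive.comp_add,
    Preadditive.add_comp, Preadditive.comp_sub, Preadditive.sub_comp, Category.assoc,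
    Category.id_comp, Category.comp_id, h1, h2, h3, h4, h5]
  module

lemma sign_naturality_left {V W : SVec} (f : V ⟶ W) (Z : SVec) :
    f ▷ Z ≫ sign W Z = sign V Z ≫ f ▷ Z := by
  have h1 : f ▷ Z ≫ parity W ▷ Z = parity V ▷ Z ≫ f ▷ Z := by
    rw [← comp_whiskerRight, parity_naturality, comp_whiskerRight]
  have h2 : f ▷ Z ≫ W ◁ parity Z = V ◁ parity Z ≫ f ▷ Z := (whisker_exchange _ _).symm
  have h3 : f ▷ Z ≫ (parity W ⊗ₘ parity Z) = (parity V ⊗ₘ parity Z) ≫ f ▷ Z := by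
    rw [MonoidalCategory.tensorHom_def, MonoidalCategory.tensorHom_def, reassoc_of% h1,
      Category.assoc, h2]
  simp only [sign, Linear.smul_comp, Linear.comp_smul, Preadditive.comp_add,
    Preadditive.add_comp, Preadditive.comp_sub, Preadditive.sub_comp,
    Category.id_comp, Category.comp_id, h1, h2, h3]

lemma sign_naturality_right {V W : SVec} (f : V ⟶ W) (Z : SVec) :
    Z ◁ f ≫ sign Z W = sign Z V ≫ Z ◁ f := by
  have h1 : Z ◁ f ≫ Z ◁ parity W = Z ◁ parity V ≫ Z ◁ f := by
    rw [← whiskerLeft_comp, parity_naturality, whiskerLeft_comp]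
  have h2 : Z ◁ f ≫ parity Z ▷ W = parity Z ▷ V ≫ Z ◁ f := (whisker_exchange _ _)
  have h3 : Z ◁ f ≫ (parity Z ⊗ₘ parity W) = (parity Z ⊗ₘ parity V) ≫ Z ◁ f := by
    rw [MonoidalCategory.tensorHom_def, MonoidalCategory.tensorHom_def, reassoc_of% h2,
      Category.assoc, h1]
  simp only [sign, Linear.smul_comp, Linear.comp_smul, Preadditive.comp_add,
    Preadditive.add_comp, Preadditive.comp_sub, Preadditive.sub_comp,
    Category.id_comp, Category.comp_id, h1, h2, h3]

/-- The super flip `v ⊗ w ↦ (-1) ^ (|v| * |w|) • w ⊗ v`. -/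
def superBraiding (V W : SVec) : V ⊗ W ≅ W ⊗ V where
  hom := sign V W ≫ (plainBraiding V W).hom
  inv := (plainBraiding V W).inv ≫ sign V W
  hom_inv_id := by simp [sign_sign]
  inv_hom_id := by
    rw [Category.assoc, ← Category.assoc (sign V W), sign_sign]
    simp


/-- The parity as a linear map. -/
def par (V : SVec) : V.V →ₗ[ℂ] V.V := (Action.ρ V (-1)).hom.hom

lemma par_comp_par (V : SVec) : par V ∘ₗ par V = LinearMap.id :=
  congrArg (fun f : V ⟶ V => f.hom.hom.hom) (parity_parity V)

section LinearAlgebra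

variable {A B D : Type*} [AddCommGroup A] [Module ℂ A] [AddCommGroup B] [Module ℂ B]
  [AddCommGroup D] [Module ℂ D]

/-- The super flip on linear maps. -/
def superFlip (p : A →ₗ[ℂ] A) (q : B →ₗ[ℂ] B) : A ⊗[ℂ] B →ₗ[ℂ] B ⊗[ℂ] A :=
  (TensorProduct.comm ℂ A B).toLinearMap ∘ₗ ((1 / 2 : ℂ) •
    (LinearMap.id + p.rTensor B + q.lTensor A - TensorProduct.map p q))

lemma superFlip_tmul (p : A →ₗ[ℂ] A) (q : B →ₗ[ℂ] B) (a : A) (b : B) :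
    superFlip p q (a ⊗ₜ b) = (1 / 2 : ℂ) •
      (b ⊗ₜ a + b ⊗ₜ p a + q b ⊗ₜ a - q b ⊗ₜ p a) := by
  simp [superFlip]

lemma superFlip_superFlip (p : A →ₗ[ℂ] A) (q : B →ₗ[ℂ] B)
    (hp : p ∘ₗ p = LinearMap.id) (hq : q ∘ₗ q = LinearMap.id) :
    superFlip q p ∘ₗ superFlip p q = LinearMap.id := by
  have hp' : ∀ a, p (p a) = a := fun a => LinearMap.congr_fun hp a
  have hq' : ∀ a, q (q a) = a := fun a => LinearMap.congr_fun hq a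
  refine TensorProduct.ext' fun a b => ?_
  simp only [LinearMap.comp_apply, superFlip_tmul, map_smul, map_add, map_sub, hp', hq',
    LinearMap.id_apply]
  module

lemma superFlip_hexagon_forward (p : A →ₗ[ℂ] A) (q : B →ₗ[ℂ] B) (r : D →ₗ[ℂ] D)
    (hp : p ∘ₗ p = LinearMap.id) :
    (TensorProduct.assoc ℂ B D A).toLinearMap ∘ₗ superFlip p (TensorProduct.map q r) ∘ₗ
      (TensorProduct.assoc ℂ A B D).toLinearMap =
    (superFlip p r).lTensor B ∘ₗ (TensorProduct.assoc ℂ B A D).toLinearMap ∘ₗ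
      (superFlip p q).rTensor D := by
  have hp' : ∀ a, p (p a) = a := fun a => LinearMap.congr_fun hp a
  refine TensorProduct.ext_threefold fun a b d => ?_
  simp only [LinearMap.comp_apply, LinearEquiv.coe_coe, TensorProduct.assoc_tmul, superFlip_tmul,
    TensorProduct.map_tmul, map_smul, map_add, map_sub, LinearMap.rTensor_tmul,
    LinearMap.lTensor_tmul, ← TensorProduct.smul_tmul', TensorProduct.tmul_smul,
    TensorProduct.add_tmul, TensorProduct.sub_tmul, TensorProduct.tmul_add,
    TensorProduct.tmul_sub, hp']
  module

lemma superFlip_hexagon_reverse (p : A →ₗ[ℂ] A) (q : B →ₗ[ℂ] B) (r : D →ₗ[ℂ] D)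
    (hr : r ∘ₗ r = LinearMap.id) :
    (TensorProduct.assoc ℂ D A B).symm.toLinearMap ∘ₗ superFlip (TensorProduct.map p q) r ∘ₗ
      (TensorProduct.assoc ℂ A B D).symm.toLinearMap =
    (superFlip p r).rTensor B ∘ₗ (TensorProduct.assoc ℂ A D B).symm.toLinearMap ∘ₗ
      (superFlip q r).lTensor A := by
  have hr' : ∀ a, r (r a) = a := fun a => LinearMap.congr_fun hr a
  refine TensorProduct.ext_threefold' fun a b d => ?_
  simp only [LinearMap.comp_apply, LinearEquiv.coe_coe, TensorProduct.assoc_symm_tmul,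
    superFlip_tmul,
    TensorProduct.map_tmul, map_smul, map_add, map_sub, LinearMap.rTensor_tmul,
    LinearMap.lTensor_tmul, ← TensorProduct.smul_tmul', TensorProduct.tmul_smul,
    TensorProduct.add_tmul, TensorProduct.sub_tmul, TensorProduct.tmul_add,
    TensorProduct.tmul_sub, hr']
  module

end LinearAlgebra

lemma superBraiding_hom (V W : SVec) :
    (superBraiding V W).hom.hom.hom.hom = superFlip (par V) (par W) := rfl

lemma hom_ext' {V W : SVec} {f g : V ⟶ W} (h : f.hom.hom.hom = g.hom.hom.hom) : f = g :=
  Action.Hom.ext (FGModuleCat.hom_ext h)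

/-- The linear map underlying a morphism. -/
def lin {V W : SVec} (f : V ⟶ W) : V.V →ₗ[ℂ] W.V := f.hom.hom.hom

lemma lin_comp {V W U : SVec} (f : V ⟶ W) (g : W ⟶ U) : lin (f ≫ g) = lin g ∘ₗ lin f := rfl

lemma lin_associator_hom (X Y Z : SVec) :
    lin (α_ X Y Z).hom = (TensorProduct.assoc ℂ X.V Y.V Z.V).toLinearMap :=
  congrArg (fun f => f.hom.hom)
    (Action.associator_hom_hom (V := FGModuleCat.{0} ℂ) (G := ℤˣ) X Y Z)

lemma lin_associator_inv (X Y Z : SVec) :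
    lin (α_ X Y Z).inv = (TensorProduct.assoc ℂ X.V Y.V Z.V).symm.toLinearMap :=
  congrArg (fun f => f.hom.hom)
    (Action.associator_inv_hom (V := FGModuleCat.{0} ℂ) (G := ℤˣ) X Y Z)

lemma lin_whiskerLeft (X : SVec) {Y Z : SVec} (f : Y ⟶ Z) :
    lin (X ◁ f) = (lin f).lTensor X.V := rfl

lemma lin_whiskerRight (X : SVec) {Y Z : SVec} (f : Y ⟶ Z) :
    lin (f ▷ X) = (lin f).rTensor X.V := rfl

instance : BraidedCategory SVec where
  braiding := superBraiding
  braiding_naturality_right X Y Z f := by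
    simp only [superBraiding]
    rw [← Category.assoc, sign_naturality_right, Category.assoc, Category.assoc]
    congr 1
    exact BraidedCategory.braiding_naturality_right (C := Action (FGModuleCat.{0} ℂ) ℤˣ) X f
  braiding_naturality_left f Z := by
    simp only [superBraiding]
    rw [← Category.assoc, sign_naturality_left, Category.assoc, Category.assoc]
    congr 1
    exact BraidedCategory.braiding_naturality_left (C := Action (FGModuleCat.{0} ℂ) ℤˣ) f Z
  hexagon_forward X Y Z := by
    refine hom_ext' (Eq.trans ?_ (Eq.trans
      (superFlip_hexagon_forward (par X) (par Y) (par Z) (par_comp_par X)) ?_))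
    · rw [← lin_associator_hom, ← lin_associator_hom]
      rfl
    · rw [← lin_associator_hom]
      rfl
  hexagon_reverse X Y Z := by
    refine hom_ext' (Eq.trans ?_ (Eq.trans
      (superFlip_hexagon_reverse (par X) (par Y) (par Z) (par_comp_par Z)) ?_))
    · rw [← lin_associator_inv, ← lin_associator_inv]
      rfl
    · rw [← lin_associator_inv]
      rfl

lemma braiding_braiding (V W : SVec) : (β_ V W).hom ≫ (β_ W V).hom = 𝟙 (V ⊗ W) :=
  hom_ext' (superFlip_superFlip (par V) (par W) (par_comp_par V) (par_comp_par W))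

end SVec

instance : BalancedCategory SVec where
  twist V := ⟨SVec.parity V, SVec.parity V, SVec.parity_parity V, SVec.parity_parity V⟩
  twist_naturality f := SVec.parity_naturality f
  twist_tensor V W := by
    rw [SVec.braiding_braiding, Category.comp_id]
    rfl

/-! ### Deligne products and split super-modular categories -/

/-- The bifunctor `F : A × D ⥤ B` exhibits `B` as the Deligne product `A ⊠ D` of the semisimple
`ℂ`-linear categories `A` and `D`: it identifies
`Hom (F (X, Y), F (X', Y'))` with `Hom (X, X') ⊗ Hom (Y, Y')` (in particular `F` is bilinear), and
every object of `B` is a finite direct sum of objects `F (X, Y)`. -/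
structure IsDeligneProduct {A : Type*} [Category* A] [Preadditive A] [Linear ℂ A]
    {D : Type*} [Category* D] [Preadditive D] [Linear ℂ D]
    {B : Type*} [Category* B] [Preadditive B] [Linear ℂ B] (F : A × D ⥤ B) : Prop where
  hom_equiv : ∀ (X X' : A) (Y Y' : D),
    ∃ e : ((X ⟶ X') ⊗[ℂ] (Y ⟶ Y')) ≃ₗ[ℂ] (F.obj (X, Y) ⟶ F.obj (X', Y')),
      ∀ (f : X ⟶ X') (g : Y ⟶ Y'), e (f ⊗ₜ[ℂ] g) = F.map (Prod.mkHom f g)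
  direct_sum : ∀ Z : B, ∃ (n : ℕ) (X : Fin n → A) (Y : Fin n → D),
    IsDirectSum Z (fun i => F.obj (X i, Y i))

/-- A balanced braided `ℂ`-linear category `B` is split super-modular if `B ≅ sVec ⊠ M` for some
unitary modular category `M`: there is a braided monoidal twist-preserving functor
`sVec × M ⥤ B` that exhibits `B` as the Deligne product. -/
def IsSplitSuperModular (B : Type u) [Category.{v} B] [Preadditive B] [Linear ℂ B]
    [MonoidalCategory B] [BraidedCategory B] [BalancedCategory B] : Prop :=
  ∃ (M : Type u) (_ : Category.{v} M) (_ : UnitaryRibbonFusionCategory M),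
    IsModular M ∧ ∃ (F : SVec × M ⥤ B) (_ : F.Braided), IsDeligneProduct F ∧
      ∀ X : SVec × M, F.map (BalancedCategory.twist X).hom = (BalancedCategory.twist (F.obj X)).hom

end SpinModular

end

/-! Write C₀ for the trivial sector of the fermion f and D' for the centralizer of a fusion
subcategory D. Everything is driven by centralizers and a dimension count.

Müger's theory supplies two tools for modular C: dim D · dim D' = dim C
(`globalDim_mul_globalDim_centralizer`), and D' is modular when D is
(`isModularSubcategory_centralizer`). Moreover dim C = 2 dim C₀ (`globalDim_trivialSector`), because
the signs of the double braidings with f, weighted by d_a², sum to zero. Unitarity enters through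
positivity: dimensions are positive, and a unitary double braiding whose trace is d_X d_Y must be
the identity (`trivialSector_of_hopf`), so the S-matrix detects centralizers.

(ii) → (iii): the centralizer of D contains f and has dimension 2 dim C₀ / dim D = 4.

(iii) → (i): for a modular A of dimension 4 containing f, the centralizer A' is modular, lies in C₀,
omits f and has half the dimension of C₀. Hence the simple objects of C₀ are those of A' and of f ⊗
A' (`centralizer_properties`). The fermion braids with itself by -1 and has no associativity
obstruction (`IsFermion.braiding_self`, `IsFermion.evaluation_assoc`), so the unit and f generate a
copy of sVec (`SuperFunctor.braided`). Tensoring it with A' exhibits C₀ as a Deligne product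
(`isDeligneProduct_tensorFunctor`).

(i) → (ii): a splitting F embeds M in C₀ by Y ↦ F(𝟙, Y), with modular image. The object F(odd line,
𝟙) has order two and lies outside the image, and together with the image it exhausts C₀; so the
image has half the dimension (`globalDim_eq_two_mul`). -/

noncomputable section

namespace SpinModular

/-! ### Twisted traces in balanced braided categories. -/

section Trace

variable {C : Type u} [Category.{v} C] [MonoidalCategory C] [BraidedCategory C]

/-- The evaluation with the factors in the opposite order, obtained from the braiding. -/
def braidedEval (X X' : C) [ExactPairing X X'] : X ⊗ X' ⟶ 𝟙_ C := (β_ X X').hom ≫ ε_ X X'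

/-- Naturality of the braiding against the cap `ε_ X X'`: the strand `Z` is pulled out of the cap,
at the price of one inverse crossing with `X'`. -/
lemma whiskerLeft_braiding_comp_evaluation (X X' Z : C) [ExactPairing X X'] :
    (α_ X' Z X).hom ≫ X' ◁ (β_ Z X).hom ≫ (α_ X' X Z).inv ≫ ε_ X X' ▷ Z =
      (β_ Z X').inv ▷ X ≫ (α_ Z X' X).hom ≫ Z ◁ ε_ X X' ≫ (ρ_ Z).hom ≫ (λ_ Z).inv := by
  have h := BraidedCategory.braiding_naturality_right Z (ε_ X X')
  rw [braiding_tensorUnit_right, BraidedCategory.braiding_tensor_right_hom] at h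
  simp only [Category.assoc] at h
  rw [h]
  simp

lemma braiding_tensor_tensor (Z Y Z' Y' : C) :
    (β_ (Z ⊗ Y) (Z' ⊗ Y')).hom = 𝟙 _ ⊗≫ Z ◁ (β_ Y Z').hom ▷ Y' ⊗≫ (β_ Z Z').hom ▷ (Y ⊗ Y') ⊗≫
      Z' ◁ (Z ◁ (β_ Y Y').hom ⊗≫ (β_ Z Y').hom ▷ Y) ⊗≫ 𝟙 _ := by
  rw [BraidedCategory.braiding_tensor_left_hom, BraidedCategory.braiding_tensor_right_hom,
    BraidedCategory.braiding_tensor_right_hom]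
  calc
    _ = 𝟙 _ ⊗≫ Z ◁ (β_ Y Z').hom ▷ Y' ⊗≫ ((Z ⊗ Z') ◁ (β_ Y Y').hom ≫ (β_ Z Z').hom ▷ (Y' ⊗ Y)) ⊗≫
        Z' ◁ (β_ Z Y').hom ▷ Y ⊗≫ 𝟙 _ := by monoidal
    _ = _ := by rw [whisker_exchange]; monoidal

/-- One half of the double braiding is slid through the cap of `Y`, where it cancels the crossing of
`Z` with `Y'`. The other half joins the crossing of `Y` with `Z'` to form the braiding of `Y` with
`Z ⊗ Z'`, which naturality removes. -/
lemma braidedEval_tensor (Y Y' Z Z' : C) [ExactPairing Y Y'] [ExactPairing Z Z'] :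
    ((β_ Y Z).hom ≫ (β_ Z Y).hom) ▷ (Z' ⊗ Y') ≫ braidedEval (Y ⊗ Z) (Z' ⊗ Y') =
      𝟙 _ ⊗≫ Y ◁ braidedEval Z Z' ▷ Y' ⊗≫ braidedEval Y Y' := by
  have h1 : (β_ Z Y).hom ▷ (Z' ⊗ Y') ≫ braidedEval (Y ⊗ Z) (Z' ⊗ Y') =
      𝟙 _ ⊗≫ Z ◁ (β_ Y Z').hom ▷ Y' ⊗≫ braidedEval Z Z' ▷ (Y ⊗ Y') ⊗≫ braidedEval Y Y' := by
    rw [braidedEval, ← Category.assoc, BraidedCategory.braiding_naturality_left,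
      ExactPairing.tensor_evaluation]
    calc
      _ = (β_ (Z ⊗ Y) (Z' ⊗ Y')).hom ⊗≫ Z' ◁ ((α_ Y' Z Y).hom ≫ Y' ◁ (β_ Z Y).hom ≫
            (α_ Y' Y Z).inv ≫ ε_ Y Y' ▷ Z) ⊗≫ ε_ Z Z' := by monoidal
      _ = 𝟙 _ ⊗≫ Z ◁ (β_ Y Z').hom ▷ Y' ⊗≫ (β_ Z Z').hom ▷ (Y ⊗ Y') ⊗≫ Z' ◁ (Z ◁ (β_ Y Y').hom ⊗≫
          ((β_ Z Y').hom ≫ (β_ Z Y').inv) ▷ Y ⊗≫ Z ◁ ε_ Y Y' ⊗≫ 𝟙 Z) ⊗≫ ε_ Z Z' := by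
        rw [whiskerLeft_braiding_comp_evaluation, braiding_tensor_tensor]
        monoidal
      _ = 𝟙 _ ⊗≫ Z ◁ (β_ Y Z').hom ▷ Y' ⊗≫ (β_ Z Z').hom ▷ (Y ⊗ Y') ⊗≫
          ((Z' ⊗ Z) ◁ ((β_ Y Y').hom ≫ ε_ Y Y') ≫ ε_ Z Z' ▷ 𝟙_ C) ⊗≫ 𝟙 (𝟙_ C) := by
        rw [Iso.hom_inv_id]; monoidal
      _ = _ := by
        rw [whisker_exchange]; simp only [braidedEval]; monoidal
  calc
    _ = (β_ Y Z).hom ▷ (Z' ⊗ Y') ≫ (β_ Z Y).hom ▷ (Z' ⊗ Y') ≫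
          braidedEval (Y ⊗ Z) (Z' ⊗ Y') := by simp
    _ = 𝟙 _ ⊗≫ ((α_ Y Z Z').inv ≫ (β_ Y Z).hom ▷ Z' ≫ (α_ Z Y Z').hom ≫ Z ◁ (β_ Y Z').hom ≫
          (α_ Z Z' Y).inv) ▷ Y' ⊗≫
        (braidedEval Z Z' ▷ Y) ▷ Y' ⊗≫ braidedEval Y Y' := by
      rw [h1]; monoidal
    _ = 𝟙 _ ⊗≫ ((β_ Y (Z ⊗ Z')).hom ≫ braidedEval Z Z' ▷ Y) ▷ Y' ⊗≫ braidedEval Y Y' := by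
      rw [BraidedCategory.braiding_tensor_right_hom]; monoidal
    _ = _ := by
      rw [← BraidedCategory.braiding_naturality_right, braiding_tensorUnit_right]; monoidal

variable [BalancedCategory C]

/-- The evaluation with the factors in the opposite order, obtained from the twist and the
braiding. -/
def twistedEval (X X' : C) [ExactPairing X X'] : X ⊗ X' ⟶ 𝟙_ C :=
  (BalancedCategory.twist X).hom ▷ X' ≫ braidedEval X X'

/-- The double braiding in the twist of a tensor product is exactly what `braidedEval_tensor`
absorbs, so twisted evaluations nest. The compatibility of traces with tensor products rests on
this. -/
lemma twistedEval_tensor (Y Y' Z Z' : C) [ExactPairing Y Y'] [ExactPairing Z Z'] :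
    twistedEval (Y ⊗ Z) (Z' ⊗ Y') =
      𝟙 _ ⊗≫ Y ◁ twistedEval Z Z' ▷ Y' ⊗≫ twistedEval Y Y' := by
  rw [twistedEval, BalancedCategory.twist_tensor, comp_whiskerRight, Category.assoc,
    braidedEval_tensor, MonoidalCategory.tensorHom_def]
  calc
    _ = 𝟙 _ ⊗≫ (BalancedCategory.twist Y).hom ▷ (Z ⊗ (Z' ⊗ Y')) ⊗≫
        (Y ◁ ((BalancedCategory.twist Z).hom ▷ Z' ≫ braidedEval Z Z')) ▷ Y' ⊗≫
          braidedEval Y Y' := by monoidal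
    _ = 𝟙 _ ⊗≫ ((BalancedCategory.twist Y).hom ▷ (Z ⊗ Z') ≫
        (Y ◁ ((BalancedCategory.twist Z).hom ▷ Z' ≫ braidedEval Z Z'))) ▷ Y' ⊗≫
          braidedEval Y Y' := by monoidal
    _ = _ := by
      rw [← whisker_exchange]; simp only [twistedEval]; monoidal

/-- The partial trace over the right factor. -/
def partialTrace (Y Y' : C) [ExactPairing Y Y'] {A B : C} (g : A ⊗ Y ⟶ B ⊗ Y) : A ⟶ B :=
  𝟙 _ ⊗≫ A ◁ η_ Y Y' ⊗≫ g ▷ Y' ⊗≫ B ◁ twistedEval Y Y' ⊗≫ 𝟙 _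

/-- The trace with respect to an exact pairing. -/
def traceWith (Y Y' : C) [ExactPairing Y Y'] (g : Y ⟶ Y) : 𝟙_ C ⟶ 𝟙_ C :=
  η_ Y Y' ≫ g ▷ Y' ≫ twistedEval Y Y'

lemma qtrace_eq_traceWith [RightRigidCategory C] {X : C} (f : X ⟶ X) :
    qtrace f = traceWith X Xᘁ f := by
  simp [qtrace, traceWith, twistedEval, braidedEval]

lemma partialTrace_whiskerRight_comp (Y Y' : C) [ExactPairing Y Y'] {A B D : C} (h : A ⟶ B)
    (g : B ⊗ Y ⟶ D ⊗ Y) : partialTrace Y Y' (h ▷ Y ≫ g) = h ≫ partialTrace Y Y' g := by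
  simp only [partialTrace]
  calc
    _ = 𝟙 _ ⊗≫ (A ◁ η_ Y Y' ≫ h ▷ (Y ⊗ Y')) ⊗≫ g ▷ Y' ⊗≫ D ◁ twistedEval Y Y' ⊗≫ 𝟙 _ := by
      monoidal
    _ = _ := by rw [whisker_exchange]; monoidal

lemma partialTrace_comp_whiskerRight (Y Y' : C) [ExactPairing Y Y'] {A B D : C}
    (g : A ⊗ Y ⟶ B ⊗ Y) (h : B ⟶ D) :
    partialTrace Y Y' (g ≫ h ▷ Y) = partialTrace Y Y' g ≫ h := by
  simp only [partialTrace]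
  calc
    _ = 𝟙 _ ⊗≫ A ◁ η_ Y Y' ⊗≫ g ▷ Y' ⊗≫ (h ▷ (Y ⊗ Y') ≫ D ◁ twistedEval Y Y') ⊗≫ 𝟙 _ := by
      monoidal
    _ = _ := by rw [← whisker_exchange]; monoidal

lemma partialTrace_tensor (Y Y' Z Z' : C) [ExactPairing Y Y'] [ExactPairing Z Z'] {A B : C}
    (g : A ⊗ (Y ⊗ Z) ⟶ B ⊗ (Y ⊗ Z)) :
    partialTrace (Y ⊗ Z) (Z' ⊗ Y') g =
      partialTrace Y Y' (partialTrace Z Z' ((α_ A Y Z).hom ≫ g ≫ (α_ B Y Z).inv)) := by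
  simp only [partialTrace, twistedEval_tensor, ExactPairing.tensor_coevaluation]
  monoidal

lemma partialTrace_whiskerLeft (X Y Y' : C) [ExactPairing Y Y'] {A B : C}
    (g : A ⊗ Y ⟶ B ⊗ Y) :
    partialTrace Y Y' ((α_ X A Y).hom ≫ X ◁ g ≫ (α_ X B Y).inv) = X ◁ partialTrace Y Y' g := by
  simp only [partialTrace]
  monoidal

lemma traceWith_partialTrace (Y Y' Z Z' : C) [ExactPairing Y Y'] [ExactPairing Z Z']
    (g : Y ⊗ Z ⟶ Y ⊗ Z) :
    traceWith Y Y' (partialTrace Z Z' g) = traceWith (Y ⊗ Z) (Z' ⊗ Y') g := by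
  simp only [partialTrace, traceWith, twistedEval_tensor, ExactPairing.tensor_coevaluation]
  monoidal

/-- Morphisms have a mate with respect to exact pairings, which slides through the
coevaluations and the braided evaluations. -/
lemma exists_mate (Y Y' Z Z' : C) [ExactPairing Y Y'] [ExactPairing Z Z'] (h : Z ⟶ Y) :
    ∃ k : Y' ⟶ Z', η_ Z Z' ≫ h ▷ Z' = η_ Y Y' ≫ Y ◁ k ∧
      h ▷ Y' ≫ twistedEval Y Y' = Z ◁ k ≫ twistedEval Z Z' := by
  let : HasRightDual Y := ⟨Y'⟩
  let : HasRightDual Z := ⟨Z'⟩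
  have h1 : η_ Z Z' ≫ h ▷ Z' = η_ Y Y' ≫ Y ◁ rightAdjointMate h :=
    (coevaluation_comp_rightAdjointMate h).symm
  have h2 : rightAdjointMate h ▷ Z ≫ ε_ Z Z' = Y' ◁ h ≫ ε_ Y Y' :=
    rightAdjointMate_comp_evaluation h
  refine ⟨rightAdjointMate h, h1, ?_⟩
  simp only [twistedEval, braidedEval]
  rw [← comp_whiskerRight_assoc, BalancedCategory.twist_naturality, comp_whiskerRight_assoc,
    BraidedCategory.braiding_naturality_left_assoc, ← h2,
    ← BraidedCategory.braiding_naturality_right_assoc, whisker_exchange_assoc]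
  rfl

/-- The morphism `h` travels around the loop as its mate. With `h` the identity and two exact
pairings on one object, this also shows that the trace does not depend on the chosen dual. -/
lemma traceWith_cyclic (Y Y' Z Z' : C) [ExactPairing Y Y'] [ExactPairing Z Z']
    (g : Y ⟶ Z) (h : Z ⟶ Y) : traceWith Y Y' (g ≫ h) = traceWith Z Z' (h ≫ g) := by
  obtain ⟨k, h1, h2⟩ := exists_mate Y Y' Z Z' h
  simp only [traceWith, comp_whiskerRight, Category.assoc, h2, reassoc_of% h1,
    whisker_exchange_assoc]

/-- The partial trace over `Y` of the double braiding of `A` with `Y`. -/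
def encircle (Y Y' : C) [ExactPairing Y Y'] (A : C) : A ⟶ A :=
  partialTrace Y Y' ((β_ A Y).hom ≫ (β_ Y A).hom)

/-- A loop coloured by `Y ⊗ Z` is two concentric loops. The hexagons separate the double braidings,
and the inner loop, being an endomorphism of `A`, slides through the crossing with `Y` by
naturality. -/
lemma encircle_tensor (Y Y' Z Z' A : C) [ExactPairing Y Y'] [ExactPairing Z Z'] :
    encircle (Y ⊗ Z) (Z' ⊗ Y') A = encircle Z Z' A ≫ encircle Y Y' A := by
  rw [encircle, partialTrace_tensor]
  have h1 : (α_ A Y Z).hom ≫ ((β_ A (Y ⊗ Z)).hom ≫ (β_ (Y ⊗ Z) A).hom) ≫ (α_ A Y Z).inv =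
      (β_ A Y).hom ▷ Z ≫ ((α_ Y A Z).hom ≫ Y ◁ ((β_ A Z).hom ≫ (β_ Z A).hom) ≫ (α_ Y A Z).inv) ≫
        (β_ Y A).hom ▷ Z := by
    simp [BraidedCategory.braiding_tensor_left_hom, BraidedCategory.braiding_tensor_right_hom]
  rw [h1, partialTrace_whiskerRight_comp, partialTrace_comp_whiskerRight,
    partialTrace_whiskerLeft]
  change partialTrace Y Y' (_ ≫ Y ◁ encircle Z Z' A ≫ _) = _
  rw [← BraidedCategory.braiding_naturality_left_assoc, partialTrace_whiskerRight_comp]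
  rfl

lemma traceWith_encircle (Y Y' A A' : C) [ExactPairing Y Y'] [ExactPairing A A'] :
    traceWith A A' (encircle Y Y' A) =
      traceWith (A ⊗ Y) (Y' ⊗ A') ((β_ A Y).hom ≫ (β_ Y A).hom) :=
  traceWith_partialTrace _ _ _ _ _

/-- Trace of the dual, with the swapped exact pairing. -/
lemma traceWith_swap (X X' : C) [ExactPairing X X']
    (h : η_ X X' ≫ X ◁ (BalancedCategory.twist X').hom =
      η_ X X' ≫ (BalancedCategory.twist X).hom ▷ X') :
    @traceWith C _ _ _ _ X' X (BraidedCategory.exactPairing_swap X X') (𝟙 X') =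
      traceWith X X' (𝟙 X) := by
  let := BraidedCategory.exactPairing_swap X X'
  have e1 : η_ X' X = η_ X X' ≫ (β_ X' X).inv := rfl
  have e2 : ε_ X' X = (β_ X X').hom ≫ ε_ X X' := rfl
  simp only [traceWith, twistedEval, braidedEval, e1, e2, id_whiskerRight, Category.id_comp,
    Category.assoc]
  rw [BraidedCategory.braiding_naturality_left_assoc, Iso.inv_hom_id_assoc, reassoc_of% h]

end Trace

open UnitaryRibbonFusionCategory

/-! ### Direct sums -/

section DirectSum

variable {C : Type u} [Category.{v} C] [Preadditive C]

lemma IsDirectSum.exists_maps {n : ℕ} {Z : C} {X : Fin n → C} (h : IsDirectSum Z X) :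
    ∃ (p : ∀ i, Z ⟶ X i) (q : ∀ i, X i ⟶ Z), ∑ i, p i ≫ q i = 𝟙 Z ∧
      (∀ i, q i ≫ p i = 𝟙 (X i)) ∧ ∀ i j, i ≠ j → q i ≫ p j = 0 := by
  obtain ⟨b, ⟨hb⟩, ⟨e⟩⟩ := h
  refine ⟨fun i => e.hom ≫ b.π i, fun i => b.ι i ≫ e.inv, ?_, ?_, ?_⟩
  · have : ∑ i, e.hom ≫ b.π i ≫ b.ι i ≫ e.inv = e.hom ≫ (∑ i, b.π i ≫ b.ι i) ≫ e.inv := by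
      simp [Preadditive.comp_sum, Preadditive.sum_comp]
    simpa [IsBilimit.total hb] using this
  · intro i; simp
  · intro i j hij; simp [bicone_ι_π_ne b hij]

lemma IsDirectSum.of_maps {n : ℕ} {Z : C} {X : Fin n → C} (p : ∀ i, Z ⟶ X i) (q : ∀ i, X i ⟶ Z)
    (h1 : ∑ i, p i ≫ q i = 𝟙 Z) (h2 : ∀ i, q i ≫ p i = 𝟙 (X i))
    (h3 : ∀ i j, i ≠ j → q i ≫ p j = 0) : IsDirectSum Z X := by
  classical
  refine ⟨⟨Z, p, q, ?_⟩, ⟨isBilimitOfTotal _ h1⟩, ⟨Iso.refl _⟩⟩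
  intro i j
  split_ifs with h
  · subst h; simp [h2]
  · exact h3 i j h

end DirectSum

section

variable {C : Type u} [Category.{v} C] [UnitaryRibbonFusionCategory C]

instance (X Y : C) : FiniteDimensional ℂ (X ⟶ Y) := finiteDimensional_hom X Y

instance : Simple (𝟙_ C) := simple_unit

/-! ### Labels -/

instance (a : Label C) : Simple a.rep := (Quotient.out a).property

/-- The label of a simple object. -/
def label (X : C) [h : Simple X] : Label C := Quotient.mk _ ⟨X, h⟩

lemma label_eq_iff (X Y : C) [Simple X] [Simple Y] : label X = label Y ↔ Nonempty (X ≅ Y) :=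
  Quotient.eq

@[simp] lemma label_rep (a : Label C) : label a.rep = a := Quotient.out_eq a

lemma rep_label (X : C) [Simple X] : Nonempty ((label X).rep ≅ X) := by
  rw [← label_eq_iff, label_rep]

open scoped Classical in
lemma finrank_hom_simple (X Y : C) [Simple X] [Simple Y] :
    Module.finrank ℂ (X ⟶ Y) = if label X = label Y then 1 else 0 := by
  split_ifs with h
  · rw [finrank_hom_simple_simple_eq_one_iff]
    exact (label_eq_iff X Y).1 h
  · rw [finrank_hom_simple_simple_eq_zero_iff]
    rw [label_eq_iff, not_nonempty_iff] at h
    exact h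

lemma finrank_hom_directSum {n : ℕ} {Z : C} {X : Fin n → C} (h : IsDirectSum Z X) (W : C) :
    Module.finrank ℂ (Z ⟶ W) = ∑ i, Module.finrank ℂ (X i ⟶ W) := by
  obtain ⟨p, q, h1, h2, h3⟩ := h.exists_maps
  rw [← Module.finrank_pi_fintype]
  refine LinearEquiv.finrank_eq
    { toFun f i := q i ≫ f
      invFun g := ∑ i, p i ≫ g i
      map_add' f g := by ext; simp
      map_smul' c f := by ext; simp
      left_inv f := by simp [← Category.assoc, ← Preadditive.sum_comp, h1]
      right_inv g := by
        ext j
        simp only [Preadditive.comp_sum]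
        rw [Finset.sum_eq_single j (fun i _ hi => by rw [← Category.assoc, h3 j i hi.symm, zero_comp])
          (by simp), ← Category.assoc, h2, Category.id_comp] }

lemma finrank_hom_directSum' {n : ℕ} {Z : C} {X : Fin n → C} (h : IsDirectSum Z X) (W : C) :
    Module.finrank ℂ (W ⟶ Z) = ∑ i, Module.finrank ℂ (W ⟶ X i) := by
  obtain ⟨p, q, h1, h2, h3⟩ := h.exists_maps
  rw [← Module.finrank_pi_fintype]
  refine LinearEquiv.finrank_eq
    { toFun f i := f ≫ p i
      invFun g := ∑ i, g i ≫ q i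
      map_add' f g := by ext; simp
      map_smul' c f := by ext; simp
      left_inv f := by simp [← Preadditive.comp_sum, h1]
      right_inv g := by
        ext j
        simp only [Preadditive.sum_comp, Category.assoc]
        rw [Finset.sum_eq_single j (fun i _ hi => by rw [h3 i j hi, comp_zero])
          (by simp), h2, Category.comp_id] }

open scoped Classical in
lemma finrank_hom_rep {n : ℕ} {Z : C} {X : Fin n → C} (h : IsDirectSum Z X)
    [∀ i, Simple (X i)] (e : Label C) :
    Module.finrank ℂ (Z ⟶ e.rep) = (Finset.univ.filter fun i => label (X i) = e).card := by
  simp only [finrank_hom_directSum h, finrank_hom_simple, Finset.card_filter, label_rep]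

/-- An additive isomorphism invariant is determined by its values on simple objects. -/
lemma eq_sum_labels {φ : C → ℂ}
    (hadd : ∀ {n : ℕ} {Z : C} {X : Fin n → C}, IsDirectSum Z X → φ Z = ∑ i, φ (X i))
    (hiso : ∀ {X Y : C}, (X ≅ Y) → φ X = φ Y) (Z : C) :
    φ Z = ∑ e : Label C, Module.finrank ℂ (Z ⟶ e.rep) * φ e.rep := by
  classical
  obtain ⟨n, X, hX, h⟩ := semisimple Z
  have : ∀ i, φ (X i) = φ (label (X i)).rep := fun i => hiso (rep_label (X i)).some.symm
  simp_rw [hadd h, this, finrank_hom_rep h]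
  rw [← Finset.sum_fiberwise (s := Finset.univ) (g := fun i => label (X i))]
  refine Finset.sum_congr rfl fun e _ => ?_
  rw [Finset.sum_congr rfl (g := fun _ => φ e.rep)]
  · simp
  · intro i hi
    rw [(Finset.mem_filter.1 hi).2]

open scoped Classical in
lemma finrank_hom_rep_symm (Z : C) (e : Label C) :
    Module.finrank ℂ (Z ⟶ e.rep) = Module.finrank ℂ (e.rep ⟶ Z) := by
  obtain ⟨n, X, hX, h⟩ := semisimple Z
  simp only [finrank_hom_directSum h, finrank_hom_directSum' h, finrank_hom_simple]
  exact Finset.sum_congr rfl fun i _ => if_congr eq_comm rfl rfl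

/-- Each simple summand of `X` contributes at least one dimension to the endomorphisms, so there is
at most one summand. -/
lemma simple_of_finrank_end (X : C) (h : Module.finrank ℂ (X ⟶ X) = 1) : Simple X := by
  obtain ⟨n, S, hS, h'⟩ := semisimple X
  have key : ∀ i, 1 ≤ Module.finrank ℂ (X ⟶ S i) := by
    intro i
    rw [finrank_hom_directSum h']
    refine le_trans (by simp [finrank_hom_simple])
      (Finset.single_le_sum (f := fun j => Module.finrank ℂ (S j ⟶ S i)) (by simp) (Finset.mem_univ i))
  have hn : n ≤ 1 := by
    rw [← h, finrank_hom_directSum' h']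
    simpa using Finset.sum_le_sum (fun i (_ : i ∈ Finset.univ) => key i)
  have hn' : n ≠ 0 := by
    rintro rfl
    rw [finrank_hom_directSum h'] at h
    simp at h
  obtain rfl : n = 1 := by omega
  obtain ⟨p, q, h1, h2, h3⟩ := h'.exists_maps
  let e : X ≅ S 0 := ⟨p 0, q 0, by simpa using h1, h2 0⟩
  exact Simple.of_iso e

lemma simple_iff_finrank_end (X : C) : Simple X ↔ Module.finrank ℂ (X ⟶ X) = 1 :=
  ⟨fun _ => finrank_endomorphism_simple_eq_one ℂ X, simple_of_finrank_end X⟩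

/-! ### Frobenius reciprocity -/

lemma finrank_tensorLeft (X Y Y' Z : C) [ExactPairing Y Y'] :
    Module.finrank ℂ (Y' ⊗ X ⟶ Z) = Module.finrank ℂ (X ⟶ Y ⊗ Z) :=
  LinearEquiv.finrank_eq
    { tensorLeftHomEquiv X Y Y' Z with
      map_add' := by intro f g; simp [tensorLeftHomEquiv]
      map_smul' := by intro f g; simp [tensorLeftHomEquiv] }

lemma finrank_tensorRight (X Y Y' Z : C) [ExactPairing Y Y'] :
    Module.finrank ℂ (X ⊗ Y ⟶ Z) = Module.finrank ℂ (X ⟶ Z ⊗ Y') :=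
  LinearEquiv.finrank_eq
    { tensorRightHomEquiv X Y Y' Z with
      map_add' := by intro f g; simp [tensorRightHomEquiv]
      map_smul' := by intro f g; simp [tensorRightHomEquiv] }

lemma finrank_hom_congr {X X' Y Y' : C} (e : X ≅ X') (e' : Y ≅ Y') :
    Module.finrank ℂ (X ⟶ Y) = Module.finrank ℂ (X' ⟶ Y') :=
  LinearEquiv.finrank_eq (Linear.homCongr ℂ e e')

end

/-- Compatibility of the twist with `𝟙_ C ⊗ 𝟙_ C ≅ 𝟙_ C` makes the twist of the unit idempotent, and
it is invertible. -/
lemma twist_unit {C : Type u} [Category.{v} C] [MonoidalCategory C] [BraidedCategory C]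
    [BalancedCategory C] : (BalancedCategory.twist (𝟙_ C)).hom = 𝟙 (𝟙_ C) := by
  have h := BalancedCategory.twist_naturality (λ_ (𝟙_ C)).hom
  rw [BalancedCategory.twist_tensor, MonoidalCategory.tensorHom_def'] at h
  simp only [braiding_tensorUnit_left, Category.assoc] at h
  rw [← cancel_mono (BalancedCategory.twist (𝟙_ C)).hom, Category.id_comp]
  have e : (λ_ (𝟙_ C)).inv ≫ (ρ_ (𝟙_ C)).hom = 𝟙 _ := by rw [unitors_inv_equal, Iso.inv_hom_id]
  have e' : (ρ_ (𝟙_ C)).inv ≫ (λ_ (𝟙_ C)).hom = 𝟙 _ := by rw [← unitors_inv_equal, Iso.inv_hom_id]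
  simpa [e', reassoc_of% e, reassoc_of% e'] using h.symm

section

variable {C : Type u} [Category.{v} C] [UnitaryRibbonFusionCategory C]

/-! ### The quantum trace as a scalar -/

lemma toScalar_eq {f : 𝟙_ C ⟶ 𝟙_ C} {c : ℂ} (h : f = c • 𝟙 (𝟙_ C)) : toScalar f = c :=
  smul_left_injective ℂ (id_nonzero (𝟙_ C)) ((toScalar_smul f).trans h)

/-- The quantum trace as a linear functional. -/
def trace {X : C} : (X ⟶ X) →ₗ[ℂ] ℂ where
  toFun f := toScalar (qtrace f)
  map_add' f g := toScalar_eq (by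
    rw [add_smul, toScalar_smul, toScalar_smul]
    simp [qtrace])
  map_smul' c f := toScalar_eq (by
    rw [smul_assoc, toScalar_smul]
    simp [qtrace])

lemma trace_def {X : C} (f : X ⟶ X) : trace f = toScalar (qtrace f) := rfl

lemma trace_eq_traceWith (X X' : C) [ExactPairing X X'] (f : X ⟶ X) :
    trace f = toScalar (traceWith X X' f) := by
  have h := @traceWith_cyclic C _ _ _ _ X Xᘁ X X' _ _ f (𝟙 X)
  rw [Category.comp_id, Category.id_comp] at h
  rw [trace_def, qtrace_eq_traceWith, h]

lemma trace_comp_comm {X Y : C} (f : X ⟶ Y) (g : Y ⟶ X) : trace (f ≫ g) = trace (g ≫ f) := by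
  rw [trace_eq_traceWith X Xᘁ, trace_eq_traceWith Y Yᘁ, traceWith_cyclic X Xᘁ Y Yᘁ]

lemma trace_conj {X Y : C} (e : X ≅ Y) (f : X ⟶ X) : trace (e.inv ≫ f ≫ e.hom) = trace f := by
  rw [trace_comp_comm, Category.assoc, e.hom_inv_id, Category.comp_id]

lemma trace_pos {X Y : C} (f : X ⟶ Y) (hf : f ≠ 0) :
    ∃ r : ℝ, 0 < r ∧ trace (f ≫ dag f) = r := by
  obtain ⟨r, hr, h⟩ := qtrace_pos f hf
  exact ⟨r, hr, toScalar_eq h⟩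

lemma dag_neg {X Y : C} (f : X ⟶ Y) : dag (-f) = -dag f := by
  simpa using dag_smul (-1 : ℂ) f

lemma dag_sub {X Y : C} (f g : X ⟶ Y) : dag (f - g) = dag f - dag g := by
  rw [sub_eq_add_neg, dag_add, dag_neg, sub_eq_add_neg]

lemma trace_comp_dag_im {X Y : C} (f : X ⟶ Y) : (trace (f ≫ dag f)).im = 0 := by
  by_cases hf : f = 0
  · simp [hf]
  · obtain ⟨r, -, h⟩ := trace_pos f hf
    simp [h]

/-- Polarisation: positivity makes the trace of `g ≫ dag g` real; `g = 𝟙 + f` yields the imaginary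
parts and `g = 𝟙 + i f` the real parts. -/
lemma trace_dag {X : C} (f : X ⟶ X) : trace (dag f) = starRingEnd ℂ (trace f) := by
  have h1 := trace_comp_dag_im (𝟙 X + f)
  have h2 := trace_comp_dag_im (𝟙 X + Complex.I • f)
  have h3 := trace_comp_dag_im f
  have h4 := trace_comp_dag_im (𝟙 X)
  simp only [dag_add, dag_smul, dag_id, Preadditive.add_comp, Preadditive.comp_add,
    Category.id_comp, Category.comp_id, map_add, Complex.add_im, Linear.smul_comp,
    Linear.comp_smul, map_smul, smul_eq_mul, Complex.conj_I, Complex.add_re, Complex.mul_im,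
    Complex.I_re, Complex.I_im, Complex.neg_re, Complex.neg_im, Complex.mul_re, h3] at h1 h2 h4
  apply Complex.ext
  · rw [Complex.conj_re]; linarith
  · rw [Complex.conj_im]; linarith

/-! ### Quantum dimensions -/

lemma qdim_def (X : C) : qdim X = trace (𝟙 X) := rfl

lemma qdim_pos (X : C) (h : 𝟙 X ≠ 0) : ∃ r : ℝ, 0 < r ∧ qdim X = r := by
  simpa [dag_id, qdim_def] using trace_pos (𝟙 X) h

lemma conj_qdim (X : C) : starRingEnd ℂ (qdim X) = qdim X := by
  rw [qdim_def, ← trace_dag, dag_id]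

lemma qdim_congr {X Y : C} (e : X ≅ Y) : qdim X = qdim Y := by
  rw [qdim_def, qdim_def, ← trace_conj e, Category.id_comp, e.inv_hom_id]

/-- The ribbon condition `twist_dual` moves the twist across the coevaluation, as `traceWith_swap`
requires. -/
lemma qdim_rightDual (X : C) : qdim Xᘁ = qdim X := by
  let := BraidedCategory.exactPairing_swap X Xᘁ
  rw [qdim_def, qdim_def, trace_eq_traceWith Xᘁ X, trace_eq_traceWith X Xᘁ, traceWith_swap]
  rw [twist_dual]
  exact coevaluation_comp_rightAdjointMate _

/-! ### Hopf links -/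

/-- The trace of the double braiding of two objects. -/
def hopf (X Y : C) : ℂ := trace ((β_ X Y).hom ≫ (β_ Y X).hom)

lemma sMatrix_apply (a b : Label C) : sMatrix C a b = hopf a.rep b.rep := rfl

lemma hopf_comm (X Y : C) : hopf X Y = hopf Y X := trace_comp_comm _ _

lemma hopf_congr_right (X : C) {Y Z : C} (e : Y ≅ Z) : hopf X Y = hopf X Z := by
  rw [hopf, hopf, ← trace_conj (whiskerLeftIso X e)]
  simp

lemma hopf_congr {X X' Y Y' : C} (e : X ≅ X') (e' : Y ≅ Y') : hopf X Y = hopf X' Y' := by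
  rw [hopf_congr_right X e', hopf_comm, hopf_congr_right Y' e, hopf_comm]

lemma hopf_directSum (X : C) {n : ℕ} {Z : C} {Y : Fin n → C} (h : IsDirectSum Z Y) :
    hopf X Z = ∑ i, hopf X (Y i) := by
  obtain ⟨p, q, h1, h2, h3⟩ := h.exists_maps
  have : (β_ X Z).hom ≫ (β_ Z X).hom = ∑ i, (X ◁ p i) ≫ (X ◁ q i) ≫ (β_ X Z).hom ≫ (β_ Z X).hom := by
    simp only [← whiskerLeft_comp_assoc]
    rw [← Preadditive.sum_comp, ← whiskerLeft_sum, h1]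
    simp
  rw [hopf, this, map_sum]
  refine Finset.sum_congr rfl fun i _ => ?_
  rw [trace_comp_comm, hopf]
  simp [← whiskerLeft_comp, h2]

lemma hopf_eq_encircle (A Y : C) : hopf A Y = trace (encircle Y Yᘁ A) := by
  rw [trace_eq_traceWith A Aᘁ, traceWith_encircle, hopf, trace_eq_traceWith (A ⊗ Y) (Yᘁ ⊗ Aᘁ)]

/-- On a simple `A` a loop around the strand acts by a scalar, and by `encircle_tensor` these
scalars multiply. The factor `qdim A` converts scalars into traces. -/
lemma hopf_mul_hopf (A Y Z : C) [Simple A] :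
    hopf A Y * hopf A Z = qdim A * hopf A (Y ⊗ Z) := by
  obtain ⟨y, hy⟩ := endomorphism_simple_eq_smul_id ℂ (encircle Y Yᘁ A)
  obtain ⟨z, hz⟩ := endomorphism_simple_eq_smul_id ℂ (encircle Z Zᘁ A)
  have h : hopf A (Y ⊗ Z) = trace (encircle (Y ⊗ Z) (Zᘁ ⊗ Yᘁ) A) := by
    rw [trace_eq_traceWith A Aᘁ, traceWith_encircle, hopf,
      trace_eq_traceWith (A ⊗ Y ⊗ Z) ((Zᘁ ⊗ Yᘁ) ⊗ Aᘁ)]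
  rw [h, encircle_tensor, hopf_eq_encircle, hopf_eq_encircle, ← hy, ← hz, qdim_def]
  simp only [Linear.smul_comp, Linear.comp_smul, Category.id_comp, map_smul, smul_eq_mul]
  ring

lemma qdim_unit : qdim (𝟙_ C) = 1 := by
  rw [qdim_def, trace_eq_traceWith (𝟙_ C) (𝟙_ C)]
  refine toScalar_eq ?_
  have e1 : η_ (𝟙_ C) (𝟙_ C) = (ρ_ _).inv := rfl
  have e2 : ε_ (𝟙_ C) (𝟙_ C) = (ρ_ _).hom := rfl
  simp [traceWith, twistedEval, braidedEval, twist_unit, e1, e2, unitors_inv_equal]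

lemma hopf_unit (X : C) : hopf X (𝟙_ C) = qdim X := by
  rw [hopf, qdim_def, ← trace_conj (ρ_ X)]
  simp

/-- This is `hopf_mul_hopf` for the simple object `𝟙_ C`. -/
lemma qdim_tensor (X Y : C) : qdim (X ⊗ Y) = qdim X * qdim Y := by
  rw [← hopf_unit X, ← hopf_unit Y, ← hopf_unit (X ⊗ Y), hopf_comm, hopf_comm X, hopf_comm Y,
    hopf_mul_hopf, qdim_unit, one_mul]

lemma qdim_directSum {n : ℕ} {Z : C} {Y : Fin n → C} (h : IsDirectSum Z Y) :
    qdim Z = ∑ i, qdim (Y i) := by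
  simp only [← hopf_unit, hopf_comm _ (𝟙_ C)]
  exact hopf_directSum _ h

end

section

variable {C : Type u} [Category.{v} C] [UnitaryRibbonFusionCategory C]

/-! ### Objects with trivial double braiding -/

lemma trivialSector_symm {X Y : C} (h : trivialSector X Y) : trivialSector Y X := by
  change (β_ X Y).hom ≫ (β_ Y X).hom = 𝟙 _ at h
  change (β_ Y X).hom ≫ (β_ X Y).hom = 𝟙 _
  rw [← cancel_epi (β_ X Y).hom, ← Category.assoc, h, Category.id_comp, Category.comp_id]

lemma doubleBraiding_naturality (X : C) {Y Z : C} (g : Y ⟶ Z) :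
    X ◁ g ≫ (β_ X Z).hom ≫ (β_ Z X).hom = ((β_ X Y).hom ≫ (β_ Y X).hom) ≫ X ◁ g := by
  simp

lemma trivialSector_retract {X Y Z : C} (r : Retract Y Z) (h : trivialSector X Z) :
    trivialSector X Y := by
  change _ = _ at h
  change _ = _
  calc
    _ = ((β_ X Y).hom ≫ (β_ Y X).hom) ≫ X ◁ (r.i ≫ r.r) := by simp
    _ = X ◁ r.i ≫ ((β_ X Z).hom ≫ (β_ Z X).hom) ≫ X ◁ r.r := by
      rw [MonoidalCategory.whiskerLeft_comp, ← Category.assoc, ← doubleBraiding_naturality]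
      simp
    _ = 𝟙 _ := by rw [h, Category.id_comp, ← MonoidalCategory.whiskerLeft_comp]; simp

lemma trivialSector_directSum {X : C} {n : ℕ} {Z : C} {Y : Fin n → C} (h : IsDirectSum Z Y)
    (hY : ∀ i, trivialSector X (Y i)) : trivialSector X Z := by
  obtain ⟨p, q, h1, h2, h3⟩ := h.exists_maps
  have hY' : ∀ i, (β_ X (Y i)).hom ≫ (β_ (Y i) X).hom = 𝟙 _ := hY
  change _ = _
  calc
    _ = (X ◁ ∑ i, p i ≫ q i) ≫ (β_ X Z).hom ≫ (β_ Z X).hom := by simp [h1]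
    _ = ∑ i, X ◁ p i ≫ X ◁ q i ≫ (β_ X Z).hom ≫ (β_ Z X).hom := by
      simp only [whiskerLeft_sum, Preadditive.sum_comp, MonoidalCategory.whiskerLeft_comp,
        Category.assoc]
    _ = ∑ i, X ◁ (p i ≫ q i) := by
      refine Finset.sum_congr rfl fun i _ => ?_
      rw [doubleBraiding_naturality, hY', Category.id_comp, MonoidalCategory.whiskerLeft_comp]
    _ = 𝟙 _ := by rw [← whiskerLeft_sum, h1, MonoidalCategory.whiskerLeft_id]

/-- Since `X` braids trivially with `Y`, its double braiding with `Y ⊗ Yᘁ` reduces to that with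
`Yᘁ`. Naturality against the coevaluation then shows that this has the same transpose as the
identity. -/
lemma trivialSector_rightDual {X Y : C} (h : trivialSector X Y) : trivialSector X Yᘁ := by
  have h' := trivialSector_symm h
  change _ = _ at h h'
  refine trivialSector_symm ?_
  change (β_ Yᘁ X).hom ≫ (β_ X Yᘁ).hom = 𝟙 (Yᘁ ⊗ X)
  apply (tensorLeftHomEquiv X Y Yᘁ (Yᘁ ⊗ X)).injective
  have key : (β_ (Y ⊗ Yᘁ) X).hom ≫ (β_ X (Y ⊗ Yᘁ)).hom =
      (α_ Y Yᘁ X).hom ≫ Y ◁ ((β_ Yᘁ X).hom ≫ (β_ X Yᘁ).hom) ≫ (α_ Y Yᘁ X).inv := by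
    simp only [BraidedCategory.braiding_tensor_left_hom, BraidedCategory.braiding_tensor_right_hom,
      Category.assoc, MonoidalCategory.whiskerLeft_comp, Iso.hom_inv_id_assoc]
    rw [← comp_whiskerRight_assoc, h', id_whiskerRight, Category.id_comp, Iso.inv_hom_id_assoc]
  have nat : η_ Y Yᘁ ▷ X ≫ (β_ (Y ⊗ Yᘁ) X).hom ≫ (β_ X (Y ⊗ Yᘁ)).hom = η_ Y Yᘁ ▷ X := by
    rw [BraidedCategory.braiding_naturality_left_assoc, BraidedCategory.braiding_naturality_right]
    simp
  rw [key] at nat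
  have nat' := nat =≫ (α_ Y Yᘁ X).hom
  simp only [Category.assoc, Iso.inv_hom_id, Category.comp_id] at nat'
  simp only [tensorLeftHomEquiv, Equiv.coe_fn_mk]
  rw [nat']
  simp

lemma isDirectSum_biprod (X Y : C) : IsDirectSum (X ⊞ Y) ![X, Y] := by
  refine IsDirectSum.of_maps (Fin.cons biprod.fst (Fin.cons biprod.snd finZeroElim))
    (Fin.cons biprod.inl (Fin.cons biprod.inr finZeroElim)) ?_ ?_ ?_
  · rw [Fin.sum_univ_two]; exact biprod.total
  · intro i; fin_cases i
    · exact biprod.inl_fst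
    · exact biprod.inr_snd
  · intro i j hij; fin_cases i <;> fin_cases j <;> simp at hij
    · exact biprod.inl_snd
    · exact biprod.inr_fst

lemma isFusionSubcategory_trivialSector (X : C) : IsFusionSubcategory (trivialSector X) where
  unit := ObjectProperty.prop_unit _
  tensor Y Z hY hZ := ObjectProperty.prop_tensor hY hZ
  dual Y hY := trivialSector_rightDual hY
  biprod Y Z hY hZ := by
    refine trivialSector_directSum (isDirectSum_biprod Y Z) fun i => ?_
    fin_cases i
    · exact hY
    · exact hZ
  summand Y Z r hZ := trivialSector_retract r hZ

/-- The objects whose double braidings with all objects with property `D` are trivial. -/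
def centralizer (D : ObjectProperty C) : ObjectProperty C :=
  fun X => ∀ Y, D Y → trivialSector Y X

lemma isFusionSubcategory_centralizer (D : ObjectProperty C) :
    IsFusionSubcategory (centralizer D) where
  unit Y _ := (isFusionSubcategory_trivialSector Y).unit
  tensor _ _ h h' Y hY := (isFusionSubcategory_trivialSector Y).tensor _ _ (h Y hY) (h' Y hY)
  dual _ h Y hY := (isFusionSubcategory_trivialSector Y).dual _ (h Y hY)
  biprod _ _ h h' Y hY := (isFusionSubcategory_trivialSector Y).biprod _ _ (h Y hY) (h' Y hY)
  summand _ _ r h Y hY := (isFusionSubcategory_trivialSector Y).summand _ _ r (h Y hY)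

lemma le_centralizer_centralizer (D : ObjectProperty C) : D ≤ centralizer (centralizer D) :=
  fun X hX _ hY => trivialSector_symm (hY X hX)

lemma isFusionSubcategory_top : IsFusionSubcategory (⊤ : ObjectProperty C) where
  unit := trivial
  tensor _ _ _ _ := trivial
  dual _ _ := trivial
  biprod _ _ _ _ := trivial
  summand _ _ _ _ := trivial

lemma hopf_of_trivialSector {X Y : C} (h : trivialSector X Y) : hopf X Y = qdim X * qdim Y := by
  change _ = _ at h
  rw [hopf, h, ← qdim_def, qdim_tensor]

/-- The double braiding `w` is unitary with trace equal to the dimension d, so `𝟙 - w` has squared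
norm d - d - d + d = 0 for the positive trace form. -/
lemma trivialSector_of_hopf {X Y : C} (h : hopf X Y = qdim X * qdim Y) : trivialSector X Y := by
  set w := (β_ X Y).hom ≫ (β_ Y X).hom with hw
  have h1 : w ≫ dag w = 𝟙 _ := by
    rw [hw, dag_comp, dag_braiding, dag_braiding]; simp
  have h2 : trace w = qdim (X ⊗ Y) := by rw [qdim_tensor, ← h]; rfl
  by_contra hne
  have hne' : 𝟙 _ - w ≠ 0 := fun h0 => hne (sub_eq_zero.1 h0).symm
  obtain ⟨r, hr, hr'⟩ := trace_pos _ hne'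
  have : trace ((𝟙 _ - w) ≫ dag (𝟙 _ - w)) = 0 := by
    rw [dag_sub, dag_id]
    simp only [Preadditive.sub_comp, Preadditive.comp_sub, Category.id_comp, Category.comp_id, h1,
      map_sub, trace_dag, h2, conj_qdim, ← qdim_def]
    ring
  rw [this] at hr'
  exact hr.ne' (by exact_mod_cast hr'.symm)

/-! ### Sums over the simple objects of a fusion subcategory -/

section FusionSubcategory

variable {D : ObjectProperty C}

lemma IsFusionSubcategory.of_iso (hD : IsFusionSubcategory D) {X Y : C} (e : X ≅ Y) (h : D Y) :
    D X := hD.summand _ _ (Retract.ofIso e) h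

lemma IsFusionSubcategory.mem_labels (hD : IsFusionSubcategory D) (X : C) [Simple X] :
    label X ∈ labels D ↔ D X :=
  ⟨hD.of_iso (rep_label X).some.symm, hD.of_iso (rep_label X).some⟩

lemma nonempty_retract {X Z : C} [Simple X] {g : Z ⟶ X} (hg : g ≠ 0) :
    Nonempty (Retract X Z) := by
  obtain ⟨n, S, hS, h⟩ := semisimple Z
  obtain ⟨p, q, h1, h2, h3⟩ := h.exists_maps
  have : ∃ i, q i ≫ g ≠ 0 := by
    by_contra! h0
    apply hg
    rw [← Category.id_comp g, ← h1, Preadditive.sum_comp]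
    simp [h0]
  obtain ⟨i, hi⟩ := this
  have := hS i
  have := isIso_of_hom_simple hi
  exact ⟨⟨inv (q i ≫ g) ≫ q i, g, by simp⟩⟩

lemma IsFusionSubcategory.finrank_eq_zero (hD : IsFusionSubcategory D) {Z X : C} [Simple X]
    (hZ : D Z) (hX : ¬ D X) : Module.finrank ℂ (Z ⟶ X) = 0 := by
  have : Subsingleton (Z ⟶ X) := subsingleton_of_forall_eq 0 fun g => by
    by_contra hg
    exact hX (hD.summand _ _ (nonempty_retract hg).some hZ)
  exact Module.finrank_zero_of_subsingleton

open scoped Classical in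
lemma sum_labels (D : ObjectProperty C) (φ : Label C → ℂ) :
    ∑ a : labels D, φ a = ∑ a : Label C, if D a.rep then φ a else 0 := by
  rw [← Finset.sum_filter]
  exact (Finset.sum_subtype _ (by simp [labels]) φ).symm

lemma IsFusionSubcategory.eq_sum_labels (hD : IsFusionSubcategory D) {φ : C → ℂ}
    (hadd : ∀ {n : ℕ} {Z : C} {X : Fin n → C}, IsDirectSum Z X → φ Z = ∑ i, φ (X i))
    (hiso : ∀ {X Y : C}, (X ≅ Y) → φ X = φ Y) {Z : C} (hZ : D Z) :
    φ Z = ∑ e : labels D, Module.finrank ℂ (Z ⟶ e.1.rep) * φ e.1.rep := by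
  classical
  rw [SpinModular.eq_sum_labels hadd hiso,
    sum_labels D fun e => Module.finrank ℂ (Z ⟶ e.rep) * φ e.rep]
  refine Finset.sum_congr rfl fun e _ => ?_
  split_ifs with he
  · rfl
  · rw [hD.finrank_eq_zero hZ he]; simp

lemma finrank_tensor_left_dual (X Y Z : C) :
    Module.finrank ℂ (X ⊗ Y ⟶ Z) = Module.finrank ℂ (Y ⟶ Xᘁ ⊗ Z) := by
  let := BraidedCategory.exactPairing_swap X Xᘁ
  exact finrank_tensorLeft Y Xᘁ X Z

/-- By Frobenius reciprocity the coefficient of `qdim c` is the multiplicity of `c` in `Xᘁ ⊗ Z`, an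
object of `D`. Equivalently, tensoring the regular object ∑ d_c c with `X` multiplies it by d_X. -/
lemma IsFusionSubcategory.sum_qdim_mul_finrank (hD : IsFusionSubcategory D) (X Z : C)
    (hX : D X) (hZ : D Z) :
    ∑ c : labels D, qdim c.1.rep * Module.finrank ℂ (X ⊗ c.1.rep ⟶ Z) = qdim X * qdim Z := by
  have h := hD.eq_sum_labels (φ := qdim) qdim_directSum qdim_congr
    (hD.tensor _ _ (hD.dual X hX) hZ)
  rw [qdim_tensor, qdim_rightDual] at h
  rw [h]
  refine Finset.sum_congr rfl fun c _ => ?_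
  rw [finrank_tensor_left_dual, finrank_hom_rep_symm, mul_comm]

/-- The Hopf link with the sum of `d_c c` over the simple objects `c` in `D`. -/
def killing (D : ObjectProperty C) (X : C) : ℂ := ∑ c : labels D, qdim c.1.rep * hopf X c.1.rep

/-- With R = ∑ d_c c the regular object of `D`, one has Y ⊗ R = d_Y R at the level of
multiplicities, so this is `hopf_mul_hopf` applied to Y and R. -/
lemma IsFusionSubcategory.hopf_mul_killing (hD : IsFusionSubcategory D) (X Y : C) [Simple X]
    (hY : D Y) : hopf X Y * killing D X = qdim X * qdim Y * killing D X := by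
  have h1 : ∀ c : labels D, hopf X (Y ⊗ c.1.rep) =
      ∑ e : labels D, Module.finrank ℂ (Y ⊗ c.1.rep ⟶ e.1.rep) * hopf X e.1.rep := fun c =>
    hD.eq_sum_labels (hopf_directSum X) (hopf_congr_right X) (hD.tensor _ _ hY c.2)
  calc
    _ = ∑ c : labels D, qdim X * (qdim c.1.rep * hopf X (Y ⊗ c.1.rep)) := by
      rw [killing, Finset.mul_sum]
      refine Finset.sum_congr rfl fun c _ => ?_
      rw [mul_left_comm, hopf_mul_hopf]; ring
    _ = qdim X * ∑ e : labels D, hopf X e.1.rep *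
          ∑ c : labels D, qdim c.1.rep * Module.finrank ℂ (Y ⊗ c.1.rep ⟶ e.1.rep) := by
      simp_rw [h1, ← Finset.mul_sum]
      congr 1
      simp_rw [Finset.mul_sum]
      rw [Finset.sum_comm]
      refine Finset.sum_congr rfl fun _ _ => Finset.sum_congr rfl fun _ _ => by ring
    _ = _ := by
      rw [mul_assoc, killing, Finset.mul_sum (a := qdim Y)]
      congr 1
      refine Finset.sum_congr rfl fun e _ => ?_
      rw [hD.sum_qdim_mul_finrank Y _ hY e.2]; ring

lemma IsFusionSubcategory.centralizer_of_simple (hD : IsFusionSubcategory D) {X : C}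
    (h : ∀ Y, Simple Y → D Y → trivialSector X Y) : centralizer D X := by
  intro Y hY
  obtain ⟨n, S, hS, hs⟩ := semisimple Y
  obtain ⟨p, q, h1, h2, h3⟩ := hs.exists_maps
  exact trivialSector_symm (trivialSector_directSum hs fun i =>
    h _ (hS i) (hD.summand _ _ ⟨q i, p i, h2 i⟩ hY))

-- If the sum is nonzero it can be cancelled from `hopf_mul_killing`. Every Hopf link of `X` with
-- `D` is then the product of the dimensions, which by `trivialSector_of_hopf` means that `X`
-- centralizes `D`.
open scoped Classical in
lemma IsFusionSubcategory.killing_eq (hD : IsFusionSubcategory D) (X : C) [Simple X] :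
    killing D X = if centralizer D X then qdim X * globalDim D else 0 := by
  split_ifs with h
  · rw [killing, globalDim, Finset.mul_sum]
    refine Finset.sum_congr rfl fun c _ => ?_
    rw [hopf_of_trivialSector (trivialSector_symm (h _ c.2))]; ring
  · by_contra h0
    refine h (hD.centralizer_of_simple fun Y _ hY => trivialSector_of_hopf ?_)
    exact mul_right_cancel₀ h0 (hD.hopf_mul_killing X Y hY)

/-! ### Müger's criterion for modularity, and double centralizers -/

lemma globalDim_pos (hD : IsFusionSubcategory D) : ∃ r : ℝ, 0 < r ∧ globalDim D = r := by
  choose d hd hd' using fun a : Label C => qdim_pos a.rep (id_nonzero _)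
  refine ⟨∑ a : labels D, d a.1 ^ 2, ?_, by simp [globalDim, hd']⟩
  refine Finset.sum_pos (fun a _ => pow_pos (hd _) 2) ⟨⟨label (𝟙_ C), ?_⟩, Finset.mem_univ _⟩
  exact (hD.mem_labels _).2 hD.unit

lemma globalDim_ne_zero (hD : IsFusionSubcategory D) : globalDim D ≠ 0 := by
  obtain ⟨r, hr, h⟩ := globalDim_pos hD
  rw [h]
  exact_mod_cast hr.ne'

/-- The row of the S-matrix at an object centralizing `D` is its dimension times the row of the
unit, a linear dependence unless the two labels coincide. -/
lemma IsModularSubcategory.iso_unit_of_centralizer (hD : IsModularSubcategory D) {X : C} [Simple X]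
    (hX : D X) (h : centralizer D X) : Nonempty (X ≅ 𝟙_ C) := by
  classical
  rw [← label_eq_iff]
  by_contra hne
  have hF := hD.toIsFusionSubcategory
  let x : labels D := ⟨label X, (hF.mem_labels X).2 hX⟩
  let o : labels D := ⟨label (𝟙_ C), (hF.mem_labels _).2 hF.unit⟩
  have hxo : x ≠ o := fun h => hne (congrArg Subtype.val h)
  apply hD.det_ne_zero
  rw [← Matrix.exists_vecMul_eq_zero_iff]
  refine ⟨Pi.single x 1 - qdim X • Pi.single o 1, ?_, ?_⟩
  · intro h0
    have := congrFun h0 x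
    simp [hxo] at this
  · ext c
    rw [Matrix.sub_vecMul, Matrix.smul_vecMul, Matrix.single_one_vecMul, Matrix.single_one_vecMul]
    simp only [Pi.sub_apply, Pi.smul_apply, Matrix.submatrix_apply, Matrix.row_apply, sMatrix_apply,
      smul_eq_mul, Pi.zero_apply]
    have h1 : hopf x.1.rep c.1.rep = hopf X c.1.rep := hopf_congr (rep_label X).some (Iso.refl _)
    have h2 : hopf o.1.rep c.1.rep = hopf (𝟙_ C) c.1.rep :=
      hopf_congr (rep_label _).some (Iso.refl _)
    rw [h1, h2, hopf_comm (𝟙_ C), hopf_unit,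
      hopf_of_trivialSector (trivialSector_symm (h _ c.2)), sub_self]

/-- When only the unit centralizes `D`, the square of the S-matrix is dim D times charge
conjugation, hence invertible. -/
lemma IsFusionSubcategory.isModularSubcategory (hD : IsFusionSubcategory D)
    (h : ∀ X, Simple X → D X → centralizer D X → Nonempty (X ≅ 𝟙_ C)) :
    IsModularSubcategory D := by
  classical
  refine ⟨hD, fun hdet => ?_⟩
  obtain ⟨v, hv, hv'⟩ := Matrix.exists_mulVec_eq_zero_iff.2 hdet
  apply hv
  have hS : ∀ b : labels D, ∑ c : labels D, hopf b.1.rep c.1.rep * v c = 0 := fun b =>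
    congrFun hv' b
  -- The rank of `Hom (e, 𝟙)` serves as the indicator of the unit label.
  have hk : ∀ e : labels D, killing D e.1.rep =
      Module.finrank ℂ (e.1.rep ⟶ 𝟙_ C) * globalDim D := by
    intro e
    rw [hD.killing_eq, finrank_hom_simple, label_eq_iff]
    by_cases he : Nonempty (e.1.rep ≅ 𝟙_ C)
    · rw [if_pos he, if_pos, qdim_congr he.some, qdim_unit]; · simp
      exact (isFusionSubcategory_centralizer D).of_iso he.some
        (isFusionSubcategory_centralizer D).unit
    · rw [if_neg he, if_neg fun h' => he (h _ inferInstance e.2 h')]; simp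
  have hS2 : ∀ (a : C) (c : labels D), D a → ∑ b : labels D, hopf b.1.rep a * hopf b.1.rep c.1.rep =
      Module.finrank ℂ (a ⊗ c.1.rep ⟶ 𝟙_ C) * globalDim D := by
    intro a c ha
    calc
      _ = ∑ b : labels D, qdim b.1.rep * ∑ e : labels D,
            Module.finrank ℂ (a ⊗ c.1.rep ⟶ e.1.rep) * hopf b.1.rep e.1.rep := by
        refine Finset.sum_congr rfl fun b _ => ?_
        rw [hopf_mul_hopf, ← hD.eq_sum_labels (hopf_directSum b.1.rep) (hopf_congr_right b.1.rep)
          (hD.tensor _ _ ha c.2)]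
      _ = ∑ e : labels D, Module.finrank ℂ (a ⊗ c.1.rep ⟶ e.1.rep) * killing D e.1.rep := by
        simp_rw [killing, Finset.mul_sum]
        rw [Finset.sum_comm]
        refine Finset.sum_congr rfl fun e _ => Finset.sum_congr rfl fun b _ => ?_
        rw [hopf_comm e.1.rep]; ring
      _ = _ := by
        simp_rw [hk, ← mul_assoc]
        rw [← Finset.sum_mul, hD.eq_sum_labels (Z := a ⊗ c.1.rep)
          (φ := fun Z => (Module.finrank ℂ (Z ⟶ 𝟙_ C) : ℂ)) (fun h => ?_) (fun e => ?_)
          (hD.tensor _ _ ha c.2)]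
        · rw [finrank_hom_directSum h]; simp
        · rw [finrank_hom_congr e (Iso.refl _)]
  ext c₀
  -- Pairing `S v = 0` with the dual of `c₀` isolates the coordinate of `v` at `c₀`, multiplied by
  -- the nonzero dimension of `D`.
  have h0 : ∑ b : labels D, hopf b.1.rep (c₀.1.rep)ᘁ * ∑ c : labels D, hopf b.1.rep c.1.rep * v c = 0 := by
    simp [hS]
  simp_rw [Finset.mul_sum, ← mul_assoc] at h0
  rw [Finset.sum_comm] at h0
  simp_rw [← Finset.sum_mul, hS2 _ _ (hD.dual _ c₀.2)] at h0
  have hN : ∀ c : labels D, Module.finrank ℂ ((c₀.1.rep)ᘁ ⊗ c.1.rep ⟶ 𝟙_ C) =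
      if c = c₀ then 1 else 0 := by
    intro c
    rw [finrank_tensorLeft c.1.rep c₀.1.rep, finrank_hom_congr (Iso.refl _) (ρ_ c₀.1.rep),
      finrank_hom_simple]
    simp [Subtype.ext_iff]
  simp_rw [hN] at h0
  simpa [globalDim_ne_zero hD] using h0

lemma isModularSubcategory_top (hC : IsModular C) : IsModularSubcategory (⊤ : ObjectProperty C) where
  toIsFusionSubcategory := isFusionSubcategory_top
  det_ne_zero := by
    classical
    have := Matrix.det_submatrix_equiv_self
      (Equiv.subtypeUnivEquiv (p := (· ∈ labels (⊤ : ObjectProperty C))) fun a => trivial)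
      (sMatrix C)
    intro h
    refine hC ?_
    rw [← this]
    convert h using 2; rfl

/-- The double sum of d_x d_c S_{xc} over simple x in `C` and c in `D` is evaluated in both orders.
Summing over c first leaves the x that centralize `D`; summing over x first leaves only c = 𝟙, by
modularity. -/
theorem globalDim_mul_globalDim_centralizer (hC : IsModular C) (hD : IsFusionSubcategory D) :
    globalDim D * globalDim (centralizer D) = globalDim (⊤ : ObjectProperty C) := by
  classical
  have hT := isModularSubcategory_top hC
  have h1 : ∑ x : Label C, qdim x.rep * killing D x.rep =
      globalDim D * globalDim (centralizer D) := by
    rw [globalDim, globalDim, sum_labels (centralizer D) fun a => qdim a.rep ^ 2, Finset.mul_sum]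
    refine Finset.sum_congr rfl fun x _ => ?_
    rw [hD.killing_eq]
    split_ifs
    · rw [globalDim]; ring
    · simp
  have h2 : ∑ x : Label C, qdim x.rep * killing D x.rep =
      ∑ c : labels D, qdim c.1.rep * killing (⊤ : ObjectProperty C) c.1.rep := by
    simp_rw [killing, Finset.mul_sum]
    rw [Finset.sum_comm]
    refine Finset.sum_congr rfl fun c _ => ?_
    rw [sum_labels ⊤ fun x => qdim c.1.rep * (qdim x.rep * hopf c.1.rep x.rep)]
    refine Finset.sum_congr rfl fun x _ => ?_
    rw [if_pos (show (⊤ : ObjectProperty C) x.rep from trivial), hopf_comm]; ring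
  rw [← h1, h2, Finset.sum_eq_single ⟨label (𝟙_ C), (hD.mem_labels _).2 hD.unit⟩]
  · rw [isFusionSubcategory_top.killing_eq, if_pos, qdim_congr (rep_label (𝟙_ C)).some, qdim_unit]
    · simp
    · exact (isFusionSubcategory_centralizer ⊤).of_iso (rep_label (𝟙_ C)).some
        (isFusionSubcategory_centralizer ⊤).unit
  · intro c _ hc
    rw [isFusionSubcategory_top.killing_eq, if_neg, mul_zero]
    intro h
    refine hc (Subtype.ext ?_)
    rw [← label_rep c.1, label_eq_iff]
    exact hT.iso_unit_of_centralizer trivial h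
  · simp

/-- Every simple object has positive squared dimension, so a missing label would make the inequality
of dimensions strict. -/
lemma labels_eq_of_globalDim_eq {D' : ObjectProperty C} (hle : D ≤ D')
    (h : globalDim D = globalDim D') : labels D = labels D' := by
  classical
  refine Set.Subset.antisymm (fun a ha => hle _ ha) fun a ha => ?_
  by_contra hna
  choose d hd hd' using fun a : Label C => qdim_pos a.rep (id_nonzero _)
  rw [globalDim, globalDim, sum_labels D fun a => qdim a.rep ^ 2,
    sum_labels D' fun a => qdim a.rep ^ 2] at h
  simp only [hd'] at h
  have h' : ∑ a : Label C, (if D a.rep then d a ^ 2 else 0) =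
      ∑ a : Label C, (if D' a.rep then d a ^ 2 else 0) := by
    have : ∀ (P : ObjectProperty C) (a : Label C), (if P a.rep then (d a : ℂ) ^ 2 else 0) =
        ((if P a.rep then d a ^ 2 else 0 : ℝ) : ℂ) := by
      intro P a; split_ifs <;> simp
    simp_rw [this] at h
    exact_mod_cast h
  refine (Finset.sum_lt_sum (fun b _ => ?_) ⟨a, Finset.mem_univ a, ?_⟩).ne h'
  · by_cases hb : D b.rep
    · simp [hb, hle _ hb]
    · rw [if_neg hb]; split_ifs <;> positivity
  · rw [if_neg (show ¬ D a.rep from hna), if_pos (show D' a.rep from ha)]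
    have := hd a
    positivity

/-- Two applications of the dimension formula show that the double centralizer has the dimension of
`D`, hence the same simple objects. A simple object of the centralizer that also centralizes it
therefore lies in `D` and centralizes `D`, so it is the unit. -/
theorem isModularSubcategory_centralizer (hC : IsModular C) (hD : IsModularSubcategory D) :
    IsModularSubcategory (centralizer D) := by
  have hF := hD.toIsFusionSubcategory
  have hF' := isFusionSubcategory_centralizer D
  have h1 := globalDim_mul_globalDim_centralizer hC hF
  have h2 := globalDim_mul_globalDim_centralizer hC hF'
  rw [← h1, mul_comm] at h2
  have h3 := labels_eq_of_globalDim_eq (le_centralizer_centralizer D)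
    (mul_right_cancel₀ (globalDim_ne_zero hF') h2).symm
  refine hF'.isModularSubcategory fun X _ hX hX' => ?_
  refine hD.iso_unit_of_centralizer ?_ hX
  rw [← hF.mem_labels, h3, (isFusionSubcategory_centralizer _).mem_labels]
  exact hX'

end FusionSubcategory

end

section

variable {C : Type u} [Category.{v} C] [UnitaryRibbonFusionCategory C]

/-! ### Objects of order two -/

lemma whiskerLeft_injective_of_iso {g : C} (e : g ⊗ g ≅ 𝟙_ C) {X Y : C} {h h' : X ⟶ Y}
    (hh : g ◁ h = g ◁ h') : h = h' := by
  have h1 : ∀ k : X ⟶ Y, k = (λ_ X).inv ≫ e.inv ▷ X ≫ (α_ g g X).hom ≫ g ◁ g ◁ k ≫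
      (α_ g g Y).inv ≫ e.hom ▷ Y ≫ (λ_ Y).hom := by
    intro k
    have h2 : g ◁ g ◁ k = (α_ g g X).inv ≫ (g ⊗ g) ◁ k ≫ (α_ g g Y).hom := by simp
    rw [h2]
    simp only [Category.assoc, Iso.hom_inv_id_assoc]
    rw [whisker_exchange_assoc, ← comp_whiskerRight_assoc, e.inv_hom_id]
    simp
  rw [h1 h, h1 h', hh]

/-- Whiskering with an object, as a linear map. -/
def whiskerLeftLinear (g X Y : C) : (X ⟶ Y) →ₗ[ℂ] (g ⊗ X ⟶ g ⊗ Y) where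
  toFun h := g ◁ h
  map_add' _ _ := by simp
  map_smul' _ _ := by simp

lemma whiskerLeftLinear_injective {g : C} (e : g ⊗ g ≅ 𝟙_ C) (X Y : C) :
    Function.Injective (whiskerLeftLinear g X Y) :=
  fun _ _ h => whiskerLeft_injective_of_iso e h

/-- Tensoring twice with `g` returns to the original morphism space, so two injections force
equality of dimensions. -/
lemma finrank_whiskerLeft {g : C} (e : g ⊗ g ≅ 𝟙_ C) (X Y : C) :
    Module.finrank ℂ (g ⊗ X ⟶ g ⊗ Y) = Module.finrank ℂ (X ⟶ Y) := by
  refine le_antisymm ?_ (LinearMap.finrank_le_finrank_of_injective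
    (whiskerLeftLinear_injective e X Y))
  rw [finrank_hom_congr ((whiskerRightIso e.symm X ≪≫ α_ g g X).symm ≪≫ λ_ X |>.symm) 
    ((whiskerRightIso e.symm Y ≪≫ α_ g g Y).symm ≪≫ λ_ Y |>.symm)]
  exact LinearMap.finrank_le_finrank_of_injective (whiskerLeftLinear_injective e _ _)

lemma whiskerLeftLinear_bijective {g : C} (e : g ⊗ g ≅ 𝟙_ C) (X Y : C) :
    Function.Bijective (whiskerLeftLinear g X Y) :=
  ⟨whiskerLeftLinear_injective e X Y, (LinearMap.injective_iff_surjective_of_finrank_eq_finrank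
    (finrank_whiskerLeft e X Y).symm).1 (whiskerLeftLinear_injective e X Y)⟩

/-- Tensoring with an object of order two is an involution up to isomorphism. -/
def tensorSelfIso {g : C} (e : g ⊗ g ≅ 𝟙_ C) (X : C) : g ⊗ (g ⊗ X) ≅ X :=
  (α_ g g X).symm ≪≫ whiskerRightIso e X ≪≫ λ_ X

lemma simple_tensor {g : C} (e : g ⊗ g ≅ 𝟙_ C) (X : C) [Simple X] : Simple (g ⊗ X) := by
  rw [simple_iff_finrank_end, finrank_whiskerLeft e, ← simple_iff_finrank_end]
  infer_instance

lemma qdim_of_iso_unit {g : C} (e : g ⊗ g ≅ 𝟙_ C) [Simple g] : qdim g = 1 := by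
  have h := qdim_tensor g g
  rw [qdim_congr e, qdim_unit] at h
  obtain ⟨r, hr, h'⟩ := qdim_pos g (id_nonzero g)
  rw [h'] at h ⊢
  have : 1 = r * r := by exact_mod_cast h
  have : r = 1 := by nlinarith
  simp [this]

-- Tensoring with `g` permutes the simple objects by an involution that preserves dimensions, since
-- d_g = 1.
open scoped Classical in
lemma sum_shift {D : ObjectProperty C} (hD : IsFusionSubcategory D) {g : C} [Simple g] (e : g ⊗ g ≅ 𝟙_ C) :
    ∑ a : Label C, (if D (g ⊗ a.rep) then qdim a.rep ^ 2 else 0) = globalDim D := by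
  have hs : ∀ a : Label C, Simple (g ⊗ a.rep) := fun a => simple_tensor e _
  let τ : Label C → Label C := fun a => label (g ⊗ a.rep)
  have hτ : ∀ a, Nonempty ((τ a).rep ≅ g ⊗ a.rep) := fun a => rep_label _
  have hinv : Function.Involutive τ := by
    intro a
    conv_rhs => rw [← label_rep a]
    rw [label_eq_iff]
    exact ⟨whiskerLeftIso g (hτ a).some ≪≫ tensorSelfIso e _⟩
  rw [globalDim, sum_labels D fun a => qdim a.rep ^ 2]
  refine Eq.trans ?_ (Equiv.sum_comp hinv.toPerm fun a : Label C => if D a.rep then qdim a.rep ^ 2 else 0)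
  refine Finset.sum_congr rfl fun a _ => ?_
  change _ = if D (τ a).rep then qdim (τ a).rep ^ 2 else 0
  rw [qdim_congr (hτ a).some, qdim_tensor, qdim_of_iso_unit e, one_mul]
  exact if_congr ⟨hD.of_iso (hτ a).some, hD.of_iso (hτ a).some.symm⟩ rfl rfl

/-- The object `g` is a summand of `(g ⊗ X) ⊗ Xᘁ`. -/
lemma mem_of_tensor_mem {D : ObjectProperty C} (hD : IsFusionSubcategory D) {g X : C} [Simple X]
    [Simple g] (e : g ⊗ g ≅ 𝟙_ C) (hX : D X) (h : D (g ⊗ X)) : D g := by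
  have h1 : Module.finrank ℂ ((g ⊗ X) ⊗ Xᘁ ⟶ g) ≠ 0 := by
    let := BraidedCategory.exactPairing_swap X Xᘁ
    rw [finrank_tensorRight (g ⊗ X) Xᘁ X g, finrank_whiskerLeft e, (simple_iff_finrank_end X).1 inferInstance]
    exact one_ne_zero
  by_contra hg
  exact h1 (hD.finrank_eq_zero (hD.tensor _ _ h (hD.dual _ hX)) hg)

/-- Splitting off an object of order two from a fusion subcategory. -/
lemma globalDim_eq_two_mul {D P : ObjectProperty C} (hD : IsFusionSubcategory D) {g : C} [Simple g]
    (e : g ⊗ g ≅ 𝟙_ C) (hg : ¬ D g)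
    (h : ∀ X, Simple X → (P X ↔ D X ∨ D (g ⊗ X))) : globalDim P = 2 * globalDim D := by
  classical
  rw [two_mul]
  nth_rw 2 [← sum_shift hD e]
  rw [globalDim, globalDim, sum_labels P fun a => qdim a.rep ^ 2,
    sum_labels D fun a => qdim a.rep ^ 2, ← Finset.sum_add_distrib]
  refine Finset.sum_congr rfl fun a _ => ?_
  have h1 := h a.rep inferInstance
  -- As `g` is not in `D`, the simple objects of `D` and of its translate by `g` are disjoint, and
  -- each family contributes the dimension of `D`.
  have h2 : D a.rep → ¬ D (g ⊗ a.rep) := fun h3 h4 => hg (mem_of_tensor_mem hD e h3 h4)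
  by_cases h3 : D a.rep
  · simp [h1, h3, h2 h3]
  · simp [h1, h3]

/-- The union of `D` with its translate by `g` is contained in `P` and already has the dimension of
`P`, so it contains every simple object of `P`. -/
lemma mem_of_globalDim_eq {D P : ObjectProperty C} (hD : IsFusionSubcategory D) {g : C} [Simple g]
    (e : g ⊗ g ≅ 𝟙_ C) (hg : ¬ D g) (h1 : D ≤ P)
    (h2 : ∀ X, D (g ⊗ X) → P X) (h : globalDim P = 2 * globalDim D) {X : C} [Simple X] (hX : P X)
    (hP : IsFusionSubcategory P) : D X ∨ D (g ⊗ X) := by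
  let Q : ObjectProperty C := fun X => D X ∨ D (g ⊗ X)
  have hQ : Q ≤ P := fun X hX => hX.elim (h1 X) (h2 X)
  have h3 : globalDim Q = globalDim P := by
    rw [h]; exact globalDim_eq_two_mul hD e hg fun X _ => Iff.rfl
  have h4 : label X ∈ labels Q := by
    rw [labels_eq_of_globalDim_eq hQ h3]
    exact (hP.mem_labels X).2 hX
  exact h4.imp (hD.of_iso (rep_label X).some.symm)
    (hD.of_iso (whiskerLeftIso g (rep_label X).some.symm))

/-! ### Fermions -/

variable {f : C}

/-- The twist is -1 on `f` and 1 on the unit. -/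
lemma IsFermion.not_iso_unit (hf : IsFermion f) : IsEmpty (f ≅ 𝟙_ C) := by
  constructor
  intro e
  have h := BalancedCategory.twist_naturality e.hom
  rw [hf.twist, twist_unit, Category.comp_id, Preadditive.neg_comp, Category.id_comp] at h
  have h0 : (2 : ℂ) • e.hom = 0 := by
    rw [two_smul]; nth_rw 1 [h]; simp
  have h1 : e.hom = 0 := (smul_eq_zero.1 h0).resolve_left two_ne_zero
  have := hf.simple
  apply id_nonzero f
  rw [← e.hom_inv_id, h1, zero_comp]

/-- The twist of `f ⊗ f ≅ 𝟙_ C` is trivial, and it equals (-1)(-1) times the double braiding of `f`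
with itself. -/
lemma IsFermion.trivialSector_self (hf : IsFermion f) : trivialSector f f := by
  obtain ⟨e⟩ := hf.tensor_self
  have h := BalancedCategory.twist_naturality e.hom
  rw [twist_unit, Category.comp_id, BalancedCategory.twist_tensor, hf.twist] at h
  have h1 : (-𝟙 f ⊗ₘ -𝟙 f) = 𝟙 (f ⊗ f) := by
    have h2 : -𝟙 f = (-1 : ℂ) • 𝟙 f := by simp
    rw [MonoidalCategory.tensorHom_def, h2, MonoidalLinear.smul_whiskerRight,
      MonoidalLinear.whiskerLeft_smul, id_whiskerRight, MonoidalCategory.whiskerLeft_id,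
      Linear.smul_comp, Category.id_comp, smul_smul]
    simp
  rw [h1, Category.id_comp] at h
  exact ((cancel_mono e.hom).1 ((Category.id_comp _).trans h)).symm

lemma hopf_eq_or_neg {g : C} [Simple g] (e : g ⊗ g ≅ 𝟙_ C) (X : C) [Simple X] :
    hopf X g = qdim X ∨ hopf X g = - qdim X := by
  have h := hopf_mul_hopf X g g
  rw [hopf_congr_right X e, hopf_unit] at h
  exact mul_self_eq_mul_self_iff.1 h

/-- The trivial sector of a fermion has half of the total dimension. -/
theorem globalDim_trivialSector (hC : IsModular C) (hf : IsFermion f) :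
    globalDim (⊤ : ObjectProperty C) = 2 * globalDim (trivialSector f) := by
  classical
  have := hf.simple
  obtain ⟨e⟩ := hf.tensor_self
  -- In a modular category only the unit has a nonzero Hopf link with the regular object.
  have h1 : killing ⊤ f = 0 := by
    rw [isFusionSubcategory_top.killing_eq, if_neg]
    exact fun h => hf.not_iso_unit.false
      ((isModularSubcategory_top hC).iso_unit_of_centralizer trivial h).some
  rw [killing, sum_labels ⊤ fun a => qdim a.rep * hopf f a.rep] at h1
  -- Each Hopf link with `f` is ± d_a, so adding the vanishing sum `h1` doubles the terms of the
  -- trivial sector and cancels the others.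
  have h2 : ∀ a : Label C, qdim a.rep ^ 2 + qdim a.rep * hopf f a.rep =
      2 * if trivialSector f a.rep then qdim a.rep ^ 2 else 0 := by
    intro a
    have hd : qdim f = 1 := qdim_of_iso_unit e
    split_ifs with h
    · rw [hopf_of_trivialSector h, hd]; ring
    · rcases hopf_eq_or_neg e a.rep with h' | h'
      · refine absurd (trivialSector_of_hopf ?_) h
        rw [hopf_comm, h', hd, one_mul]
      · rw [hopf_comm, h']; ring
  rw [← add_zero (globalDim _), ← h1, globalDim, globalDim, sum_labels ⊤ fun a => qdim a.rep ^ 2,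
    sum_labels (trivialSector f) fun a => qdim a.rep ^ 2, Finset.mul_sum, ← Finset.sum_add_distrib]
  refine Finset.sum_congr rfl fun a _ => ?_
  rw [← h2, if_pos (show (⊤ : ObjectProperty C) a.rep from trivial),
    if_pos (show (⊤ : ObjectProperty C) a.rep from trivial)]

/-- The witness is the centralizer of `D`. It contains `f` because `D` lies in the trivial sector,
and its dimension is 2 · (2 dim D) / dim D = 4. -/
theorem exists_modular_of_split_dimension (hC : IsModular C) (hf : IsFermion f)
    {D : ObjectProperty C} (hle : D ≤ trivialSector f) (hD : IsModularSubcategory D)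
    (hdim : globalDim D = globalDim (trivialSector f) / 2) :
    ∃ A : ObjectProperty C, IsModularSubcategory A ∧ globalDim A = 4 ∧ A f := by
  refine ⟨centralizer D, isModularSubcategory_centralizer hC hD, ?_,
    fun Y hY => trivialSector_symm (hle Y hY)⟩
  have h := globalDim_mul_globalDim_centralizer hC hD.toIsFusionSubcategory
  rw [globalDim_trivialSector hC hf] at h
  have h' : globalDim (trivialSector f) = 2 * globalDim D := by rw [hdim]; ring
  rw [h'] at h
  refine mul_left_cancel₀ (globalDim_ne_zero hD.toIsFusionSubcategory) (h.trans (by ring))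

/-- The centralizer of a modular subcategory of dimension four containing the fermion. -/
theorem centralizer_properties (hC : IsModular C) (hf : IsFermion f)
    {A : ObjectProperty C} (hA : IsModularSubcategory A) (hdim : globalDim A = 4) (hfA : A f) :
    centralizer A ≤ trivialSector f ∧ ¬ centralizer A f ∧
      ∀ X, Simple X → trivialSector f X → centralizer A X ∨ centralizer A (f ⊗ X) := by
  have := hf.simple
  obtain ⟨e⟩ := hf.tensor_self
  have hle : centralizer A ≤ trivialSector f := fun X hX => hX f hfA
  have hF := isFusionSubcategory_centralizer A
  have hT := isFusionSubcategory_trivialSector f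
  have hn : ¬ centralizer A f := fun h =>
    hf.not_iso_unit.false (hA.iso_unit_of_centralizer hfA h).some
  have hff := hf.trivialSector_self
  refine ⟨hle, hn, fun X _ hX => mem_of_globalDim_eq hF e hn hle (fun Y hY => ?_) ?_ hX hT⟩
  · exact hT.of_iso (tensorSelfIso e Y).symm (hT.tensor _ _ hff (hle _ hY))
  -- From 4 dim A' = dim C = 2 dim C₀ it follows that dim C₀ = 2 dim A', so A' and its translate by
  -- `f` fill C₀.
  · have h := globalDim_mul_globalDim_centralizer hC hA.toIsFusionSubcategory
    rw [globalDim_trivialSector hC hf, hdim] at h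
    linear_combination (-1 / 2) * h

end

section

variable {C : Type u} [Category.{v} C] [UnitaryRibbonFusionCategory C] {D : ObjectProperty C}

/-! ### Fusion subcategories are unitary ribbon fusion categories -/

/-- The hypothesis makes `Z` a retract of the direct sum of the `Y i`, which is built one biproduct
at a time; no orthogonality of the maps is needed. -/
lemma IsFusionSubcategory.of_sum (hD : IsFusionSubcategory D) {ι : Type*} [Fintype ι] {Y : ι → C}
    (hY : ∀ i, D (Y i)) {Z : C} (p : ∀ i, Z ⟶ Y i) (q : ∀ i, Y i ⟶ Z)
    (h : ∑ i, p i ≫ q i = 𝟙 Z) : D Z := by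
  classical
  have key : ∀ s : Finset ι, ∃ (W : C) (a : Z ⟶ W) (b : W ⟶ Z), D W ∧
      a ≫ b = ∑ i ∈ s, p i ≫ q i := by
    intro s
    induction s using Finset.induction_on with
    | empty => exact ⟨𝟙_ C, 0, 0, hD.unit, by simp⟩
    | insert i s hi ih =>
      obtain ⟨W, a, b, hW, hab⟩ := ih
      exact ⟨Y i ⊞ W, biprod.lift (p i) a, biprod.desc (q i) b, hD.biprod _ _ (hY i) hW, by
        rw [biprod.lift_desc, hab, Finset.sum_insert hi]⟩
  obtain ⟨W, a, b, hW, hab⟩ := key Finset.univ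
  exact hD.summand _ _ ⟨a, b, hab.trans h⟩ hW

lemma nonempty_retract' {X Z : C} [Simple X] {g : X ⟶ Z} (hg : g ≠ 0) :
    Nonempty (Retract X Z) := by
  obtain ⟨n, S, hS, h⟩ := semisimple Z
  obtain ⟨p, q, h1, h2, h3⟩ := h.exists_maps
  have : ∃ i, g ≫ p i ≠ 0 := by
    by_contra! h0
    apply hg
    rw [← Category.comp_id g, ← h1, Preadditive.comp_sum]
    simp [← Category.assoc, h0]
  obtain ⟨i, hi⟩ := this
  have := hS i
  have := isIso_of_hom_simple hi
  exact ⟨⟨g, p i ≫ inv (g ≫ p i), by rw [← Category.assoc, IsIso.hom_inv_id]⟩⟩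

/-- By semisimplicity, each simple summand of `X` embeds in `Y` and is therefore a retract of it. -/
lemma IsFusionSubcategory.of_mono (hD : IsFusionSubcategory D) {X Y : C} (i : X ⟶ Y) [Mono i]
    (hY : D Y) : D X := by
  obtain ⟨n, S, hS, h⟩ := semisimple X
  obtain ⟨p, q, h1, h2, h3⟩ := h.exists_maps
  refine hD.of_sum (fun j => ?_) p q h1
  have : q j ≫ i ≠ 0 := by
    intro h0
    have := hS j
    have hq := zero_of_comp_mono i h0
    exact id_nonzero (S j) (by rw [← h2, hq, zero_comp])
  exact hD.summand _ _ (nonempty_retract' this).some hY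

lemma IsFusionSubcategory.of_epi (hD : IsFusionSubcategory D) {X Y : C} (g : Y ⟶ X) [Epi g]
    (hY : D Y) : D X := by
  obtain ⟨n, S, hS, h⟩ := semisimple X
  obtain ⟨p, q, h1, h2, h3⟩ := h.exists_maps
  refine hD.of_sum (fun j => ?_) p q h1
  have : g ≫ p j ≠ 0 := by
    intro h0
    have := hS j
    have hq := zero_of_epi_comp g h0
    exact id_nonzero (S j) (by rw [← h2, hq, comp_zero])
  exact hD.summand _ _ (nonempty_retract this).some hY

lemma IsFusionSubcategory.isMonoidal (hD : IsFusionSubcategory D) : D.IsMonoidal where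
  prop_unit := hD.unit
  prop_tensor := hD.tensor

lemma IsFusionSubcategory.containsZero (hD : IsFusionSubcategory D) : D.ContainsZero :=
  ⟨⟨_, isZero_zero C, hD.of_mono (0 : _ ⟶ 𝟙_ C) hD.unit⟩⟩

lemma IsFusionSubcategory.isClosedUnderSubobjects (hD : IsFusionSubcategory D) :
    D.IsClosedUnderSubobjects :=
  ⟨fun f _ h => hD.of_mono f h⟩

lemma IsFusionSubcategory.isClosedUnderQuotients (hD : IsFusionSubcategory D) :
    D.IsClosedUnderQuotients :=
  ⟨fun f _ h => hD.of_epi f h⟩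

lemma IsFusionSubcategory.isClosedUnderFiniteProducts (hD : IsFusionSubcategory D) :
    D.IsClosedUnderFiniteProducts where
  isClosedUnderLimitsOfShape J _ := ⟨by
    classical
    rintro Z ⟨h⟩
    have := Fintype.ofFinite J
    let q : ∀ j : J, h.diag.obj ⟨j⟩ ⟶ Z := fun j => h.isLimit.lift ⟨h.diag.obj ⟨j⟩,
      Discrete.natTrans fun k => if hk : j = k.as then eqToHom (by subst hk; rfl) else 0⟩
    have hq : ∀ j k : J, q j ≫ h.π.app ⟨k⟩ =
        if hk : j = k then eqToHom (by subst hk; rfl) else 0 := fun j k =>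
      h.isLimit.fac _ ⟨k⟩
    refine hD.of_sum (fun j : J => h.prop_diag_obj ⟨j⟩) (fun j => h.π.app ⟨j⟩) q ?_
    refine h.isLimit.hom_ext fun k => ?_
    change (∑ j : J, h.π.app ⟨j⟩ ≫ q j) ≫ h.π.app ⟨k.as⟩ = 𝟙 Z ≫ h.π.app ⟨k.as⟩
    rw [Preadditive.sum_comp, Finset.sum_eq_single k.as]
    · simp [hq]
    · intro j _ hj
      simp [hq, hj]
    · simp⟩

/-- The duals of the objects of a fusion subcategory. -/
@[reducible] def IsFusionSubcategory.rightRigid (hD : IsFusionSubcategory D) [D.IsMonoidal] :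
    RightRigidCategory D.FullSubcategory where
  rightDual X :=
    { rightDual := ⟨X.objᘁ, hD.dual _ X.property⟩
      exact :=
        { coevaluation' := ObjectProperty.homMk (η_ X.obj X.objᘁ)
          evaluation' := ObjectProperty.homMk (ε_ X.obj X.objᘁ)
          coevaluation_evaluation' := by
            ext; exact ExactPairing.coevaluation_evaluation _ _
          evaluation_coevaluation' := by
            ext; exact ExactPairing.evaluation_coevaluation _ _ } }

/-- The morphisms of a full subcategory, linearly. -/
def fullHomEquiv (D : ObjectProperty C) (X Y : D.FullSubcategory) : (X ⟶ Y) ≃ₗ[ℂ] (X.obj ⟶ Y.obj) where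
  toFun f := f.hom
  invFun f := ObjectProperty.homMk f
  map_add' _ _ := rfl
  map_smul' _ _ := rfl
  left_inv _ := rfl
  right_inv _ := rfl

lemma IsFusionSubcategory.simple_iff (hD : IsFusionSubcategory D) (X : D.FullSubcategory) :
    Simple X ↔ Simple X.obj := by
  have := hD.containsZero
  have := hD.isClosedUnderSubobjects
  have := hD.isClosedUnderQuotients
  have := hD.isClosedUnderFiniteProducts
  constructor
  · intro h
    have : FiniteDimensional ℂ (X ⟶ X) := Module.Finite.equiv (fullHomEquiv D X X).symm
    apply simple_of_finrank_end
    rw [← (fullHomEquiv D X X).finrank_eq, finrank_endomorphism_simple_eq_one ℂ X]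
  · intro h
    have := D.preservesMonomorphisms_ι_of_isNormalEpiCategory
    refine ⟨fun {Y} f _ => ⟨fun _ h0 => ?_, fun h0 => ?_⟩⟩
    · apply id_nonzero X.obj
      have h1 : 𝟙 X = 0 := by
        rw [← IsIso.inv_hom_id f]
        exact (congrArg (inv f ≫ ·) h0).trans comp_zero
      exact congrArg (·.hom) h1
    · rw [← ObjectProperty.isIso_hom_iff]
      have : Mono f.hom := inferInstanceAs (Mono (D.ι.map f))
      exact isIso_of_mono_of_nonzero fun h1 => h0 (by ext; exact h1)

lemma IsFusionSubcategory.finite_label (hD : IsFusionSubcategory D) :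
    Finite (Label D.FullSubcategory) := by
  have hs : ∀ a : Label D.FullSubcategory, Simple a.out.val.obj := fun a =>
    (hD.simple_iff _).1 a.out.property
  refine Finite.of_injective (fun a : Label D.FullSubcategory => label a.out.val.obj) fun a b h => ?_
  obtain ⟨e⟩ := (label_eq_iff _ _).1 h
  rw [← Quotient.out_eq a, ← Quotient.out_eq b]
  exact Quotient.sound ⟨D.isoMk e⟩

lemma IsFusionSubcategory.semisimple (hD : IsFusionSubcategory D) (X : D.FullSubcategory) :
    ∃ (n : ℕ) (S : Fin n → D.FullSubcategory), (∀ i, Simple (S i)) ∧ IsDirectSum X S := by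
  obtain ⟨n, S, hS, h⟩ := UnitaryRibbonFusionCategory.semisimple X.obj
  obtain ⟨p, q, h1, h2, h3⟩ := h.exists_maps
  refine ⟨n, fun i => ⟨S i, hD.summand _ _ ⟨q i, p i, h2 i⟩ X.property⟩,
    fun i => (hD.simple_iff _).2 (hS i), IsDirectSum.of_maps (fun i => ObjectProperty.homMk (p i))
      (fun i => ObjectProperty.homMk (q i)) ?_ (fun i => ?_) fun i j hij => ?_⟩
  · apply (fullHomEquiv D X X).injective
    rw [map_sum]
    exact h1
  · ext; exact h2 i
  · ext; exact h3 i j hij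

/-- A fusion subcategory is a unitary ribbon fusion category. -/
@[reducible] def IsFusionSubcategory.unitaryRibbonFusionCategory (hD : IsFusionSubcategory D) [D.IsMonoidal] :
    UnitaryRibbonFusionCategory D.FullSubcategory :=
  have := hD.containsZero
  have := hD.isClosedUnderSubobjects
  have := hD.isClosedUnderQuotients
  have := hD.isClosedUnderFiniteProducts
  letI := hD.rightRigid
  -- Left duals are obtained from right duals through the braiding.
  letI := BraidedCategory.rigidCategoryOfRightRigidCategory (C := D.FullSubcategory)
  letI : Abelian D.FullSubcategory := inferInstance
  { (inferInstance : Abelian D.FullSubcategory),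
    (inferInstance : Linear ℂ D.FullSubcategory),
    (inferInstance : BraidedCategory D.FullSubcategory),
    (inferInstance : BalancedCategory D.FullSubcategory),
    (inferInstance : MonoidalPreadditive D.FullSubcategory),
    (inferInstance : MonoidalLinear ℂ D.FullSubcategory),
    BraidedCategory.rigidCategoryOfRightRigidCategory (C := D.FullSubcategory) with
    finiteDimensional_hom X Y := Module.Finite.equiv (fullHomEquiv D X Y).symm
    semisimple := hD.semisimple
    finite_label := hD.finite_label
    simple_unit := (hD.simple_iff _).2 (simple_unit (C := C))
    twist_dual X := by
      ext; exact twist_dual X.obj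
    dag f := ObjectProperty.homMk (dag f.hom)
    dag_id X := by ext; exact dag_id X.obj
    dag_comp f g := by ext; exact dag_comp f.hom g.hom
    dag_dag f := by ext; exact dag_dag f.hom
    dag_add f g := by ext; exact dag_add f.hom g.hom
    dag_smul c f := by ext; exact dag_smul c f.hom
    dag_definite f h := by
      ext; exact dag_definite f.hom (congrArg (·.hom) h)
    dag_positive f := by
      obtain ⟨g, hg⟩ := dag_positive f.hom
      exact ⟨ObjectProperty.homMk g, by ext; exact hg⟩
    dag_tensor f g := by ext; exact dag_tensor f.hom g.hom
    dag_associator X Y Z := by ext; exact dag_associator X.obj Y.obj Z.obj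
    dag_leftUnitor X := by ext; exact dag_leftUnitor X.obj
    dag_rightUnitor X := by ext; exact dag_rightUnitor X.obj
    dag_braiding X Y := by ext; exact dag_braiding X.obj Y.obj
    dag_twist X := by ext; exact dag_twist X.obj
    qtrace_pos f hf := by
      obtain ⟨r, hr, h⟩ := qtrace_pos f.hom fun h => hf (by ext; exact h)
      exact ⟨r, hr, by ext; exact h⟩ }

lemma IsFusionSubcategory.hopf_fullSubcategory (hD : IsFusionSubcategory D) [D.IsMonoidal]
    (X Y : D.FullSubcategory) :
    @hopf _ _ hD.unitaryRibbonFusionCategory X Y = hopf X.obj Y.obj := by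
  let := hD.unitaryRibbonFusionCategory
  symm
  refine toScalar_eq ?_
  exact (congrArg (·.hom) (toScalar_smul (qtrace ((β_ X Y).hom ≫ (β_ Y X).hom)))).symm

end

/-! ### Transfer of modularity -/

section

variable {M : Type*} [Category* M] [UnitaryRibbonFusionCategory M]
  {C : Type*} [Category* C] [UnitaryRibbonFusionCategory C]

/-- Modularity can be tested on a subcategory with the same morphism spaces and Hopf links. -/
theorem isModular_iff {D : ObjectProperty C} (hD : IsFusionSubcategory D) (Φ : M → C)
    (h1 : ∀ X, D X ↔ ∃ Y, Nonempty (X ≅ Φ Y))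
    (h2 : ∀ X Y, Module.finrank ℂ (Φ X ⟶ Φ Y) = Module.finrank ℂ (X ⟶ Y))
    (h3 : ∀ X Y, hopf (Φ X) (Φ Y) = hopf X Y) :
    IsModular M ↔ IsModularSubcategory D := by
  classical
  have hs : ∀ X, Simple (Φ X) ↔ Simple X := fun X => by
    rw [simple_iff_finrank_end, simple_iff_finrank_end, h2]
  have hs' : ∀ a : Label M, Simple (Φ a.rep) := fun a => (hs _).2 inferInstance
  have hl : ∀ X Y [Simple X] [Simple Y] [Simple (Φ X)] [Simple (Φ Y)],
      (label (Φ X) = label (Φ Y) ↔ label X = label Y) := by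
    intro X Y _ _ _ _
    have := h2 X Y
    rw [finrank_hom_simple, finrank_hom_simple] at this
    by_cases h : label X = label Y <;> by_cases h' : label (Φ X) = label (Φ Y) <;> simp_all
  let τ : Label M → labels D := fun a =>
    ⟨label (Φ a.rep), (hD.mem_labels _).2 ((h1 _).2 ⟨_, ⟨Iso.refl _⟩⟩)⟩
  have hτ : Function.Bijective τ := by
    constructor
    · intro a b hab
      have := (hl a.rep b.rep).1 (congrArg Subtype.val hab)
      simpa using this
    · rintro ⟨d, hd⟩
      obtain ⟨Y, ⟨e⟩⟩ := (h1 _).1 hd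
      have hΦ : Simple (Φ Y) := Simple.of_iso e.symm
      have hY : Simple Y := (hs Y).1 hΦ
      refine ⟨label Y, Subtype.ext ?_⟩
      change label (Φ (label Y).rep) = d
      rw [(hl (label Y).rep Y).2 (label_rep _), ← label_rep d,
        label_eq_iff]
      exact ⟨e.symm⟩
  -- The bijection `τ` of labels carries one S-matrix to the other, since Hopf links depend only on
  -- isomorphism classes.
  have key : (sMatrix M).det =
      ((sMatrix C).submatrix (Subtype.val : labels D → Label C) Subtype.val).det := by
    rw [← Matrix.det_submatrix_equiv_self (Equiv.ofBijective τ hτ)]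
    congr 1
    ext a b
    change hopf a.rep b.rep = hopf (label (Φ a.rep)).rep (label (Φ b.rep)).rep
    rw [hopf_congr (rep_label (Φ a.rep)).some (rep_label (Φ b.rep)).some, h3]
  constructor
  · intro h
    exact ⟨hD, by rw [← key]; convert h⟩
  · intro h h0
    refine h.det_ne_zero ?_
    rw [← key]; convert h0

end

section

variable {C : Type u} [Category.{v} C] [UnitaryRibbonFusionCategory C] {D : ObjectProperty C}

lemma IsModularSubcategory.isModular (hD : IsModularSubcategory D) [D.IsMonoidal] :
    @IsModular _ _ hD.toIsFusionSubcategory.unitaryRibbonFusionCategory := by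
  have hF := hD.toIsFusionSubcategory
  let := hF.unitaryRibbonFusionCategory
  refine (isModular_iff hF (fun X : D.FullSubcategory => X.obj) (fun X => ?_) (fun X Y => ?_)
    fun X Y => ?_).2 hD
  · exact ⟨fun h => ⟨⟨X, h⟩, ⟨Iso.refl _⟩⟩, fun ⟨Y, ⟨e⟩⟩ => hF.of_iso e Y.property⟩
  · exact (fullHomEquiv D X Y).finrank_eq.symm
  · exact (hF.hopf_fullSubcategory X Y).symm

end

/-! ### Homogeneous bases of super vector spaces -/

/-- The sign of a parity. -/
def sgn (k : Bool) : ℂ := if k then -1 else 1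

@[simp] lemma sgn_true : sgn true = -1 := rfl
@[simp] lemma sgn_false : sgn false = 1 := rfl

lemma sgn_xor (k l : Bool) : sgn (xor k l) = sgn k * sgn l := by
  cases k <;> cases l <;> simp

lemma sgn_injective : Function.Injective sgn := by
  intro k l h
  cases k <;> cases l <;> simp at h ⊢ <;> norm_num at h

/-- The space is the direct sum of the eigenspaces of the involution for 1 and -1; a basis of each
is chosen. -/
lemma exists_eigenbasis {A : Type*} [AddCommGroup A] [Module ℂ A] [FiniteDimensional ℂ A]
    (p : A →ₗ[ℂ] A) (hp : p ∘ₗ p = LinearMap.id) :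
    ∃ (n : ℕ) (b : Module.Basis (Fin n) ℂ A) (s : Fin n → Bool), ∀ i, p (b i) = sgn (s i) • b i := by
  have hp' : ∀ a, p (p a) = a := fun a => LinearMap.congr_fun hp a
  have hc : IsCompl (LinearMap.ker (p - LinearMap.id)) (LinearMap.ker (p + LinearMap.id)) := by
    constructor
    · rw [Submodule.disjoint_def]
      intro x h1 h2
      simp only [LinearMap.mem_ker, LinearMap.sub_apply, LinearMap.add_apply,
        LinearMap.id_apply] at h1 h2
      rw [sub_eq_zero] at h1
      rw [h1, ← two_smul ℂ] at h2
      exact (smul_eq_zero.1 h2).resolve_left two_ne_zero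
    · rw [codisjoint_iff, eq_top_iff]
      intro x _
      have : x = (1 / 2 : ℂ) • (x + p x) + (1 / 2 : ℂ) • (x - p x) := by module
      rw [this]
      refine Submodule.add_mem_sup ?_ ?_
      · simp [hp', add_comm]
      · simp [hp']
  let b₀ := Module.finBasis ℂ (LinearMap.ker (p - LinearMap.id))
  let b₁ := Module.finBasis ℂ (LinearMap.ker (p + LinearMap.id))
  let b := ((b₀.prod b₁).map (Submodule.prodEquivOfIsCompl _ _ hc)).reindex finSumFinEquiv
  refine ⟨_, b, fun i => Sum.elim (fun _ => false) (fun _ => true) (finSumFinEquiv.symm i), ?_⟩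
  intro i
  obtain ⟨i, rfl⟩ := finSumFinEquiv.surjective i
  rcases i with i | i
  · have := (b₀ i).2
    simp only [LinearMap.mem_ker, LinearMap.sub_apply, LinearMap.id_apply, sub_eq_zero] at this
    simpa [b] using this
  · have := (b₁ i).2
    simp only [LinearMap.mem_ker, LinearMap.add_apply, LinearMap.id_apply,
      add_eq_zero_iff_eq_neg] at this
    simpa [b] using this

namespace SVec

instance (V : SVec) : FiniteDimensional ℂ V.V := inferInstanceAs (Module.Finite ℂ V.V.obj)

/-- The dimension of a super vector space. -/
def dim (V : SVec) : ℕ := (exists_eigenbasis (par V) (par_comp_par V)).choose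

/-- A basis of homogeneous vectors. -/
def basis (V : SVec) : Module.Basis (Fin (dim V)) ℂ V.V :=
  (exists_eigenbasis (par V) (par_comp_par V)).choose_spec.choose

/-- The parities of the basis vectors. -/
def degree (V : SVec) : Fin (dim V) → Bool :=
  (exists_eigenbasis (par V) (par_comp_par V)).choose_spec.choose_spec.choose

lemma par_basis (V : SVec) (i : Fin (dim V)) : par V (basis V i) = sgn (degree V i) • basis V i :=
  (exists_eigenbasis (par V) (par_comp_par V)).choose_spec.choose_spec.choose_spec i

/-- A linear map that commutes with the parities, as a morphism. -/
def ofLin {V W : SVec} (l : V.V →ₗ[ℂ] W.V) (h : ∀ v, l (par V v) = par W (l v)) : V ⟶ W where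
  hom := FGModuleCat.ofHom l
  comm g := by
    rcases Int.units_eq_one_or g with rfl | rfl
    · rw [map_one, map_one]
      exact (Category.id_comp _).trans (Category.comp_id _).symm
    · ext v
      exact h v

lemma lin_ofLin {V W : SVec} (l : V.V →ₗ[ℂ] W.V) (h : ∀ v, l (par V v) = par W (l v)) :
    lin (ofLin l h) = l := rfl

lemma lin_par {V W : SVec} (g : V ⟶ W) (v : V.V) : lin g (par V v) = par W (lin g v) :=
  (LinearMap.congr_fun (congrArg lin (parity_naturality g)) v).symm

lemma lin_add {V W : SVec} (g h : V ⟶ W) : lin (g + h) = lin g + lin h := rfl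
lemma lin_smul {V W : SVec} (c : ℂ) (g : V ⟶ W) : lin (c • g) = c • lin g := rfl
lemma lin_id (V : SVec) : lin (𝟙 V) = LinearMap.id := rfl

/-- The vector `v ⊗ w` of a tensor product. -/
def tmul (V W : SVec) : V.V →ₗ[ℂ] W.V →ₗ[ℂ] (V ⊗ W).V := TensorProduct.mk ℂ V.V W.V

lemma par_tmul (V W : SVec) (v : V.V) (w : W.V) :
    par (V ⊗ W) (tmul V W v w) = tmul V W (par V v) (par W w) := rfl

/-- The products of the vectors of the homogeneous bases. -/
def tensorBasis (V W : SVec) : Module.Basis (Fin (dim V) × Fin (dim W)) ℂ (V ⊗ W).V :=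
  (basis V).tensorProduct (basis W)

lemma tensorBasis_apply (V W : SVec) (x : Fin (dim V) × Fin (dim W)) :
    tensorBasis V W x = tmul V W (basis V x.1) (basis W x.2) :=
  Module.Basis.tensorProduct_apply' (basis V) (basis W) x

lemma lin_braiding_tmul (V W : SVec) (v : V.V) (w : W.V) (k l : Bool) (hv : par V v = sgn k • v)
    (hw : par W w = sgn l • w) :
    lin (β_ V W).hom (tmul V W v w) = (if k && l then (-1 : ℂ) else 1) • tmul W V w v := by
  have h : superFlip (par V) (par W) (v ⊗ₜ[ℂ] w) =
      (if k && l then (-1 : ℂ) else 1) • (w ⊗ₜ[ℂ] v) := by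
    simp only [superFlip_tmul, hv, hw, TensorProduct.tmul_smul, ← TensorProduct.smul_tmul']
    cases k <;> cases l <;> simp <;> module
  exact h

lemma lin_whiskerRight_tmul {V W : SVec} (g : V ⟶ W) (U : SVec) (v : V.V) (x : U.V) :
    lin (g ▷ U) (tmul V U v x) = tmul W U (lin g v) x := rfl

lemma lin_whiskerLeft_tmul {V W : SVec} (U : SVec) (g : V ⟶ W) (x : U.V) (v : V.V) :
    lin (U ◁ g) (tmul U V x v) = tmul U W x (lin g v) := rfl

lemma lin_associator_tmul (U V W : SVec) (x : U.V) (v : V.V) (w : W.V) :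
    lin (α_ U V W).hom (tmul (U ⊗ V) W (tmul U V x v) w) =
      tmul U (V ⊗ W) x (tmul V W v w) := rfl

/-- The unit vector of the unit. -/
def one : (𝟙_ SVec).V := (1 : ℂ)

lemma par_one : par (𝟙_ SVec) one = one := rfl

lemma lin_leftUnitor_tmul (V : SVec) (v : V.V) :
    lin (λ_ V).hom (tmul (𝟙_ SVec) V one v) = v := one_smul ℂ v

lemma lin_rightUnitor_tmul (V : SVec) (v : V.V) :
    lin (ρ_ V).hom (tmul V (𝟙_ SVec) v one) = v := one_smul ℂ v

/-- The coordinates of a vector of parity `k` at basis vectors of the other parity vanish. The basis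
is arbitrary, so product bases can be used alongside the chosen ones. -/
lemma homogeneous_induction {V : SVec} {ι : Type*} [Fintype ι] (b : Module.Basis ι ℂ V.V)
    (s : ι → Bool) (hs : ∀ i, par V (b i) = sgn (s i) • b i) {k : Bool} {P : V.V → Prop}
    (zero : P 0) (add : ∀ x y, P x → P y → P (x + y)) (smul : ∀ (c : ℂ) x, P x → P (c • x))
    (hb : ∀ i, s i = k → P (b i)) {v : V.V} (hv : par V v = sgn k • v) : P v := by
  rw [← b.sum_repr v]
  refine Finset.sum_induction _ P add zero fun i _ => ?_
  by_cases hi : s i = k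
  · exact smul _ _ (hb i hi)
  · have h1 : b.coord i ∘ₗ par V = sgn (s i) • b.coord i := by
      refine b.ext fun j => ?_
      rw [LinearMap.comp_apply, hs, map_smul, LinearMap.smul_apply]
      by_cases hij : j = i
      · rw [hij]
      · simp [hij]
    have h2 : b.repr v i = 0 := by
      have h3 := LinearMap.congr_fun h1 v
      rw [LinearMap.comp_apply, hv, map_smul, LinearMap.smul_apply, ← sub_eq_zero, ← sub_smul,
        smul_eq_zero, sub_eq_zero] at h3
      exact h3.resolve_left fun h => hi (sgn_injective h.symm)
    rw [h2, zero_smul]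
    exact zero

lemma par_tmul_of_homogeneous {V W : SVec} {k l : Bool} {v : V.V} {w : W.V}
    (hv : par V v = sgn k • v) (hw : par W w = sgn l • w) :
    par (V ⊗ W) (tmul V W v w) = sgn (xor k l) • tmul V W v w := by
  rw [par_tmul, hv, hw, map_smul, map_smul, LinearMap.smul_apply, smul_smul, sgn_xor, mul_comm]

lemma par_lin_of_homogeneous {V W : SVec} (g : V ⟶ W) {k : Bool} {v : V.V}
    (hv : par V v = sgn k • v) : par W (lin g v) = sgn k • lin g v := by
  rw [← lin_par, hv, map_smul]

lemma par_tensorBasis (V W : SVec) (x : Fin (dim V) × Fin (dim W)) :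
    par (V ⊗ W) (tensorBasis V W x) =
      sgn (xor (degree V x.1) (degree W x.2)) • tensorBasis V W x := by
  rw [tensorBasis_apply]
  exact par_tmul_of_homogeneous (par_basis V _) (par_basis W _)

/-- The basis of the unit. -/
def unitBasis : Module.Basis Unit ℂ (𝟙_ SVec).V := Module.Basis.singleton Unit ℂ

lemma unitBasis_apply (i : Unit) : unitBasis i = one := Module.Basis.singleton_apply Unit ℂ i

lemma par_unitBasis (i : Unit) : par (𝟙_ SVec) (unitBasis i) = sgn false • unitBasis i := by
  rw [unitBasis_apply, par_one, sgn_false, one_smul]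

lemma par_one' : par (𝟙_ SVec) one = sgn false • one := by
  rw [par_one, sgn_false, one_smul]

end SVec

/-! ### The super vector spaces inside a category with a fermion -/

namespace SuperFunctor

section Cover

variable {B : Type*} [Category* B] [Preadditive B]

/-- The family `s` is split jointly epimorphic. -/
def Covers {ι : Type*} [Fintype ι] {Y : B} {X : ι → B} (s : ∀ i, X i ⟶ Y) : Prop :=
  ∃ p : ∀ i, Y ⟶ X i, ∑ i, p i ≫ s i = 𝟙 Y

lemma Covers.hom_ext {ι : Type*} [Fintype ι] {Y : B} {X : ι → B} {s : ∀ i, X i ⟶ Y}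
    (h : Covers s) {Z : B} {g g' : Y ⟶ Z} (hg : ∀ i, s i ≫ g = s i ≫ g') : g = g' := by
  obtain ⟨p, hp⟩ := h
  rw [← Category.id_comp g, ← Category.id_comp g', ← hp, Preadditive.sum_comp,
    Preadditive.sum_comp]
  simp only [Category.assoc, hg]

lemma Covers.tensor [MonoidalCategory B] [MonoidalPreadditive B] {ι κ : Type*} [Fintype ι]
    [Fintype κ] {Y Z : B} {X : ι → B} {W : κ → B} {s : ∀ i, X i ⟶ Y} {t : ∀ j, W j ⟶ Z}
    (hs : Covers s) (ht : Covers t) : Covers fun x : ι × κ => s x.1 ⊗ₘ t x.2 := by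
  obtain ⟨p, hp⟩ := hs
  obtain ⟨q, hq⟩ := ht
  refine ⟨fun x => p x.1 ⊗ₘ q x.2, ?_⟩
  simp only [tensorHom_comp_tensorHom]
  rw [Fintype.sum_prod_type]
  simp only [← tensor_sum, ← sum_tensor, hp, hq, id_tensorHom_id]

end Cover

section

variable {B : Type u} [Category.{v} B] [Preadditive B] [MonoidalCategory B]

/-- The unit or `f`, according to the parity. -/
def gradedObj (f : B) : Bool → B
  | false => 𝟙_ B
  | true => f

/-- The identity of `gradedObj f k` if `k = l`, and zero otherwise. -/
def transfer (f : B) (k l : Bool) : gradedObj f k ⟶ gradedObj f l :=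
  if h : k = l then eqToHom (by rw [h]) else 0

@[simp] lemma transfer_self (f : B) (k : Bool) : transfer f k k = 𝟙 _ := by simp [transfer]

lemma transfer_of_ne (f : B) {k l : Bool} (h : k ≠ l) : transfer f k l = 0 := by simp [transfer, h]

lemma transfer_comp_transfer (f : B) {k l : Bool} (h : k = l) :
    transfer f k l ≫ transfer f l k = 𝟙 _ := by
  subst h
  simp

/-- The product of the graded pieces. -/
def mulIso {f : B} (e : f ⊗ f ≅ 𝟙_ B) :
    ∀ k l : Bool, gradedObj f k ⊗ gradedObj f l ≅ gradedObj f (xor k l)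
  | false, false => λ_ (𝟙_ B)
  | false, true => λ_ f
  | true, false => ρ_ f
  | true, true => e

/-- The summands of the object for a super vector space. -/
abbrev summand (f : B) (V : SVec) (i : Fin (SVec.dim V)) : B := gradedObj f (SVec.degree V i)

variable [HasFiniteBiproducts B]

/-- The direct sum of copies of the unit and of `f`. -/
def obj (f : B) (V : SVec) : B := ⨁ summand f V

variable (f : B)

/-- The inclusion of a basis vector. -/
def ι (V : SVec) (i : Fin (SVec.dim V)) : gradedObj f (SVec.degree V i) ⟶ obj f V :=
  biproduct.ι (summand f V) i

/-- The projection to a basis vector. -/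
def π (V : SVec) (i : Fin (SVec.dim V)) : obj f V ⟶ gradedObj f (SVec.degree V i) :=
  biproduct.π (summand f V) i

lemma ι_π_self (V : SVec) (i : Fin (SVec.dim V)) : ι f V i ≫ π f V i = 𝟙 _ :=
  biproduct.ι_π_self (summand f V) i

lemma ι_π_self_assoc (V : SVec) (i : Fin (SVec.dim V)) {Z : B}
    (h : gradedObj f (SVec.degree V i) ⟶ Z) : ι f V i ≫ π f V i ≫ h = h := by
  rw [← Category.assoc, ι_π_self, Category.id_comp]

lemma ι_π_ne (V : SVec) {i j : Fin (SVec.dim V)} (h : i ≠ j) : ι f V i ≫ π f V j = 0 :=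
  biproduct.ι_π_ne (summand f V) h

lemma sum_π_ι (V : SVec) : ∑ i, π f V i ≫ ι f V i = 𝟙 _ :=
  biproduct.total (f := summand f V)

lemma covers_ι (V : SVec) : Covers (ι f V) := ⟨_, sum_π_ι f V⟩

variable [Linear ℂ B]

/-- The morphism from a graded piece given by a vector. -/
def incl (V : SVec) (k : Bool) : V.V →ₗ[ℂ] (gradedObj f k ⟶ obj f V) :=
  ∑ i, ((SVec.basis V).coord i).smulRight (transfer f k (SVec.degree V i) ≫ ι f V i)

lemma incl_basis (V : SVec) (k : Bool) (i : Fin (SVec.dim V)) :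
    incl f V k (SVec.basis V i) = transfer f k (SVec.degree V i) ≫ ι f V i := by
  simp [incl, LinearMap.sum_apply, Finsupp.single_apply, ite_smul]

lemma incl_basis_degree (V : SVec) (i : Fin (SVec.dim V)) :
    incl f V (SVec.degree V i) (SVec.basis V i) = ι f V i := by
  rw [incl_basis, transfer_self, Category.id_comp]

variable {f}

/-- The morphism determined by its values on homogeneous vectors. -/
def desc {V : SVec} {Z : B} (φ : ∀ k, V.V →ₗ[ℂ] (gradedObj f k ⟶ Z)) : obj f V ⟶ Z :=
  biproduct.desc (f := summand f V) fun i => φ _ (SVec.basis V i)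

/-- Homogeneous vectors act as generalized elements of `obj f V`: morphisms out of it are built by
`desc` and compared by `hom_ext` on them. Homogeneity is needed because `incl f V k` discards the
components of the other parity. -/
lemma incl_desc {V : SVec} {Z : B} (φ : ∀ k, V.V →ₗ[ℂ] (gradedObj f k ⟶ Z)) {k : Bool}
    {v : V.V} (hv : SVec.par V v = sgn k • v) : incl f V k v ≫ desc φ = φ k v := by
  refine SVec.homogeneous_induction (SVec.basis V) (SVec.degree V) (SVec.par_basis V)
    (P := fun v => incl f V k v ≫ desc φ = φ k v) (by simp)
    (fun x y hx hy => by simp [hx, hy]) (fun c x hx => by simp [hx]) (fun i hi => ?_) hv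
  subst hi
  rw [incl_basis_degree]
  exact biproduct.ι_desc (f := summand f V) _ _

lemma incl_desc_assoc {V : SVec} {Z : B} (φ : ∀ k, V.V →ₗ[ℂ] (gradedObj f k ⟶ Z)) {k : Bool}
    {v : V.V} (hv : SVec.par V v = sgn k • v) {Z' : B} (h : Z ⟶ Z') :
    incl f V k v ≫ desc φ ≫ h = φ k v ≫ h := by
  rw [← Category.assoc, incl_desc φ hv]

lemma hom_ext {V : SVec} {Z : B} {g g' : obj f V ⟶ Z}
    (h : ∀ k v, SVec.par V v = sgn k • v → incl f V k v ≫ g = incl f V k v ≫ g') : g = g' :=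
  (covers_ι f V).hom_ext fun i => by
    rw [← incl_basis_degree]
    exact h _ _ (SVec.par_basis V i)

lemma hom_ext_of_basis {V : SVec} {Z : B} {κ : Type*} [Fintype κ] (b : Module.Basis κ ℂ V.V)
    (s : κ → Bool) (hs : ∀ i, SVec.par V (b i) = sgn (s i) • b i) {g g' : obj f V ⟶ Z}
    (h : ∀ i, incl f V (s i) (b i) ≫ g = incl f V (s i) (b i) ≫ g') : g = g' :=
  hom_ext fun k v hv => by
    refine SVec.homogeneous_induction b s hs
      (P := fun v => incl f V k v ≫ g = incl f V k v ≫ g') (by simp)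
      (fun x y hx hy => by simp [hx, hy]) (fun c x hx => by simp [hx]) (fun i hi => ?_) hv
    subst hi
    exact h i

/-- The action on morphisms. -/
def map {V W : SVec} (g : V ⟶ W) : obj f V ⟶ obj f W := desc fun k => incl f W k ∘ₗ SVec.lin g

lemma incl_map {V W : SVec} (g : V ⟶ W) {k : Bool} {v : V.V} (hv : SVec.par V v = sgn k • v) :
    incl f V k v ≫ map g = incl f W k (SVec.lin g v) :=
  incl_desc _ hv

lemma incl_map_assoc {V W : SVec} (g : V ⟶ W) {k : Bool} {v : V.V}
    (hv : SVec.par V v = sgn k • v) {Z : B} (h : obj f W ⟶ Z) :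
    incl f V k v ≫ map g ≫ h = incl f W k (SVec.lin g v) ≫ h := by
  rw [← Category.assoc, incl_map g hv]

variable (f) in
/-- The super vector spaces inside a category with a fermion. -/
@[simps] def functor : SVec ⥤ B where
  obj := obj f
  map := map
  map_id V := hom_ext fun k v hv => by
    rw [incl_map _ hv, Category.comp_id, SVec.lin_id, LinearMap.id_apply]
  map_comp g h := hom_ext fun k v hv => by
    rw [incl_map _ hv, incl_map_assoc _ hv, incl_map _ (SVec.par_lin_of_homogeneous g hv)]
    rfl

variable [MonoidalPreadditive B]

lemma hom_ext_tensor {V W : SVec} {Z : B} {g g' : obj f V ⊗ obj f W ⟶ Z}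
    (h : ∀ k v l w, SVec.par V v = sgn k • v → SVec.par W w = sgn l • w →
      (incl f V k v ⊗ₘ incl f W l w) ≫ g = (incl f V k v ⊗ₘ incl f W l w) ≫ g') : g = g' :=
  ((covers_ι f V).tensor (covers_ι f W)).hom_ext fun x => by
    rw [← incl_basis_degree, ← incl_basis_degree]
    exact h _ _ _ _ (SVec.par_basis V _) (SVec.par_basis W _)

lemma hom_ext_tensor_tensor {U V W : SVec} {Z : B} {g g' : (obj f U ⊗ obj f V) ⊗ obj f W ⟶ Z}
    (h : ∀ k u l v n w, SVec.par U u = sgn k • u → SVec.par V v = sgn l • v →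
      SVec.par W w = sgn n • w →
      ((incl f U k u ⊗ₘ incl f V l v) ⊗ₘ incl f W n w) ≫ g =
        ((incl f U k u ⊗ₘ incl f V l v) ⊗ₘ incl f W n w) ≫ g') : g = g' :=
  (((covers_ι f U).tensor (covers_ι f V)).tensor (covers_ι f W)).hom_ext fun x => by
    rw [← incl_basis_degree, ← incl_basis_degree, ← incl_basis_degree]
    exact h _ _ _ _ _ _ (SVec.par_basis U _) (SVec.par_basis V _) (SVec.par_basis W _)

/-! ### The tensorator -/

variable (e : f ⊗ f ≅ 𝟙_ B)

/-- The tensorator. -/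
def μ (V W : SVec) : obj f V ⊗ obj f W ⟶ obj f (V ⊗ W) :=
  ∑ x : Fin (SVec.dim V) × Fin (SVec.dim W), (π f V x.1 ⊗ₘ π f W x.2) ≫ (mulIso e _ _).hom ≫
    incl f (V ⊗ W) _ (SVec.tmul V W (SVec.basis V x.1) (SVec.basis W x.2))

lemma ι_tensor_π (V W : SVec) (x y : Fin (SVec.dim V) × Fin (SVec.dim W)) (h : y ≠ x) :
    (ι f V x.1 ⊗ₘ ι f W x.2) ≫ (π f V y.1 ⊗ₘ π f W y.2) = 0 := by
  rw [tensorHom_comp_tensorHom]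
  by_cases h1 : x.1 = y.1
  · have h2 : x.2 ≠ y.2 := fun h2 => h (Prod.ext h1.symm h2.symm)
    rw [ι_π_ne f W h2, MonoidalPreadditive.tensor_zero]
  · rw [ι_π_ne f V h1, MonoidalPreadditive.zero_tensor]

variable [MonoidalLinear ℂ B]

/-- The definition of `μ` uses the chosen bases of `V` and `W`, while `obj f (V ⊗ W)` uses a third
one unrelated to their product. This formula on homogeneous vectors removes all three choices, and
the coherence axioms are checked with it. -/
lemma incl_μ {V W : SVec} {k l : Bool} {v : V.V} {w : W.V} (hv : SVec.par V v = sgn k • v)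
    (hw : SVec.par W w = sgn l • w) :
    (incl f V k v ⊗ₘ incl f W l w) ≫ μ e V W =
      (mulIso e k l).hom ≫ incl f (V ⊗ W) (xor k l) (SVec.tmul V W v w) := by
  refine SVec.homogeneous_induction (SVec.basis V) (SVec.degree V) (SVec.par_basis V)
    (P := fun v => (incl f V k v ⊗ₘ incl f W l w) ≫ μ e V W =
      (mulIso e k l).hom ≫ incl f (V ⊗ W) (xor k l) (SVec.tmul V W v w))
    (by simp)
    (fun x y hx hy => by simp [hx, hy, MonoidalPreadditive.add_tensor])
    (fun c x hx => by simp [MonoidalCategory.tensorHom_def] at hx ⊢; rw [hx]) (fun i hi => ?_) hv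
  refine SVec.homogeneous_induction (SVec.basis W) (SVec.degree W) (SVec.par_basis W)
    (P := fun w => (incl f V k (SVec.basis V i) ⊗ₘ incl f W l w) ≫ μ e V W =
      (mulIso e k l).hom ≫ incl f (V ⊗ W) (xor k l) (SVec.tmul V W (SVec.basis V i) w))
    (by simp)
    (fun x y hx hy => by simp [hx, hy, MonoidalPreadditive.tensor_add])
    (fun c x hx => by simp [MonoidalCategory.tensorHom_def] at hx ⊢; rw [hx]) (fun j hj => ?_) hw
  subst hi hj
  rw [incl_basis_degree, incl_basis_degree, μ, Preadditive.comp_sum,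
    Finset.sum_eq_single (i, j)]
  · rw [← Category.assoc, tensorHom_comp_tensorHom, ι_π_self, ι_π_self, id_tensorHom_id,
      Category.id_comp]
  · intro y _ hy
    rw [← Category.assoc, ι_tensor_π V W (i, j) y hy, zero_comp]
  · simp

lemma incl_μ_assoc {V W : SVec} {k l : Bool} {v : V.V} {w : W.V}
    (hv : SVec.par V v = sgn k • v) (hw : SVec.par W w = sgn l • w) {Z : B}
    (h : obj f (V ⊗ W) ⟶ Z) :
    (incl f V k v ⊗ₘ incl f W l w) ≫ μ e V W ≫ h =
      (mulIso e k l).hom ≫ incl f (V ⊗ W) (xor k l) (SVec.tmul V W v w) ≫ h := by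
  rw [← Category.assoc, incl_μ e hv hw, Category.assoc]

/-- The components of the inverse of the tensorator. -/
def νAux (V W : SVec) (k : Bool) : (V ⊗ W).V →ₗ[ℂ] (gradedObj f k ⟶ obj f V ⊗ obj f W) :=
  ∑ x : Fin (SVec.dim V) × Fin (SVec.dim W), ((SVec.tensorBasis V W).coord x).smulRight
    (transfer f k _ ≫ (mulIso e _ _).inv ≫ (ι f V x.1 ⊗ₘ ι f W x.2))

lemma νAux_tensorBasis (V W : SVec) (x : Fin (SVec.dim V) × Fin (SVec.dim W)) :
    νAux e V W (xor (SVec.degree V x.1) (SVec.degree W x.2)) (SVec.tensorBasis V W x) =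
      (mulIso e _ _).inv ≫ (ι f V x.1 ⊗ₘ ι f W x.2) := by
  simp only [νAux, LinearMap.sum_apply, LinearMap.smulRight_apply, Module.Basis.coord_apply,
    Module.Basis.repr_self]
  rw [Finset.sum_eq_single x]
  · simp
  · intro y _ hy
    rw [Finsupp.single_eq_of_ne hy, zero_smul]
  · simp

/-- The tensorator as an isomorphism. -/
@[simps hom] def μIso (V W : SVec) : obj f V ⊗ obj f W ≅ obj f (V ⊗ W) where
  hom := μ e V W
  inv := desc (νAux e V W)
  hom_inv_id := ((covers_ι f V).tensor (covers_ι f W)).hom_ext fun x => by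
    rw [← incl_basis_degree, ← incl_basis_degree,
      incl_μ_assoc _ (SVec.par_basis V _) (SVec.par_basis W _), ← SVec.tensorBasis_apply,
      incl_desc _ (SVec.par_tensorBasis V W x), νAux_tensorBasis, incl_basis_degree,
      incl_basis_degree, Iso.hom_inv_id_assoc, Category.comp_id]
  inv_hom_id := hom_ext_of_basis (SVec.tensorBasis V W) _ (SVec.par_tensorBasis V W) fun x => by
    rw [incl_desc_assoc _ (SVec.par_tensorBasis V W x), νAux_tensorBasis, Category.assoc,
      ← incl_basis_degree, ← incl_basis_degree, incl_μ _ (SVec.par_basis V _) (SVec.par_basis W _),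
      Iso.inv_hom_id_assoc, Category.comp_id, SVec.tensorBasis_apply]

variable (f) in
/-- The image of a super vector space with a basis of one vector. -/
def lineIso {V : SVec} (b : Module.Basis Unit ℂ V.V) (k : Bool)
    (hb : ∀ i, SVec.par V (b i) = sgn k • b i) : gradedObj f k ≅ obj f V where
  hom := incl f V k (b ())
  inv := desc fun l => (b.coord ()).smulRight (transfer f l k)
  hom_inv_id := by
    rw [incl_desc _ (hb ()), LinearMap.smulRight_apply, Module.Basis.coord_apply,
      Module.Basis.repr_self, Finsupp.single_eq_same, one_smul, transfer_self]
  inv_hom_id := hom_ext_of_basis b (fun _ => k) hb fun i => by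
    rw [incl_desc_assoc _ (hb i), Category.comp_id, LinearMap.smulRight_apply,
      Module.Basis.coord_apply, Module.Basis.repr_self, Finsupp.single_eq_same, one_smul,
      transfer_self, Category.id_comp]

variable (f) in
/-- The comparison of the units. -/
def εIso : 𝟙_ B ≅ obj f (𝟙_ SVec) := lineIso f SVec.unitBasis false SVec.par_unitBasis

variable (f) in
/-- The comparison of the units as a morphism. -/
def unitHom : 𝟙_ B ⟶ obj f (𝟙_ SVec) := incl f (𝟙_ SVec) false SVec.one

lemma εIso_hom : (εIso f).hom = unitHom f :=
  congrArg (incl f (𝟙_ SVec) false) (SVec.unitBasis_apply ())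

/-! ### Coherence -/

/-- Only three odd factors require `he`; the other seven cases are unit coherence. The two iterated
parities agree only propositionally, so `incl` is appended to give both sides the same target. -/
lemma mulIso_assoc
    (he : e.hom ▷ f ≫ (λ_ f).hom = (α_ f f f).hom ≫ f ◁ e.hom ≫ (ρ_ f).hom) (k l n : Bool)
    {V : SVec} (v : V.V) :
    (mulIso e k l).hom ▷ gradedObj f n ≫ (mulIso e (xor k l) n).hom ≫
        incl f V (xor (xor k l) n) v =
      (α_ _ _ _).hom ≫ gradedObj f k ◁ (mulIso e l n).hom ≫ (mulIso e k (xor l n)).hom ≫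
        incl f V (xor k (xor l n)) v := by
  cases k <;> cases l <;> cases n
  · have h : (λ_ (𝟙_ B)).hom ▷ 𝟙_ B ≫ (λ_ (𝟙_ B)).hom =
        (α_ _ _ _).hom ≫ 𝟙_ B ◁ (λ_ (𝟙_ B)).hom ≫ (λ_ (𝟙_ B)).hom := by monoidal
    have h' := reassoc_of% h
    exact h' _
  · have h : (λ_ (𝟙_ B)).hom ▷ f ≫ (λ_ f).hom =
        (α_ _ _ _).hom ≫ 𝟙_ B ◁ (λ_ f).hom ≫ (λ_ f).hom := by monoidal
    have h' := reassoc_of% h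
    exact h' _
  · have h : (λ_ f).hom ▷ 𝟙_ B ≫ (ρ_ f).hom =
        (α_ _ _ _).hom ≫ 𝟙_ B ◁ (ρ_ f).hom ≫ (λ_ f).hom := by monoidal
    have h' := reassoc_of% h
    exact h' _
  · have h : (λ_ f).hom ▷ f ≫ e.hom = (α_ _ _ _).hom ≫ 𝟙_ B ◁ e.hom ≫ (λ_ (𝟙_ B)).hom := by
      rw [leftUnitor_naturality]
      monoidal
    have h' := reassoc_of% h
    exact h' _
  · have h : (ρ_ f).hom ▷ 𝟙_ B ≫ (ρ_ f).hom =
        (α_ _ _ _).hom ≫ f ◁ (λ_ (𝟙_ B)).hom ≫ (ρ_ f).hom := by monoidal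
    have h' := reassoc_of% h
    exact h' _
  · have h : (ρ_ f).hom ▷ f ≫ e.hom = (α_ _ _ _).hom ≫ f ◁ (λ_ f).hom ≫ e.hom := by monoidal
    have h' := reassoc_of% h
    exact h' _
  · have h : e.hom ▷ 𝟙_ B ≫ (λ_ (𝟙_ B)).hom = (α_ _ _ _).hom ≫ f ◁ (ρ_ f).hom ≫ e.hom := by
      rw [unitors_equal, rightUnitor_naturality]
      monoidal
    have h' := reassoc_of% h
    exact h' _
  · have h' := reassoc_of% he
    exact h' _

variable (f) in
/-- The monoidal structure. -/
def coreMonoidal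
    (he : e.hom ▷ f ≫ (λ_ f).hom = (α_ f f f).hom ≫ f ◁ e.hom ≫ (ρ_ f).hom) :
    (functor f).CoreMonoidal where
  εIso := εIso f
  μIso := μIso e
  μIso_hom_natural_left g W := hom_ext_tensor fun k v l w hv hw => by
    have h : (incl f _ k v ⊗ₘ incl f W l w) ≫ map g ▷ obj f W =
        incl f _ k (SVec.lin g v) ⊗ₘ incl f W l w := by
      rw [← tensorHom_id, tensorHom_comp_tensorHom, Category.comp_id, incl_map _ hv]
    change _ ≫ map g ▷ obj f W ≫ μ e _ W = _ ≫ μ e _ W ≫ map (g ▷ W)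
    rw [reassoc_of% h, incl_μ _ (SVec.par_lin_of_homogeneous g hv) hw, incl_μ_assoc _ hv hw,
      incl_map _ (SVec.par_tmul_of_homogeneous hv hw), SVec.lin_whiskerRight_tmul]
  μIso_hom_natural_right {V V'} W g := hom_ext_tensor fun k v l w hv hw => by
    have h : (incl f W k v ⊗ₘ incl f _ l w) ≫ obj f W ◁ map g =
        incl f _ k v ⊗ₘ incl f V' l (SVec.lin g w) := by
      rw [← id_tensorHom, tensorHom_comp_tensorHom, Category.comp_id, incl_map _ hw]
    change _ ≫ obj f W ◁ map g ≫ μ e W _ = _ ≫ μ e W _ ≫ map (W ◁ g)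
    rw [reassoc_of% h, incl_μ _ hv (SVec.par_lin_of_homogeneous g hw), incl_μ_assoc _ hv hw,
      incl_map _ (SVec.par_tmul_of_homogeneous hv hw), SVec.lin_whiskerLeft_tmul]
  associativity U V W := hom_ext_tensor_tensor fun k u l v n w hu hv hw => by
    have h1 : ((incl f U k u ⊗ₘ incl f V l v) ⊗ₘ incl f W n w) ≫ μ e U V ▷ obj f W =
        (mulIso e k l).hom ▷ gradedObj f n ≫
          (incl f (U ⊗ V) (xor k l) (SVec.tmul U V u v) ⊗ₘ incl f W n w) := by
      rw [← tensorHom_id, tensorHom_comp_tensorHom, incl_μ _ hu hv, ← tensorHom_id,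
        tensorHom_comp_tensorHom, Category.comp_id, Category.id_comp]
    have h2 : (incl f U k u ⊗ₘ incl f V l v ⊗ₘ incl f W n w) ≫ obj f U ◁ μ e V W =
        gradedObj f k ◁ (mulIso e l n).hom ≫
          (incl f U k u ⊗ₘ incl f (V ⊗ W) (xor l n) (SVec.tmul V W v w)) := by
      rw [← id_tensorHom, tensorHom_comp_tensorHom, incl_μ _ hv hw, ← id_tensorHom,
        tensorHom_comp_tensorHom, Category.comp_id, Category.id_comp]
    change _ ≫ μ e U V ▷ obj f W ≫ μ e (U ⊗ V) W ≫ map (α_ U V W).hom =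
      _ ≫ (α_ (obj f U) (obj f V) (obj f W)).hom ≫ obj f U ◁ μ e V W ≫ μ e U (V ⊗ W)
    rw [reassoc_of% h1, incl_μ_assoc _ (SVec.par_tmul_of_homogeneous hu hv) hw,
      incl_map _ (SVec.par_tmul_of_homogeneous (SVec.par_tmul_of_homogeneous hu hv) hw),
      associator_naturality_assoc, reassoc_of% h2,
      incl_μ _ hu (SVec.par_tmul_of_homogeneous hv hw), SVec.lin_associator_tmul,
      mulIso_assoc e he]
  left_unitality V := by
    rw [εIso_hom]
    change (λ_ (obj f V)).hom = unitHom f ▷ obj f V ≫ μ e (𝟙_ SVec) V ≫ map (λ_ V).hom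
    rw [← cancel_epi (λ_ (obj f V)).inv, Iso.inv_hom_id]
    refine hom_ext fun k v hv => ?_
    have h1 : incl f V k v ≫ (λ_ (obj f V)).inv ≫ unitHom f ▷ obj f V =
        (λ_ _).inv ≫ (unitHom f ⊗ₘ incl f V k v) := by
      rw [leftUnitor_inv_naturality_assoc, whisker_exchange, MonoidalCategory.tensorHom_def]
    have h2 : (unitHom f ⊗ₘ incl f V k v) ≫ μ e (𝟙_ SVec) V ≫ map (λ_ V).hom =
        (λ_ (gradedObj f k)).hom ≫ incl f V k v := by
      refine (incl_μ_assoc e SVec.par_one' hv _).trans ?_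
      rw [incl_map _ (SVec.par_tmul_of_homogeneous SVec.par_one' hv), SVec.lin_leftUnitor_tmul]
      cases k <;> rfl
    rw [reassoc_of% h1, h2, Category.comp_id, Iso.inv_hom_id_assoc]
  right_unitality V := by
    rw [εIso_hom]
    change (ρ_ (obj f V)).hom = obj f V ◁ unitHom f ≫ μ e V (𝟙_ SVec) ≫ map (ρ_ V).hom
    rw [← cancel_epi (ρ_ (obj f V)).inv, Iso.inv_hom_id]
    refine hom_ext fun k v hv => ?_
    have h1 : incl f V k v ≫ (ρ_ (obj f V)).inv ≫ obj f V ◁ unitHom f =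
        (ρ_ _).inv ≫ (incl f V k v ⊗ₘ unitHom f) := by
      rw [rightUnitor_inv_naturality_assoc, MonoidalCategory.tensorHom_def]
    have h2 : (incl f V k v ⊗ₘ unitHom f) ≫ μ e V (𝟙_ SVec) ≫ map (ρ_ V).hom =
        (ρ_ (gradedObj f k)).hom ≫ incl f V k v := by
      refine (incl_μ_assoc e hv SVec.par_one' _).trans ?_
      rw [incl_map _ (SVec.par_tmul_of_homogeneous hv SVec.par_one'), SVec.lin_rightUnitor_tmul]
      cases k
      · exact congrArg (· ≫ incl f V false v) unitors_equal
      · rfl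
    rw [reassoc_of% h1, h2, Category.comp_id, Iso.inv_hom_id_assoc]

variable (f) in
/-- The braided structure. -/
@[reducible] def braided [BraidedCategory B]
    (he : e.hom ▷ f ≫ (λ_ f).hom = (α_ f f f).hom ≫ f ◁ e.hom ≫ (ρ_ f).hom)
    (hβ : (β_ f f).hom = -𝟙 _) : (functor f).Braided :=
  { (coreMonoidal f e he).toMonoidal with
    braided := fun V W => hom_ext_tensor fun k v l w hv hw => by
      change (incl f V k v ⊗ₘ incl f W l w) ≫ μ e V W ≫ map (β_ V W).hom =
        (incl f V k v ⊗ₘ incl f W l w) ≫ (β_ (obj f V) (obj f W)).hom ≫ μ e W V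
      rw [incl_μ_assoc _ hv hw, incl_map _ (SVec.par_tmul_of_homogeneous hv hw),
        BraidedCategory.braiding_naturality_assoc, incl_μ _ hw hv,
        SVec.lin_braiding_tmul V W v w k l hv hw, map_smul, Linear.comp_smul]
      cases k <;> cases l
      · have h : (β_ (𝟙_ B) (𝟙_ B)).hom ≫ (λ_ (𝟙_ B)).hom = (λ_ (𝟙_ B)).hom := by
          rw [braiding_leftUnitor, unitors_equal]
        exact (one_smul ℂ _).trans ((reassoc_of% h) _).symm
      · have h : (β_ (𝟙_ B) f).hom ≫ (ρ_ f).hom = (λ_ f).hom := by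
          rw [braiding_rightUnitor]
        exact (one_smul ℂ _).trans ((reassoc_of% h) _).symm
      · have h : (β_ f (𝟙_ B)).hom ≫ (λ_ f).hom = (ρ_ f).hom := by
          rw [braiding_leftUnitor]
        exact (one_smul ℂ _).trans ((reassoc_of% h) _).symm
      -- The sign of the super flip on two odd vectors matches the self-braiding of `f`.
      · have h : (β_ f f).hom ≫ e.hom = (-1 : ℂ) • e.hom := by
          rw [hβ, Preadditive.neg_comp, Category.id_comp, neg_smul, one_smul]
        refine Eq.trans ?_ ((reassoc_of% h) _).symm
        exact (Linear.smul_comp _ _ _ _ _ _).symm }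

lemma map_parity [BraidedCategory B] [BalancedCategory B]
    (hf : (BalancedCategory.twist f).hom = -𝟙 f) (V : SVec) :
    map (BalancedCategory.twist V).hom = (BalancedCategory.twist (obj f V)).hom :=
  hom_ext fun k v hv => by
    rw [incl_map _ hv, BalancedCategory.twist_naturality]
    change incl f V k (SVec.par V v) = _
    rw [hv, map_smul]
    cases k
    · have h : (BalancedCategory.twist (𝟙_ B)).hom = 𝟙 _ := twist_unit
      refine (one_smul ℂ _).trans ?_
      change _ = (BalancedCategory.twist (𝟙_ B)).hom ≫ _
      rw [h]
      exact (Category.id_comp _).symm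
    · have h : (BalancedCategory.twist f).hom = (-1 : ℂ) • 𝟙 f := by
        rw [hf, neg_smul, one_smul]
      change (-1 : ℂ) • incl f V true v = (BalancedCategory.twist f).hom ≫ _
      rw [h]
      refine Eq.trans ?_ (Linear.smul_comp _ _ _ _ _ _).symm
      exact congrArg ((-1 : ℂ) • ·) (Category.id_comp _).symm

/-- The morphism between basis vectors `i` and `j`, zero if their parities differ. -/
def matrixUnit (V W : SVec) (i : Fin (SVec.dim V)) (j : Fin (SVec.dim W)) : V ⟶ W :=
  SVec.ofLin (if SVec.degree V i = SVec.degree W j then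
      ((SVec.basis V).coord i).smulRight (SVec.basis W j) else 0) <| by
    intro v
    split_ifs with h
    · revert v
      refine fun v => LinearMap.congr_fun (f := ((SVec.basis V).coord i).smulRight
        (SVec.basis W j) ∘ₗ SVec.par V) (g := SVec.par W ∘ₗ ((SVec.basis V).coord i).smulRight
        (SVec.basis W j)) ((SVec.basis V).ext fun i' => ?_) v
      simp only [LinearMap.comp_apply, SVec.par_basis, map_smul, LinearMap.smulRight_apply,
        Module.Basis.coord_apply, Module.Basis.repr_self]
      by_cases hi : i' = i
      · rw [hi, h, Finsupp.single_eq_same, one_smul, one_smul]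
      · rw [Finsupp.single_eq_of_ne (Ne.symm hi), zero_smul, smul_zero, zero_smul]
    · simp

lemma lin_matrixUnit (V W : SVec) (i : Fin (SVec.dim V)) (j : Fin (SVec.dim W)) :
    SVec.lin (matrixUnit V W i j) = if SVec.degree V i = SVec.degree W j then
      ((SVec.basis V).coord i).smulRight (SVec.basis W j) else 0 := rfl

lemma map_matrixUnit (V W : SVec) (i : Fin (SVec.dim V)) (j : Fin (SVec.dim W)) :
    map (matrixUnit V W i j) =
      π f V i ≫ transfer f (SVec.degree V i) (SVec.degree W j) ≫ ι f W j := by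
  refine (covers_ι f V).hom_ext fun i' => ?_
  rw [← incl_basis_degree, incl_map _ (SVec.par_basis V i'), incl_basis_degree, lin_matrixUnit]
  by_cases hi : i' = i
  · subst hi
    rw [ι_π_self_assoc]
    split_ifs with h
    · rw [LinearMap.smulRight_apply, Module.Basis.coord_apply, Module.Basis.repr_self,
        Finsupp.single_eq_same, one_smul, incl_basis]
    · rw [transfer_of_ne f h, zero_comp, LinearMap.zero_apply, map_zero]
  · rw [← Category.assoc (ι f V i'), ι_π_ne f V hi, zero_comp]
    split_ifs with h
    · rw [LinearMap.smulRight_apply, Module.Basis.coord_apply, Module.Basis.repr_self,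
        Finsupp.single_eq_of_ne (Ne.symm hi), zero_smul, map_zero]
    · rw [LinearMap.zero_apply, map_zero]

/-- Morphisms of super vector spaces preserve parity. -/
lemma coord_lin_of_degree_ne {V W : SVec} (g : V ⟶ W) {i : Fin (SVec.dim V)}
    {j : Fin (SVec.dim W)} (h : SVec.degree V i ≠ SVec.degree W j) :
    (SVec.basis W).coord j (SVec.lin g (SVec.basis V i)) = 0 := by
  refine SVec.homogeneous_induction (SVec.basis W) (SVec.degree W) (SVec.par_basis W)
    (P := fun w => (SVec.basis W).coord j w = 0) (map_zero _)
    (fun x y hx hy => by rw [map_add, hx, hy, add_zero])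
    (fun c x hx => by rw [map_smul, hx, smul_zero]) (fun j' hj' => ?_)
    (SVec.par_lin_of_homogeneous g (SVec.par_basis V i))
  have : j' ≠ j := fun h' => h (by rw [← hj', h'])
  rw [Module.Basis.coord_apply, Module.Basis.repr_self, Finsupp.single_eq_of_ne (Ne.symm this)]

lemma sum_matrixUnit {V W : SVec} (g : V ⟶ W) :
    ∑ i, ∑ j, (SVec.basis W).coord j (SVec.lin g (SVec.basis V i)) • matrixUnit V W i j = g := by
  let L : (V ⟶ W) →ₗ[ℂ] V.V →ₗ[ℂ] W.V := ⟨⟨SVec.lin, SVec.lin_add⟩, SVec.lin_smul⟩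
  refine SVec.hom_ext' ((SVec.basis V).ext fun i => ?_)
  change L _ _ = L g _
  simp only [map_sum, map_smul, LinearMap.sum_apply, LinearMap.smul_apply]
  rw [Finset.sum_eq_single i]
  · refine Eq.trans (Finset.sum_congr rfl fun j _ => ?_) ((SVec.basis W).sum_repr (SVec.lin g _))
    change _ • SVec.lin (matrixUnit V W i j) _ = _
    rw [lin_matrixUnit]
    split_ifs with h
    · rw [LinearMap.smulRight_apply, Module.Basis.coord_apply, Module.Basis.coord_apply,
        Module.Basis.repr_self, Finsupp.single_eq_same, one_smul]
    · have := coord_lin_of_degree_ne g h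
      rw [Module.Basis.coord_apply] at this
      rw [LinearMap.zero_apply, smul_zero, this, zero_smul]
  · intro i' _ hi
    refine Finset.sum_eq_zero fun j _ => ?_
    change _ • SVec.lin (matrixUnit V W i' j) _ = _
    rw [lin_matrixUnit]
    split_ifs with h
    · rw [LinearMap.smulRight_apply, Module.Basis.coord_apply _ i', Module.Basis.repr_self,
        Finsupp.single_eq_of_ne hi, zero_smul, smul_zero]
    · rw [LinearMap.zero_apply, smul_zero]
  · simp

lemma ι_map_π {V W : SVec} (g : V ⟶ W) (i : Fin (SVec.dim V)) (j : Fin (SVec.dim W)) :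
    ι f V i ≫ map g ≫ π f W j ≫ transfer f (SVec.degree W j) (SVec.degree V i) =
      (SVec.basis W).coord j (SVec.lin g (SVec.basis V i)) • 𝟙 _ := by
  have h1 : ι f V i ≫ map g = ∑ j', (SVec.basis W).coord j' (SVec.lin g (SVec.basis V i)) •
      transfer f _ _ ≫ ι f W j' := by
    rw [← incl_basis_degree, incl_map _ (SVec.par_basis V i), incl, LinearMap.sum_apply]
    rfl
  rw [← Category.assoc (ι f V i), h1, Preadditive.sum_comp, Finset.sum_eq_single j]
  · rw [Linear.smul_comp, Category.assoc, ι_π_self_assoc]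
    by_cases h : SVec.degree V i = SVec.degree W j
    · rw [h, transfer_self, Category.id_comp]
    · rw [coord_lin_of_degree_ne g h, zero_smul, zero_smul]
  · intro j' _ hj
    rw [Linear.smul_comp, Category.assoc, ← Category.assoc (ι f W j'), ι_π_ne f W hj, zero_comp,
      comp_zero, smul_zero]
  · simp

end

end SuperFunctor

/-! ### Products of braided functors -/

section

variable {A M B : Type*} [Category* A] [Category* M] [Category* B] [MonoidalCategory A]
  [MonoidalCategory M] [MonoidalCategory B]

/-- The tensor product of two functors. -/
def tensorFunctor (K : A ⥤ B) (J : M ⥤ B) : A × M ⥤ B := K.prod J ⋙ tensor B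

variable [BraidedCategory A] [BraidedCategory M] [BraidedCategory B]

/-- After the braiding has crossed `k₁` with `j₂`, `tensorμ` crosses them back; the resulting double
braiding is trivial by hypothesis. -/
lemma braiding_tensorμ (k₁ j₁ k₂ j₂ : B) (h : (β_ k₁ j₂).hom ≫ (β_ j₂ k₁).hom = 𝟙 _) :
    (β_ (k₁ ⊗ j₁) (k₂ ⊗ j₂)).hom ≫ tensorμ k₂ j₂ k₁ j₁ =
      tensorμ k₁ j₁ k₂ j₂ ≫ ((β_ k₁ k₂).hom ⊗ₘ (β_ j₁ j₂).hom) := by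
  rw [braiding_tensor_tensor]
  simp only [tensorμ]
  calc
    _ = 𝟙 _ ⊗≫ k₁ ◁ (β_ j₁ k₂).hom ▷ j₂ ⊗≫ (β_ k₁ k₂).hom ▷ (j₁ ⊗ j₂) ⊗≫
        k₂ ◁ (k₁ ◁ (β_ j₁ j₂).hom ⊗≫ ((β_ k₁ j₂).hom ≫ (β_ j₂ k₁).hom) ▷ j₁) ⊗≫ 𝟙 _ := by
      monoidal
    _ = 𝟙 _ ⊗≫ k₁ ◁ (β_ j₁ k₂).hom ▷ j₂ ⊗≫ ((β_ k₁ k₂).hom ▷ (j₁ ⊗ j₂) ≫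
        (k₂ ⊗ k₁) ◁ (β_ j₁ j₂).hom) ⊗≫ 𝟙 _ := by
      rw [h]; monoidal
    _ = _ := by
      rw [← MonoidalCategory.tensorHom_def]; monoidal

variable (K : A ⥤ B) (J : M ⥤ B) [K.Braided] [J.Braided]

/-- The tensor product of two braided functors with trivial double braidings is braided. -/
@[reducible] def tensorFunctorBraided
    (h : ∀ V Y, (β_ (K.obj V) (J.obj Y)).hom ≫ (β_ (J.obj Y) (K.obj V)).hom = 𝟙 _) :
    (tensorFunctor K J).Braided :=
  letI : (tensorFunctor K J).Monoidal := inferInstanceAs (K.prod J ⋙ tensor B).Monoidal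
  { this with
    braided := fun X Y => by
      have hμ : ∀ X Y : A × M, Functor.LaxMonoidal.μ (tensorFunctor K J) X Y =
          tensorμ (K.obj X.1) (J.obj X.2) (K.obj Y.1) (J.obj Y.2) ≫
            (Functor.LaxMonoidal.μ K X.1 Y.1 ⊗ₘ Functor.LaxMonoidal.μ J X.2 Y.2) :=
        fun X Y => rfl
      refine (congrArg (· ≫ (tensorFunctor K J).map (β_ X Y).hom) (hμ X Y)).trans ?_
      refine Eq.trans ?_ (congrArg ((β_ _ _).hom ≫ ·) (hμ Y X)).symm
      change (_ ≫ _) ≫ (K.map (β_ X.1 Y.1).hom ⊗ₘ J.map (β_ X.2 Y.2).hom) =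
        (β_ (K.obj X.1 ⊗ J.obj X.2) (K.obj Y.1 ⊗ J.obj Y.2)).hom ≫ _
      rw [Category.assoc, tensorHom_comp_tensorHom, Functor.LaxBraided.braided,
        Functor.LaxBraided.braided, ← tensorHom_comp_tensorHom, ← Category.assoc,
        ← braiding_tensorμ _ _ _ _ (h X.1 Y.2), Category.assoc] }

lemma tensorFunctor_twist [BalancedCategory A] [BalancedCategory M] [BalancedCategory B]
    (h : ∀ V Y, (β_ (K.obj V) (J.obj Y)).hom ≫ (β_ (J.obj Y) (K.obj V)).hom = 𝟙 _)
    (hK : ∀ V, K.map (BalancedCategory.twist V).hom = (BalancedCategory.twist (K.obj V)).hom)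
    (hJ : ∀ Y, J.map (BalancedCategory.twist Y).hom = (BalancedCategory.twist (J.obj Y)).hom)
    (X : A × M) : (tensorFunctor K J).map (BalancedCategory.twist X).hom =
      (BalancedCategory.twist ((tensorFunctor K J).obj X)).hom := by
  change K.map _ ⊗ₘ J.map _ = (BalancedCategory.twist (K.obj X.1 ⊗ J.obj X.2)).hom
  rw [BalancedCategory.twist_tensor, h, Category.comp_id]
  exact congrArg₂ (· ⊗ₘ ·) (hK X.1) (hJ X.2)

end

/-! ### The Deligne product with super vector spaces -/

section

open SuperFunctor

variable {M : Type*} [Category* M] [Preadditive M] [Linear ℂ M]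
  {B : Type u} [Category.{v} B] [Preadditive B] [Linear ℂ B] [HasFiniteBiproducts B]
  [MonoidalCategory B] [MonoidalPreadditive B] [MonoidalLinear ℂ B]
  (f : B) (J : M ⥤ B) [J.Additive] [J.Linear ℂ]

/-- Tensoring the image of a morphism with a graded piece. -/
def whiskerMap (k : Bool) (Y Y' : M) :
    (Y ⟶ Y') →ₗ[ℂ] (gradedObj f k ⊗ J.obj Y ⟶ gradedObj f k ⊗ J.obj Y') where
  toFun g := gradedObj f k ◁ J.map g
  map_add' g h := by rw [J.map_add, MonoidalPreadditive.whiskerLeft_add]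
  map_smul' c g := by rw [J.map_smul, MonoidalLinear.whiskerLeft_smul, RingHom.id_apply]

lemma whiskerMap_apply (k : Bool) {Y Y' : M} (g : Y ⟶ Y') :
    whiskerMap f J k Y Y' g = gradedObj f k ◁ J.map g := rfl

/-- The action of the tensor product of functors on morphisms. -/
def tensorHomMap (V V' : SVec) (Y Y' : M) :
    (V ⟶ V') ⊗[ℂ] (Y ⟶ Y') →ₗ[ℂ] (obj f V ⊗ J.obj Y ⟶ obj f V' ⊗ J.obj Y') :=
  TensorProduct.lift (LinearMap.mk₂ ℂ (fun v g => map v ⊗ₘ J.map g)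
    (fun v v' g => by
      rw [← MonoidalPreadditive.add_tensor]
      congr 1
      refine hom_ext fun k x hx => ?_
      rw [incl_map _ hx, Preadditive.comp_add, incl_map _ hx, incl_map _ hx, SVec.lin_add,
        LinearMap.add_apply, map_add])
    (fun c v g => by
      rw [MonoidalCategory.tensorHom_def, MonoidalCategory.tensorHom_def,
        ← Linear.smul_comp, ← MonoidalLinear.smul_whiskerRight]
      congr 2
      refine hom_ext fun k x hx => ?_
      rw [incl_map _ hx, Linear.comp_smul, incl_map _ hx, SVec.lin_smul,
        LinearMap.smul_apply, map_smul])
    (fun v g g' => by rw [J.map_add, MonoidalPreadditive.tensor_add])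
    (fun c v g => by
      rw [J.map_smul, MonoidalCategory.tensorHom_def, MonoidalCategory.tensorHom_def,
        MonoidalLinear.whiskerLeft_smul, Linear.comp_smul]))

lemma tensorHomMap_tmul {V V' : SVec} {Y Y' : M} (v : V ⟶ V') (g : Y ⟶ Y') :
    tensorHomMap f J V V' Y Y' (v ⊗ₜ g) = map v ⊗ₘ J.map g := rfl

variable {f J}

/-- The matrix entries of a morphism. -/
def entry (hs : ∀ k Y Y', Function.Bijective (whiskerMap f J k Y Y')) (V V' : SVec) (Y Y' : M)
    (i : Fin (SVec.dim V)) (j : Fin (SVec.dim V')) :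
    (obj f V ⊗ J.obj Y ⟶ obj f V' ⊗ J.obj Y') →ₗ[ℂ] (Y ⟶ Y') :=
  (LinearEquiv.ofBijective _ (hs (SVec.degree V i) Y Y')).symm.toLinearMap ∘ₗ
    (Linear.leftComp ℂ _ (ι f V i ▷ J.obj Y)) ∘ₗ (Linear.rightComp ℂ _
      ((π f V' j ≫ transfer f (SVec.degree V' j) (SVec.degree V i)) ▷ J.obj Y'))

lemma whisker_entry (hs : ∀ k Y Y', Function.Bijective (whiskerMap f J k Y Y')) {V V' : SVec}
    {Y Y' : M} (i : Fin (SVec.dim V)) (j : Fin (SVec.dim V'))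
    (h : obj f V ⊗ J.obj Y ⟶ obj f V' ⊗ J.obj Y') :
    gradedObj f (SVec.degree V i) ◁ J.map (entry hs V V' Y Y' i j h) = ι f V i ▷ J.obj Y ≫ h ≫
      (π f V' j ≫ transfer f (SVec.degree V' j) (SVec.degree V i)) ▷ J.obj Y' :=
  (LinearEquiv.ofBijective _ (hs (SVec.degree V i) Y Y')).apply_symm_apply _

lemma entry_tensorHom (hs : ∀ k Y Y', Function.Bijective (whiskerMap f J k Y Y')) {V V' : SVec}
    {Y Y' : M} (i : Fin (SVec.dim V)) (j : Fin (SVec.dim V')) (v : V ⟶ V') (g : Y ⟶ Y') :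
    entry hs V V' Y Y' i j (map v ⊗ₘ J.map g) =
      (SVec.basis V').coord j (SVec.lin v (SVec.basis V i)) • g := by
  refine (hs (SVec.degree V i) Y Y').1 ?_
  rw [whiskerMap_apply, whisker_entry, map_smul, whiskerMap_apply, ← tensorHom_id,
    ← tensorHom_id, tensorHom_comp_tensorHom, tensorHom_comp_tensorHom, Category.id_comp,
    Category.comp_id, ι_map_π, MonoidalCategory.tensorHom_def, MonoidalLinear.smul_whiskerRight,
    id_whiskerRight, Linear.smul_comp, Category.id_comp]

/-- By `hs` every diagonal matrix entry comes from a unique morphism of `M`, and by `hd` the entries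
between different parities vanish. Expansion in matrix units is therefore an inverse. -/
theorem tensorHomMap_bijective (hs : ∀ k Y Y', Function.Bijective (whiskerMap f J k Y Y'))
    (hd : ∀ k l Y Y', k ≠ l → ∀ g : gradedObj f k ⊗ J.obj Y ⟶ gradedObj f l ⊗ J.obj Y', g = 0)
    (V V' : SVec) (Y Y' : M) : Function.Bijective (tensorHomMap f J V V' Y Y') := by
  let S : (obj f V ⊗ J.obj Y ⟶ obj f V' ⊗ J.obj Y') →ₗ[ℂ] (V ⟶ V') ⊗[ℂ] (Y ⟶ Y') :=
    ∑ i, ∑ j, TensorProduct.mk ℂ _ _ (matrixUnit V V' i j) ∘ₗ entry hs V V' Y Y' i j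
  have hS : ∀ h, S h = ∑ i, ∑ j, matrixUnit V V' i j ⊗ₜ entry hs V V' Y Y' i j h := fun h => by
    simp only [S, LinearMap.sum_apply]
    rfl
  have h1 : S ∘ₗ tensorHomMap f J V V' Y Y' = LinearMap.id := by
    refine TensorProduct.ext' fun v g => ?_
    rw [LinearMap.comp_apply, tensorHomMap_tmul, hS, LinearMap.id_apply]
    simp only [entry_tensorHom, ← TensorProduct.smul_tmul]
    simp only [← TensorProduct.sum_tmul, sum_matrixUnit]
  have h2 : ∀ h, tensorHomMap f J V V' Y Y' (S h) = h := by
    intro h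
    -- The term at `(i, j)` is the block of `h` from the summand `i` to the summand `j`; the blocks
    -- add up to `h`.
    have h3 : ∀ i j, map (matrixUnit V V' i j) ⊗ₘ J.map (entry hs V V' Y Y' i j h) =
        (π f V i ≫ ι f V i) ▷ J.obj Y ≫ h ≫ (π f V' j ≫ ι f V' j) ▷ J.obj Y' := by
      intro i j
      have h4 : gradedObj f (SVec.degree V i) ◁ J.map (entry hs V V' Y Y' i j h) ≫
          transfer f (SVec.degree V i) (SVec.degree V' j) ▷ J.obj Y' =
          ι f V i ▷ J.obj Y ≫ h ≫ π f V' j ▷ J.obj Y' := by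
        by_cases hij : SVec.degree V i = SVec.degree V' j
        · rw [whisker_entry, comp_whiskerRight, Category.assoc, Category.assoc, Category.assoc,
            ← comp_whiskerRight, transfer_comp_transfer f hij.symm, id_whiskerRight,
            Category.comp_id]
        · rw [hd _ _ _ _ hij (ι f V i ▷ J.obj Y ≫ _), transfer_of_ne f hij,
            MonoidalPreadditive.zero_whiskerRight, comp_zero]
      rw [map_matrixUnit, MonoidalCategory.tensorHom_def']
      rw [comp_whiskerRight, comp_whiskerRight, comp_whiskerRight, comp_whiskerRight,
        Category.assoc, whisker_exchange_assoc, reassoc_of% h4]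
    rw [hS]
    simp only [map_sum, tensorHomMap_tmul, h3]
    simp only [← Preadditive.comp_sum, ← Preadditive.sum_comp, ← sum_whiskerRight, sum_π_ι]
    simp
  refine ⟨fun x y hxy => ?_, fun h => ⟨S h, h2 h⟩⟩
  have := congrArg S hxy
  rwa [← LinearMap.comp_apply, ← LinearMap.comp_apply, h1] at this

/-- Recognition of the Deligne product with super vector spaces. -/
theorem isDeligneProduct_tensorFunctor
    (hs : ∀ k Y Y', Function.Bijective (whiskerMap f J k Y Y'))
    (hd : ∀ k l Y Y', k ≠ l → ∀ g : gradedObj f k ⊗ J.obj Y ⟶ gradedObj f l ⊗ J.obj Y', g = 0)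
    (hz : ∀ Z : B, ∃ (n : ℕ) (X : Fin n → SVec) (Y : Fin n → M),
      IsDirectSum Z fun i => obj f (X i) ⊗ J.obj (Y i)) :
    IsDeligneProduct (tensorFunctor (functor f) J) where
  hom_equiv V V' Y Y' :=
    ⟨LinearEquiv.ofBijective _ (tensorHomMap_bijective hs hd V V' Y Y'), fun _ _ => rfl⟩
  direct_sum := hz

end

/-! ### The odd line. -/

namespace SVec

/-- The odd line. -/
def oddLine : SVec where
  V := FGModuleCat.of ℂ ℂ
  ρ := (algebraMap ℂ (End (FGModuleCat.of ℂ ℂ))).toMonoidHom.comp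
    ((Int.castRingHom ℂ).toMonoidHom.comp (Units.coeHom ℤ))

/-- The basis of the odd line. -/
def oddBasis : Module.Basis Unit ℂ oddLine.V := Module.Basis.singleton Unit ℂ

lemma par_odd (v : oddLine.V) : par oddLine v = sgn true • v := by
  change (algebraMap ℂ (End (FGModuleCat.of ℂ ℂ)) ((-1 : ℤˣ) : ℤ)).hom.hom v = _
  rw [Algebra.algebraMap_eq_smul_one]
  change (((-1 : ℤˣ) : ℤ) : ℂ) • v = _
  simp

end SVec

section

variable {C : Type u} [Category.{v} C] [UnitaryRibbonFusionCategory C] {f : C}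

/-! ### The braiding of a fermion with itself -/

/-- As `f ⊗ f` is simple, the self-braiding of `f` is a scalar c, and c² = 1. By the hexagon, the
braiding of `f ⊗ f` with `f` is c² times the associator, hence the associator itself. Naturality of
the braiding along `e` then gives the identity, whatever the choice of `e`. -/
lemma IsFermion.evaluation_assoc (hf : IsFermion f) (e : f ⊗ f ≅ 𝟙_ C) :
    e.hom ▷ f ≫ (λ_ f).hom = (α_ f f f).hom ≫ f ◁ e.hom ≫ (ρ_ f).hom := by
  have := hf.simple
  have : Simple (f ⊗ f) := Simple.of_iso e
  obtain ⟨c, hc⟩ := endomorphism_simple_eq_smul_id ℂ (β_ f f).hom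
  have h1 : (c * c) • 𝟙 (f ⊗ f) = 𝟙 (f ⊗ f) := by
    have h := hf.trivialSector_self
    change (β_ f f).hom ≫ (β_ f f).hom = _ at h
    rw [← hc] at h
    simpa [smul_smul] using h
  have h2 : (β_ (f ⊗ f) f).hom = (α_ f f f).hom := by
    rw [BraidedCategory.braiding_tensor_left_hom, ← hc]
    simp only [MonoidalLinear.whiskerLeft_smul, MonoidalLinear.smul_whiskerRight,
      Linear.comp_smul, Linear.smul_comp, smul_smul, MonoidalCategory.whiskerLeft_id,
      id_whiskerRight, Category.id_comp]
    have h3 : c * c = 1 := by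
      by_contra h
      refine id_nonzero (f ⊗ f) ?_
      have h4 : (c * c - 1) • 𝟙 (f ⊗ f) = 0 := by rw [sub_smul, h1, one_smul, sub_self]
      exact (smul_eq_zero.1 h4).resolve_left (sub_ne_zero.2 h)
    simp [h3]
  have h3 := BraidedCategory.braiding_naturality_left e.hom f
  rw [h2, braiding_tensorUnit_left] at h3
  rw [← reassoc_of% h3]
  simp

/-- The isomorphism `e` makes `f` its own dual. Computed with this pairing, the dimension of `f` is
its twist -1 times the self-braiding scalar c; it is also 1, so c = -1. -/
lemma IsFermion.braiding_self (hf : IsFermion f) : (β_ f f).hom = -𝟙 (f ⊗ f) := by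
  have := hf.simple
  obtain ⟨e⟩ := hf.tensor_self
  have : Simple (f ⊗ f) := Simple.of_iso e
  obtain ⟨c, hc⟩ := endomorphism_simple_eq_smul_id ℂ (β_ f f).hom
  have h := hf.evaluation_assoc e
  let : ExactPairing f f :=
    { coevaluation' := e.inv
      evaluation' := e.hom
      coevaluation_evaluation' := by
        rw [← cancel_mono (λ_ f).hom, Category.assoc, Category.assoc, h, Category.assoc,
          Iso.inv_hom_id_assoc, ← whiskerLeft_comp_assoc, e.inv_hom_id]
        simp
      evaluation_coevaluation' := by
        rw [← cancel_mono (ρ_ f).hom, Category.assoc, Category.assoc, ← h, Category.assoc,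
          Iso.inv_hom_id, ← comp_whiskerRight_assoc, e.inv_hom_id]
        simp }
  have h1 : qdim f = -c := by
    rw [qdim_def, trace_eq_traceWith f f]
    refine toScalar_eq ?_
    have e1 : η_ f f = e.inv := rfl
    have e2 : ε_ f f = e.hom := rfl
    have h2 : -𝟙 f = (-1 : ℂ) • 𝟙 f := by simp
    rw [traceWith, twistedEval, braidedEval, e1, e2, hf.twist, ← hc, h2,
      MonoidalLinear.smul_whiskerRight]
    simp only [id_whiskerRight, Category.id_comp, Linear.smul_comp, Linear.comp_smul,
      e.inv_hom_id, smul_smul]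
    congr 1
    ring
  rw [qdim_of_iso_unit e] at h1
  rw [← hc, ← neg_neg c, ← h1, neg_smul, one_smul]

/-! ### From a modular subcategory containing the fermion to a splitting -/

/-- Frobenius reciprocity turns `g` into a morphism from `X ⊗ Yᘁ`, an object of `D`, to the simple
object `f` outside `D`. -/
lemma hom_tensor_eq_zero {D : ObjectProperty C} (hD : IsFusionSubcategory D) [Simple f]
    (hf : ¬ D f) {X Y : C} (hX : D X) (hY : D Y) (g : X ⟶ f ⊗ Y) : g = 0 := by
  have h : Module.finrank ℂ (X ⟶ f ⊗ Y) = 0 := by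
    let := BraidedCategory.exactPairing_swap Y Yᘁ
    rw [← finrank_tensorRight X Yᘁ Y f]
    exact hD.finrank_eq_zero (hD.tensor _ _ hX (hD.dual _ hY)) hf
  have := Module.finrank_zero_iff.1 h
  exact Subsingleton.elim _ _

lemma tensor_hom_eq_zero {D : ObjectProperty C} (hD : IsFusionSubcategory D) [Simple f]
    (e : f ⊗ f ≅ 𝟙_ C) (hf : ¬ D f) {X Y : C} (hX : D X) (hY : D Y) (g : f ⊗ X ⟶ Y) : g = 0 := by
  refine whiskerLeft_injective_of_iso e ?_
  rw [← cancel_epi (tensorSelfIso e X).inv, hom_tensor_eq_zero hD hf hX hY (_ ≫ f ◁ g)]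
  simp

end

/-! ### Splitting the trivial sector over a centralizer. -/

section

variable {B : Type u} [Category.{v} B] [Preadditive B] [Linear ℂ B] [HasFiniteBiproducts B]
  [MonoidalCategory B] [MonoidalPreadditive B] [BraidedCategory B] {f : B}

lemma SuperFunctor.doubleBraiding_obj {Y : B} (h : (β_ f Y).hom ≫ (β_ Y f).hom = 𝟙 _)
    (V : SVec) : (β_ (SuperFunctor.obj f V) Y).hom ≫ (β_ Y (SuperFunctor.obj f V)).hom = 𝟙 _ := by
  have h1 : ∀ k, (β_ (SuperFunctor.gradedObj f k) Y).hom ≫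
      (β_ Y (SuperFunctor.gradedObj f k)).hom = 𝟙 _ := by
    rintro (_ | _)
    · change (β_ (𝟙_ B) Y).hom ≫ (β_ Y (𝟙_ B)).hom = 𝟙 _
      simp
    · exact h
  have h2 : SuperFunctor.Covers fun i => SuperFunctor.ι f V i ▷ Y := by
    refine ⟨fun i => SuperFunctor.π f V i ▷ Y, ?_⟩
    simp only [← comp_whiskerRight]
    rw [← sum_whiskerRight, SuperFunctor.sum_π_ι, id_whiskerRight]
  refine h2.hom_ext fun i => ?_
  rw [BraidedCategory.braiding_naturality_left_assoc,
    BraidedCategory.braiding_naturality_right, reassoc_of% (h1 _), Category.comp_id]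

end

section

variable {C : Type u} [Category.{v} C] [UnitaryRibbonFusionCategory C] {f : C}

lemma IsDirectSum.congr {B : Type*} [Category* B] [Preadditive B] {n : ℕ} {Z : B} {X Y : Fin n → B}
    (h : IsDirectSum Z X) (e : ∀ i, Nonempty (X i ≅ Y i)) : IsDirectSum Z Y := by
  obtain ⟨p, q, h1, h2, h3⟩ := h.exists_maps
  let e' := fun i => (e i).some
  refine IsDirectSum.of_maps (fun i => p i ≫ (e' i).hom) (fun i => (e' i).inv ≫ q i) ?_ ?_ ?_
  · simpa using h1
  · intro i
    simp [reassoc_of% (h2 i)]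
  · intro i j hij
    simp [reassoc_of% (h3 i j hij)]

/-- A modular subcategory of dimension four containing the fermion splits the trivial sector. -/
theorem isSplitSuperModular_of_modular (hC : IsModular C) (hf : IsFermion f) {A : ObjectProperty C}
    (hA : IsModularSubcategory A) (hdim : globalDim A = 4) (hfA : A f) :
    IsSplitSuperModular (trivialSector f).FullSubcategory := by
  have := hf.simple
  obtain ⟨e⟩ := hf.tensor_self
  obtain ⟨hle, hn, hX⟩ := centralizer_properties hC hf hA hdim hfA
  have hT := isFusionSubcategory_trivialSector f
  have hD : IsModularSubcategory (centralizer A) := isModularSubcategory_centralizer hC hA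
  have hF := hD.toIsFusionSubcategory
  have := hF.isMonoidal
  have := hT.isClosedUnderFiniteProducts
  have : HasFiniteBiproducts (trivialSector f).FullSubcategory :=
    HasFiniteBiproducts.of_hasFiniteProducts
  let f' : (trivialSector f).FullSubcategory := ⟨f, hf.trivialSector_self⟩
  let e' : f' ⊗ f' ≅ 𝟙_ _ := (trivialSector f).isoMk e
  let J := ObjectProperty.ιOfLE hle
  have hJ : J.Additive := ⟨rfl⟩
  have hJ' : J.Linear ℂ := ⟨fun _ _ => rfl⟩
  let hK : (SuperFunctor.functor f').Braided := SuperFunctor.braided f' e'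
    (by ext; exact hf.evaluation_assoc e) (by ext; exact hf.braiding_self)
  have hβ : ∀ V Y, (β_ ((SuperFunctor.functor f').obj V) (J.obj Y)).hom ≫
      (β_ (J.obj Y) ((SuperFunctor.functor f').obj V)).hom = 𝟙 _ := fun V Y =>
    SuperFunctor.doubleBraiding_obj (by ext; exact (J.obj Y).property) V
  let hJb : J.Braided := { (inferInstance : J.Monoidal) with }
  -- The modular factor is the centralizer of `A`, and the functor sends `(V, Y)` to the copy of `V`
  -- built from `f`, tensored with `Y`.
  refine ⟨(centralizer A).FullSubcategory, inferInstance, hF.unitaryRibbonFusionCategory,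
    hD.isModular, tensorFunctor (SuperFunctor.functor f') J,
    tensorFunctorBraided _ _ hβ, ?_, ?_⟩
  · refine isDeligneProduct_tensorFunctor ?_ ?_ ?_
    · intro k Y Y'
      have h : (fullHomEquiv (trivialSector f) _ _) ∘ whiskerMap f' J k Y Y' =
          whiskerLeftLinear (SuperFunctor.gradedObj f' k).obj Y.obj Y'.obj ∘
            fullHomEquiv (centralizer A) Y Y' := rfl
      refine ((fullHomEquiv (trivialSector f) _ _).bijective.of_comp_iff' _).1 ?_
      rw [h]
      refine Function.Bijective.comp ?_ (fullHomEquiv (centralizer A) Y Y').bijective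
      rcases k with _ | _
      · exact whiskerLeftLinear_bijective (λ_ (𝟙_ C)) _ _
      · exact whiskerLeftLinear_bijective e _ _
    · rintro (_ | _) (_ | _) Y Y' hkl g
      · exact absurd rfl hkl
      · ext
        exact (cancel_epi (λ_ Y.obj).inv).1
          ((hom_tensor_eq_zero hF hn Y.property Y'.property _).trans comp_zero.symm)
      · ext
        exact (cancel_mono (λ_ Y'.obj).hom).1
          ((tensor_hom_eq_zero hF e hn Y.property Y'.property _).trans zero_comp.symm)
      · exact absurd rfl hkl
    · intro Z
      obtain ⟨n, S, hS, h⟩ := hT.semisimple Z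
      -- A simple object of the trivial sector lies in A', or becomes so after tensoring with `f`;
      -- it comes from the even or the odd line accordingly.
      have h1 : ∀ i, ∃ (V : SVec) (Y : (centralizer A).FullSubcategory),
          Nonempty (S i ≅ SuperFunctor.obj f' V ⊗ J.obj Y) := by
        intro i
        rcases hX _ ((hT.simple_iff _).1 (hS i)) (S i).property with h2 | h2
        · refine ⟨𝟙_ SVec, ⟨_, h2⟩, ⟨(λ_ (S i)).symm ≪≫
            whiskerRightIso (SuperFunctor.εIso f') (S i)⟩⟩
        · refine ⟨SVec.oddLine, ⟨_, h2⟩, ⟨?_ ≪≫ whiskerRightIso (SuperFunctor.lineIso f'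
            SVec.oddBasis true fun i => SVec.par_odd _) (f' ⊗ S i)⟩⟩
          exact (trivialSector f).isoMk (tensorSelfIso e (S i).obj).symm
      choose V Y hVY using h1
      exact ⟨n, V, Y, h.congr hVY⟩
  · refine tensorFunctor_twist _ _ hβ (fun V => ?_) fun Y => rfl
    exact SuperFunctor.map_parity (by ext; exact hf.twist) V

end

/-! ### Quantum traces under braided functors -/

section

open Functor.LaxMonoidal Functor.OplaxMonoidal

variable {M C : Type*} [Category* M] [Category* C] [MonoidalCategory M] [MonoidalCategory C]

/-- The image of an exact pairing under a monoidal functor. -/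
@[reducible] def mapExactPairing (J : M ⥤ C) [J.Monoidal] (X X' : M) [ExactPairing X X'] :
    ExactPairing (J.obj X) (J.obj X') where
  coevaluation' := ε J ≫ J.map (η_ X X') ≫ δ J X X'
  evaluation' := μ J X' X ≫ J.map (ε_ X X') ≫ η J
  coevaluation_evaluation' := by
    have h := congrArg (fun t => J.obj X' ◁ ε J ≫ μ J X' (𝟙_ M) ≫ J.map t ≫
      δ J (𝟙_ M) X' ≫ η J ▷ J.obj X') (ExactPairing.coevaluation_evaluation X X')
    refine Eq.trans ?_ (h.trans ?_)
    · simp only [Functor.map_comp, Functor.Monoidal.map_whiskerLeft,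
        Functor.Monoidal.map_whiskerRight, Functor.Monoidal.map_associator_inv, Category.assoc,
        MonoidalCategory.whiskerLeft_comp, comp_whiskerRight, Functor.Monoidal.μ_δ_assoc]
    · simp only [Functor.map_comp, Functor.Monoidal.map_rightUnitor,
        Functor.Monoidal.map_leftUnitor_inv]
      simp [← whiskerLeft_comp_assoc, ← comp_whiskerRight_assoc]
  evaluation_coevaluation' := by
    have h := congrArg (fun t => ε J ▷ J.obj X ≫ μ J (𝟙_ M) X ≫ J.map t ≫
      δ J X (𝟙_ M) ≫ J.obj X ◁ η J) (ExactPairing.evaluation_coevaluation X X')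
    refine Eq.trans ?_ (h.trans ?_)
    · simp only [Functor.map_comp, Functor.Monoidal.map_whiskerLeft,
        Functor.Monoidal.map_whiskerRight, Functor.Monoidal.map_associator, Category.assoc,
        MonoidalCategory.whiskerLeft_comp, comp_whiskerRight, Functor.Monoidal.μ_δ_assoc]
    · simp only [Functor.map_comp, Functor.Monoidal.map_leftUnitor,
        Functor.Monoidal.map_rightUnitor_inv]
      simp [← whiskerLeft_comp_assoc, ← comp_whiskerRight_assoc]

variable [BraidedCategory M] [BraidedCategory C] [BalancedCategory M] [BalancedCategory C]

lemma map_traceWith (J : M ⥤ C) [J.Braided]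
    (hJ : ∀ Y, J.map (BalancedCategory.twist Y).hom = (BalancedCategory.twist (J.obj Y)).hom)
    (X X' : M) [ExactPairing X X'] (g : X ⟶ X) :
    @traceWith C _ _ _ _ (J.obj X) (J.obj X') (mapExactPairing J X X') (J.map g) =
      ε J ≫ J.map (traceWith X X' g) ≫ η J := by
  let := mapExactPairing J X X'
  have h1 : η_ (J.obj X) (J.obj X') = ε J ≫ J.map (η_ X X') ≫ δ J X X' := rfl
  have h2 : ε_ (J.obj X) (J.obj X') = μ J X' X ≫ J.map (ε_ X X') ≫ η J := rfl
  simp [traceWith, twistedEval, braidedEval, h1, h2, ← hJ]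

end

/-! ### The inclusion of a factor -/

section

variable (A M : Type*) [Category* A] [Category* M] [MonoidalCategory A] [MonoidalCategory M]

/-- The inclusion of the second factor of a product. -/
@[simps] def inclusionRight : M ⥤ A × M where
  obj Y := (𝟙_ A, Y)
  map g := Prod.mkHom (𝟙 _) g

instance : (inclusionRight A M).Monoidal :=
  Functor.CoreMonoidal.toMonoidal
    { εIso := Iso.refl _
      μIso := fun X Y => (λ_ (𝟙_ A)).prod (Iso.refl (X ⊗ Y))
      μIso_hom_natural_left := fun {Y Z} f X => Prod.hom_ext
        (show 𝟙 (𝟙_ A) ▷ 𝟙_ A ≫ (λ_ (𝟙_ A)).hom = (λ_ (𝟙_ A)).hom ≫ 𝟙 _ by simp)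
        (show f ▷ X ≫ 𝟙 (Z ⊗ X) = 𝟙 (Y ⊗ X) ≫ f ▷ X by simp)
      μIso_hom_natural_right := fun {Y Z} X f => Prod.hom_ext
        (show 𝟙_ A ◁ 𝟙 (𝟙_ A) ≫ (λ_ (𝟙_ A)).hom = (λ_ (𝟙_ A)).hom ≫ 𝟙 _ by simp)
        (show X ◁ f ≫ 𝟙 (X ⊗ Z) = 𝟙 (X ⊗ Y) ≫ X ◁ f by simp)
      associativity := fun X Y Z => Prod.hom_ext
        (show (λ_ (𝟙_ A)).hom ▷ 𝟙_ A ≫ (λ_ (𝟙_ A)).hom ≫ 𝟙 _ =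
          (α_ _ _ _).hom ≫ 𝟙_ A ◁ (λ_ (𝟙_ A)).hom ≫ (λ_ (𝟙_ A)).hom by monoidal)
        (show 𝟙 (X ⊗ Y) ▷ Z ≫ 𝟙 _ ≫ (α_ X Y Z).hom = (α_ X Y Z).hom ≫ X ◁ 𝟙 (Y ⊗ Z) ≫ 𝟙 _
          by simp)
      left_unitality := fun X => Prod.hom_ext
        (show (λ_ (𝟙_ A)).hom = 𝟙 (𝟙_ A) ▷ 𝟙_ A ≫ (λ_ (𝟙_ A)).hom ≫ 𝟙 _ by simp)
        (show (λ_ X).hom = 𝟙 (𝟙_ M) ▷ X ≫ 𝟙 _ ≫ (λ_ X).hom by simp)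
      right_unitality := fun X => Prod.hom_ext
        (show (ρ_ (𝟙_ A)).hom = 𝟙_ A ◁ 𝟙 (𝟙_ A) ≫ (λ_ (𝟙_ A)).hom ≫ 𝟙 _ by
          simp [unitors_equal])
        (show (ρ_ X).hom = X ◁ 𝟙 (𝟙_ M) ≫ 𝟙 _ ≫ (ρ_ X).hom by simp) }

instance [BraidedCategory A] [BraidedCategory M] : (inclusionRight A M).Braided where
  braided X Y := by
    refine Prod.hom_ext ?_ ?_
    · change (λ_ (𝟙_ A)).hom ≫ 𝟙 _ = (β_ (𝟙_ A) (𝟙_ A)).hom ≫ (λ_ (𝟙_ A)).hom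
      rw [braiding_leftUnitor, Category.comp_id, unitors_equal]
    · change 𝟙 _ ≫ (β_ X Y).hom = (β_ X Y).hom ≫ 𝟙 _
      simp

lemma inclusionRight_twist [BraidedCategory A] [BraidedCategory M] [BalancedCategory A]
    [BalancedCategory M] (Y : M) : (inclusionRight A M).map (BalancedCategory.twist Y).hom =
      (BalancedCategory.twist ((inclusionRight A M).obj Y)).hom :=
  Prod.hom_ext twist_unit.symm rfl

end

/-! ### Images of braided functors -/

section

variable {M : Type*} [Category* M] [UnitaryRibbonFusionCategory M]
  {C : Type*} [Category* C] [UnitaryRibbonFusionCategory C] (J : M ⥤ C)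

/-- The objects isomorphic to an object of the image. -/
def imageProp : ObjectProperty C := fun X => ∃ Y, Nonempty (X ≅ J.obj Y)

variable [J.Braided] [J.Additive] [J.Linear ℂ]

lemma trace_map
    (hJ : ∀ Y, J.map (BalancedCategory.twist Y).hom = (BalancedCategory.twist (J.obj Y)).hom)
    {X : M} (g : X ⟶ X) : trace (J.map g) = trace g := by
  let := mapExactPairing J X Xᘁ
  rw [trace_eq_traceWith (J.obj X) (J.obj Xᘁ), map_traceWith J hJ, ← toScalar_smul (traceWith X Xᘁ g)]
  refine (toScalar_eq ?_).trans (trace_eq_traceWith X Xᘁ g).symm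
  rw [J.map_smul, J.map_id]
  simp

lemma hopf_map
    (hJ : ∀ Y, J.map (BalancedCategory.twist Y).hom = (BalancedCategory.twist (J.obj Y)).hom)
    (X Y : M) : hopf (J.obj X) (J.obj Y) = hopf X Y := by
  rw [hopf, hopf, ← trace_map J hJ, ← trace_conj (Functor.Monoidal.μIso J X Y)]
  congr 1
  simp

variable [J.Full] [J.Faithful]

lemma isFusionSubcategory_imageProp : IsFusionSubcategory (imageProp J) where
  unit := ⟨_, ⟨Functor.Monoidal.εIso J⟩⟩
  tensor := by
    rintro X Y ⟨X', ⟨e⟩⟩ ⟨Y', ⟨e'⟩⟩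
    exact ⟨_, ⟨(e ⊗ᵢ e') ≪≫ Functor.Monoidal.μIso J X' Y'⟩⟩
  dual := by
    rintro X ⟨Y, ⟨e⟩⟩
    let := mapExactPairing J Y Yᘁ
    -- The functor carries dual pairs to dual pairs, and duals are unique up to isomorphism.
    exact ⟨Yᘁ, ⟨rightDualIso (inferInstance : ExactPairing X Xᘁ)
      (exactPairingCongrLeft e)⟩⟩
  biprod := by
    rintro X Y ⟨X', ⟨e⟩⟩ ⟨Y', ⟨e'⟩⟩
    have := preservesBinaryBiproducts_of_preservesBiproducts J
    exact ⟨X' ⊞ Y', ⟨biprod.mapIso e e' ≪≫ (J.mapBiprod X' Y').symm⟩⟩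
  summand := by
    rintro X Y r ⟨Y', ⟨e⟩⟩
    -- Full faithfulness lifts the idempotent of the retract to the source, where it splits; the
    -- image of the splitting is `X`.
    have h : J.preimage (e.inv ≫ r.r ≫ r.i ≫ e.hom) ≫ J.preimage (e.inv ≫ r.r ≫ r.i ≫ e.hom) =
        J.preimage (e.inv ≫ r.r ≫ r.i ≫ e.hom) := by
      apply J.map_injective
      simp
    obtain ⟨Z, i, p, h1, h2⟩ := IsIdempotentComplete.idempotents_split _ _ h
    have h3 : J.map p ≫ J.map i = e.inv ≫ r.r ≫ r.i ≫ e.hom := by rw [← J.map_comp, h2]; simp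
    have h4 : J.map i ≫ J.map p = 𝟙 _ := by rw [← J.map_comp, h1, J.map_id]
    refine ⟨Z, ⟨⟨r.i ≫ e.hom ≫ J.map p, J.map i ≫ e.inv ≫ r.r, ?_, ?_⟩⟩⟩
    · simp only [Category.assoc, reassoc_of% h3]
      simp
    · have h5 : r.r ≫ r.i = e.hom ≫ J.map p ≫ J.map i ≫ e.inv := by
        rw [reassoc_of% h3]; simp
      simp only [Category.assoc, reassoc_of% h5]
      simp [h4]

lemma isModularSubcategory_imageProp (hM : IsModular M)
    (hJ : ∀ Y, J.map (BalancedCategory.twist Y).hom = (BalancedCategory.twist (J.obj Y)).hom) :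
    IsModularSubcategory (imageProp J) :=
  (isModular_iff (isFusionSubcategory_imageProp J) J.obj (fun _ => Iff.rfl)
    (fun X Y => (LinearEquiv.ofBijective (J.mapLinearMap ℂ (X := X) (Y := Y))
      ⟨J.map_injective, J.map_surjective⟩).finrank_eq.symm)
    (hopf_map J hJ)).1 hM

end

/-! ### Lines of super vector spaces -/

namespace SVec

/-- The line of parity `k`. -/
def line : Bool → SVec
  | false => 𝟙_ SVec
  | true => oddLine

/-- The basis of a line. -/
def lineBasis : ∀ k, Module.Basis Unit ℂ (line k).V
  | false => unitBasis
  | true => oddBasis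

lemma par_line (k : Bool) (v : (line k).V) : par (line k) v = sgn k • v := by
  cases k
  · exact (one_smul ℂ _).symm
  · exact par_odd v

lemma hom_line_eq_zero {k l : Bool} (h : k ≠ l) (g : line k ⟶ line l) : g = 0 := by
  refine hom_ext' (LinearMap.ext fun v => ?_)
  have h1 : sgn k • lin g v = sgn l • lin g v := by
    rw [← par_line, ← lin_par, par_line, map_smul]
  rw [← sub_eq_zero, ← sub_smul, smul_eq_zero, sub_eq_zero] at h1
  exact h1.resolve_left fun h2 => h (sgn_injective h2)

/-- The scalar of an endomorphism of a line. -/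
def lineScalar (k : Bool) : (line k ⟶ line k) →ₗ[ℂ] ℂ where
  toFun g := (lineBasis k).coord () (lin g (lineBasis k ()))
  map_add' g h := by rw [lin_add, LinearMap.add_apply, map_add]
  map_smul' c g := by rw [lin_smul, LinearMap.smul_apply, map_smul]; rfl

lemma lineScalar_id (k : Bool) : lineScalar k (𝟙 _) = 1 := by
  change (lineBasis k).coord () (lin (𝟙 (line k)) (lineBasis k ())) = 1
  rw [lin_id, LinearMap.id_apply, Module.Basis.coord_apply, Module.Basis.repr_self,
    Finsupp.single_eq_same]

lemma lineScalar_bijective (k : Bool) : Function.Bijective (lineScalar k) := by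
  constructor
  · intro g h hgh
    refine hom_ext' ((lineBasis k).ext fun i => (lineBasis k).repr.injective (Finsupp.ext fun j => ?_))
    exact hgh
  · intro c
    exact ⟨c • 𝟙 _, by rw [map_smul, lineScalar_id, smul_eq_mul, mul_one]⟩

/-- Endomorphisms of a line are scalars. -/
def lineEquiv (k : Bool) : (line k ⟶ line k) ≃ₗ[ℂ] ℂ :=
  LinearEquiv.ofBijective _ (lineScalar_bijective k)

lemma lineEquiv_symm_one (k : Bool) : (lineEquiv k).symm 1 = 𝟙 _ := by
  rw [LinearEquiv.symm_apply_eq]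
  exact (lineScalar_id k).symm

/-- This reduces the objects `F (V, Y)` of a Deligne product to the case where `V` is an even or odd
line. -/
lemma exists_lines (V : SVec) : ∃ (a : ∀ i, V ⟶ line (degree V i)) (b : ∀ i, line (degree V i) ⟶ V),
    ∑ i, a i ≫ b i = 𝟙 V := by
  have h1 : ∀ i v, (basis V).coord i (par V v) = sgn (degree V i) • (basis V).coord i v := by
    intro i
    refine LinearMap.congr_fun (f := (basis V).coord i ∘ₗ par V)
      (g := sgn (degree V i) • (basis V).coord i) ((basis V).ext fun j => ?_)
    rw [LinearMap.comp_apply, par_basis, map_smul, LinearMap.smul_apply]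
    by_cases hij : j = i
    · rw [hij]
    · simp [hij]
  let a : ∀ i, V ⟶ line (degree V i) := fun i =>
    ofLin (((basis V).coord i).smulRight (lineBasis _ ())) fun v => by
      rw [LinearMap.smulRight_apply, h1, par_line, LinearMap.smulRight_apply, smul_assoc]
  let b : ∀ i, line (degree V i) ⟶ V := fun i =>
    ofLin (((lineBasis _).coord ()).smulRight (basis V i)) fun v => by
      rw [LinearMap.smulRight_apply, par_line, map_smul, LinearMap.smulRight_apply, map_smul,
        par_basis, smul_smul, smul_assoc, smul_smul, mul_comm]
  refine ⟨a, b, ?_⟩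
  let L : (V ⟶ V) →ₗ[ℂ] V.V →ₗ[ℂ] V.V := ⟨⟨lin, lin_add⟩, lin_smul⟩
  refine hom_ext' (LinearMap.ext fun v => ?_)
  change L _ v = v
  rw [map_sum, LinearMap.sum_apply]
  refine Eq.trans (Finset.sum_congr rfl fun i _ => ?_) ((basis V).sum_repr v)
  change lin (b i) (lin (a i) v) = _
  simp only [a, b, lin_ofLin, LinearMap.smulRight_apply, map_smul,
    Module.Basis.coord_apply, Module.Basis.repr_self, Finsupp.single_eq_same, one_smul]

lemma lid_par (v : (oddLine ⊗ oddLine).V) :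
    TensorProduct.lid ℂ ℂ (par (oddLine ⊗ oddLine) v) = TensorProduct.lid ℂ ℂ v := by
  refine LinearMap.congr_fun (f := (TensorProduct.lid ℂ ℂ).toLinearMap ∘ₗ
    par (oddLine ⊗ oddLine)) (g := (TensorProduct.lid ℂ ℂ).toLinearMap)
    (TensorProduct.ext' fun x y => ?_) v
  change TensorProduct.lid ℂ ℂ (par oddLine x ⊗ₜ[ℂ] par oddLine y) = _
  rw [par_odd, par_odd]
  have h : ∀ x y : ℂ, TensorProduct.lid ℂ ℂ ((sgn true • x) ⊗ₜ[ℂ] (sgn true • y)) =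
      TensorProduct.lid ℂ ℂ (x ⊗ₜ[ℂ] y) := fun x y => by simp
  exact h x y

/-- The square of the odd line. -/
def oddSquare : oddLine ⊗ oddLine ≅ 𝟙_ SVec where
  hom := ofLin (TensorProduct.lid ℂ ℂ).toLinearMap lid_par
  inv := ofLin (TensorProduct.lid ℂ ℂ).symm.toLinearMap fun v =>
    (TensorProduct.lid ℂ ℂ).injective (((TensorProduct.lid ℂ ℂ).apply_symm_apply v).trans
      ((lid_par _).trans ((TensorProduct.lid ℂ ℂ).apply_symm_apply v)).symm)
  hom_inv_id := hom_ext' (LinearMap.ext fun v => (TensorProduct.lid ℂ ℂ).symm_apply_apply v)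
  inv_hom_id := hom_ext' (LinearMap.ext fun v => (TensorProduct.lid ℂ ℂ).apply_symm_apply v)

end SVec

/-! ### Deligne products with super vector spaces -/

section

variable {M : Type*} [Category* M] [Preadditive M] [Linear ℂ M] {B : Type*} [Category* B]
  [Preadditive B] [Linear ℂ B] {F : SVec × M ⥤ B}

lemma IsDeligneProduct.map_sum (hF : IsDeligneProduct F) {X X' : SVec} {Y Y' : M} {ι : Type*}
    (s : Finset ι) (a : ι → (X ⟶ X')) (g : Y ⟶ Y') :
    F.map (Prod.mkHom (∑ i ∈ s, a i) g) = ∑ i ∈ s, F.map (Prod.mkHom (a i) g) := by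
  obtain ⟨e, he⟩ := hF.hom_equiv X X' Y Y'
  simp only [← he]
  rw [TensorProduct.sum_tmul, _root_.map_sum]

lemma IsDeligneProduct.hom_eq_zero (hF : IsDeligneProduct F) {k l : Bool} (h : k ≠ l) {Y Y' : M}
    (g : F.obj (SVec.line k, Y) ⟶ F.obj (SVec.line l, Y')) : g = 0 := by
  obtain ⟨e, -⟩ := hF.hom_equiv (SVec.line k) (SVec.line l) Y Y'
  obtain ⟨x, rfl⟩ := e.surjective g
  have hx : x = 0 := by
    induction x using TensorProduct.induction_on with
    | zero => rfl
    | tmul a b => rw [SVec.hom_line_eq_zero h a, TensorProduct.zero_tmul]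
    | add x y hx hy => rw [hx, hy, add_zero]
  rw [hx, map_zero]

/-- Endomorphisms of a line are scalars, so the first tensor factor disappears. -/
lemma IsDeligneProduct.exists_equiv (hF : IsDeligneProduct F) (k : Bool) (Y Y' : M) :
    ∃ e : (Y ⟶ Y') ≃ₗ[ℂ] (F.obj (SVec.line k, Y) ⟶ F.obj (SVec.line k, Y')),
      ∀ g, e g = F.map (Prod.mkHom (𝟙 _) g) := by
  obtain ⟨e, he⟩ := hF.hom_equiv (SVec.line k) (SVec.line k) Y Y'
  refine ⟨(TensorProduct.lid ℂ _).symm ≪≫ₗ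
    TensorProduct.congr (SVec.lineEquiv k).symm (LinearEquiv.refl ℂ _) ≪≫ₗ e, fun g => ?_⟩
  rw [← he, ← SVec.lineEquiv_symm_one]
  rfl

end

/-! ### From a splitting to a modular subcategory of half the dimension. -/

section

variable {C : Type u} [Category.{v} C] [UnitaryRibbonFusionCategory C] {f : C}

/-- A splitting of the trivial sector gives a modular subcategory of half its dimension. -/
theorem exists_modular_of_isSplitSuperModular
    (h : IsSplitSuperModular (trivialSector f).FullSubcategory) :
    ∃ D : ObjectProperty C, D ≤ trivialSector f ∧ IsModularSubcategory D ∧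
      globalDim D = globalDim (trivialSector f) / 2 := by
  obtain ⟨M, _, _, hM, F, _, hF, htw⟩ := h
  have hT := isFusionSubcategory_trivialSector f
  let J : M ⥤ C := inclusionRight SVec M ⋙ F ⋙ (trivialSector f).ι
  have hJt : ∀ Y, J.map (BalancedCategory.twist Y).hom = (BalancedCategory.twist (J.obj Y)).hom := by
    intro Y
    exact congrArg (·.hom) ((congrArg F.map (inclusionRight_twist SVec M Y)).trans (htw _))
  have hE : ∀ Y Y' : M, ∃ e : (Y ⟶ Y') ≃ₗ[ℂ] (J.obj Y ⟶ J.obj Y'), ∀ g, e g = J.map g := by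
    intro Y Y'
    obtain ⟨e, he⟩ := hF.exists_equiv false Y Y'
    exact ⟨e ≪≫ₗ fullHomEquiv _ _ _, fun g => congrArg (·.hom) (he g)⟩
  have : J.Additive := ⟨fun {Y Y' g h} => by
    obtain ⟨e, he⟩ := hE Y Y'
    rw [← he, ← he, ← he, map_add]⟩
  have : J.Linear ℂ := ⟨fun {Y Y'} g c => by
    obtain ⟨e, he⟩ := hE Y Y'
    rw [← he, ← he, map_smul]⟩
  have : J.Full := ⟨fun {Y Y'} g => by
    obtain ⟨e, he⟩ := hE Y Y'
    exact ⟨e.symm g, by rw [← he, e.apply_symm_apply]⟩⟩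
  have : J.Faithful := ⟨fun {Y Y' g h} hgh => by
    obtain ⟨e, he⟩ := hE Y Y'
    rw [← he, ← he] at hgh
    exact e.injective hgh⟩
  have hD := isModularSubcategory_imageProp J hM hJt
  have hD' := hD.toIsFusionSubcategory
  have hle : imageProp J ≤ trivialSector f := by
    rintro X ⟨Y, ⟨e⟩⟩
    exact hT.of_iso e (F.obj (𝟙_ SVec, Y)).property
  refine ⟨imageProp J, hle, hD, ?_⟩
  -- The image of the odd line plays the part of the fermion. Only its order two and its absence
  -- from the image of `J` matter; it need not be identified with `f`.
  let G : (trivialSector f).FullSubcategory := F.obj (SVec.oddLine, 𝟙_ M)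
  let g : C := G.obj
  let e : g ⊗ g ≅ 𝟙_ C := (trivialSector f).ι.mapIso (Functor.Monoidal.μIso F _ _ ≪≫
    F.mapIso (SVec.oddSquare.prod (λ_ (𝟙_ M))) ≪≫ (Functor.Monoidal.εIso F).symm)
  have hg : Simple g := by
    obtain ⟨e, -⟩ := hF.exists_equiv true (𝟙_ M) (𝟙_ M)
    exact (simple_iff_finrank_end g).2 ((e ≪≫ₗ fullHomEquiv _ _ _).finrank_eq.symm.trans
      ((simple_iff_finrank_end _).1 inferInstance))
  have hgD : ¬ imageProp J g := by
    rintro ⟨Y, ⟨i⟩⟩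
    have h1 : (ObjectProperty.homMk i.hom : G ⟶ F.obj (SVec.line false, Y)) = 0 :=
      hF.hom_eq_zero (k := true) (l := false) (by decide) _
    have h2 : i.hom = 0 := congrArg (·.hom) h1
    apply id_nonzero g
    rw [← i.hom_inv_id, h2, zero_comp]
  have hgT : ∀ Y : M, Nonempty ((F.obj (SVec.line true, Y)).obj ≅ g ⊗ J.obj Y) := fun Y =>
    ⟨(trivialSector f).ι.mapIso (F.mapIso ((ρ_ (SVec.line true)).symm.prod (λ_ Y).symm) ≪≫
      (Functor.Monoidal.μIso F (SVec.oddLine, 𝟙_ M) (𝟙_ SVec, Y)).symm)⟩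
  have key : ∀ X, Simple X → (trivialSector f X ↔ imageProp J X ∨ imageProp J (g ⊗ X)) := by
    intro X _
    constructor
    -- Some summand `F (V i, Y i)` maps nontrivially to `X`, hence so does `F` of one of the lines
    -- in `V i`. As `X` is simple it is a retract of that object, and the parity of the line decides
    -- the alternative.
    · intro hX
      obtain ⟨n, V, Y, h⟩ := hF.direct_sum ⟨X, hX⟩
      obtain ⟨p, q, h1, -, -⟩ := h.exists_maps
      have h2 : ∃ i, p i ≫ q i ≠ 0 := by
        by_contra! h0
        simp only [h0, Finset.sum_const_zero] at h1
        exact id_nonzero X (congrArg (·.hom) h1).symm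
      obtain ⟨i, hi⟩ := h2
      obtain ⟨a, b, hab⟩ := SVec.exists_lines (V i)
      have h3 : ∃ j, F.map (Prod.mkHom (a j) (𝟙 (Y i))) ≫ F.map (Prod.mkHom (b j) (𝟙 _)) ≫ q i ≠ 0 := by
        by_contra! h0
        refine hi ?_
        have h4 : (𝟙 (F.obj (V i, Y i))) = ∑ j, F.map (Prod.mkHom (a j) (𝟙 (Y i))) ≫
            F.map (Prod.mkHom (b j) (𝟙 _)) := by
          rw [← F.map_id]
          have := hF.map_sum Finset.univ (fun j => a j ≫ b j) (𝟙 (Y i))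
          rw [hab] at this
          refine this.trans (Finset.sum_congr rfl fun j _ => ?_)
          rw [← F.map_comp]
          congr 1
          exact Prod.hom_ext rfl (Category.id_comp _).symm
        rw [← Category.id_comp (q i), h4, Preadditive.sum_comp]
        simp [h0]
      obtain ⟨j, hj⟩ := h3
      have h5 : F.map (Prod.mkHom (b j) (𝟙 (Y i))) ≫ q i ≠ 0 := fun h0 => hj (by rw [h0, comp_zero])
      have h6 : (F.map (Prod.mkHom (b j) (𝟙 (Y i))) ≫ q i).hom ≠ 0 := fun h0 =>
        h5 (by ext; exact h0)
      obtain ⟨r⟩ := nonempty_retract h6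
      clear h5 h6 hj
      rcases hk : SVec.degree (V i) j with _ | _
      · left
        rw [hk] at r
        exact hD'.summand _ _ r ⟨Y i, ⟨Iso.refl _⟩⟩
      · right
        rw [hk] at r
        -- Tensoring the retract with `g` makes `g ⊗ X` a retract of `g ⊗ (g ⊗ J Y) ≅ J Y`.
        refine hD'.summand _ _ (r.map (tensorLeft g)) (hD'.of_iso
          (whiskerLeftIso g (hgT (Y i)).some ≪≫ tensorSelfIso e _) ⟨Y i, ⟨Iso.refl _⟩⟩)
    · rintro (h | h)
      · exact hle _ h
      · exact hT.of_iso (tensorSelfIso e X).symm (hT.tensor _ _ G.property (hle _ h))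
  rw [globalDim_eq_two_mul hD' e hgD key]
  ring

end

end SpinModular

end

open SpinModular in
theorem mainTheorem7 {C : Type u} [Category.{v} C] [UnitaryRibbonFusionCategory C]
    (hC : IsModular C) (f : C) (hf : IsFermion f) :
    List.TFAE [
      IsSplitSuperModular (trivialSector f).FullSubcategory,
      ∃ D : ObjectProperty C, D ≤ trivialSector f ∧ IsModularSubcategory D ∧
        globalDim D = globalDim (trivialSector f) / 2,
      ∃ A : ObjectProperty C, IsModularSubcategory A ∧ globalDim A = 4 ∧ A f] := by
  tfae_have 1 → 2 := exists_modular_of_isSplitSuperModular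
  tfae_have 2 → 3 := fun ⟨_, hle, hD, hdim⟩ => exists_modular_of_split_dimension hC hf hle hD hdim
  tfae_have 3 → 1 := fun ⟨_, hA, hdim, hfA⟩ => isSplitSuperModular_of_modular hC hf hA hdim hfA
  tfae_finish
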